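/- **Setting.** Let $\mathrm{Cob}^m_n$ be Bar-Natan's graded dotted cobordism category: its objects are formally shifted diagrams $q^k a$, with $a$ a properly embedded $1$-manifold in the rectangle with $m$ boundary points on the top and $n$ on the bottom; its morphisms are $\mathbb{Z}[\alpha]$-linear combinations of dotted cobordisms embedded in (rectangle)$\times[0,1]$, modulo isotopy rel boundary and the local relations: spheres with $0,1,2,3$ dots equal $0,1,0,\alpha$; a neck equals the sum of the two ways of cutting it into two disks with one dot on one of them; a sheet with a handle equals twice a dotted sheet. A cobordism $S$ with $d$ dots from $q^k a$ to $q^l b$ has degree $l-k-\chi(S)+2d+(m+n)/2$, and $\deg\alpha=4$. Let $\mathrm{BN}^m_n$, $(\mathrm{BN}^m_n)^\oplus$, $(\mathrm{BN}^m_n)^\Pi$ be its closures under finite direct sums, countable direct sums (matrices with finite columns) and countable direct products (matrices with finite rows). All complexes are cochain complexes, with differentials, chain maps and homotopies of $q$-degree zero. For complexes $A$ over $\mathrm{BN}^m_k$ and $B$ over $\mathrm{BN}^k_n$, stacking diagrams ($A$ on top of $B$) gives a bicomplex, and $A\otimes B$ over $(\mathrm{BN}^m_n)^\oplus$, respectively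 $A\,\bar\otimes\, B$ over $(\mathrm{BN}^m_n)^\Pi$, is its total complex formed with direct sums, respectively direct products. The dual $A^\vee$ reflects all diagrams in a horizontal line, negates all $q$-shifts and homological degrees, and has differential $-d_A^\vee$. A *universal projector* on $n$ strands is a complex $P_n$ over $\mathrm{BN}^n_n$ in nonpositive degrees whose term in degree zero is the identity diagram $1_n$, such that no shift $q^d1_n$ is a direct summand of a term in another degree, and such that stacking on top or below with a diagram that joins two adjacent points by an arc and is vertical elsewhere (a turnback) makes it contractible. **Proposition (Absorption rule).** Let $x,y,z\ge 0$ be integers and $a=x+y+z$. Let $P_y$ and $P_a$ be universal projectors on $y$ and $a$ strands. For a complex $K$ over $\mathrm{BN}^y_y$ write $\widehat K=1_x\sqcup K\sqcup 1_z$, a complex over $\mathrm{BN}^a_a$. Then there are homotopy equivalences $$\widehat{P_y}\otimes P_a\simeq P_a,\qquad \widehat{P_y^\vee}\,\bar\otimes\,P_a\simeq P_a,\qquad \widehat{P_y^\vee}\otimes P_a^\vee\simeq P_a^\vee,\qquad \widehat{P_y}\otimes P_a^\vee\simeq P_a^\vee,$$ where the first and the third also hold with $\bar\otimes$ in place of $\otimes$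 (there the two totalizations agree), the second uses direct products and the fourth direct sums. The vertical reflections also hold: $$P_a\otimes\widehat{P_y}\simeq P_a,\qquad P_a\,\bar\otimes\,\widehat{P_y^\vee}\simeq P_a,\qquad P_a^\vee\otimes\widehat{P_y^\vee}\simeq P_a^\vee,\qquad P_a^\vee\otimes\widehat{P_y}\simeq P_a^\vee,$$ again the first and the third with either totalization. -/

import Mathlib

open CategoryTheory

set_option linter.unusedSimpArgs false
set_option linter.unusedSectionVars false

/-- The pushout of the sets `A` and `B` along `f : G → A` and `g : G → B`. -/
def Glue {G A B : Type} (f : G → A) (g : G → B) : Type :=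
  Quot (fun x y : A ⊕ B => ∃ t, x = Sum.inl (f t) ∧ y = Sum.inr (g t))

namespace Glue

variable {G A B : Type} {f : G → A} {g : G → B}

def inl (x : A) : Glue f g := Quot.mk _ (Sum.inl x)

def inr (x : B) : Glue f g := Quot.mk _ (Sum.inr x)

theorem cond (t : G) : (inl (f t) : Glue f g) = inr (g t) := Quot.sound ⟨t, rfl, rfl⟩

def lift {D : Type} (u : A → D) (v : B → D) (h : ∀ t, u (f t) = v (g t)) : Glue f g → D :=
  Quot.lift (Sum.elim u v) (by rintro _ _ ⟨t, rfl, rfl⟩; exact h t)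

theorem ind {p : Glue f g → Prop} (hl : ∀ x, p (inl x)) (hr : ∀ x, p (inr x)) (z) : p z := by
  rcases z with ⟨x | x⟩
  exacts [hl x, hr x]

@[simp] theorem lift_inl {D : Type} (u : A → D) (v : B → D) (h) (x : A) :
    (lift u v h : Glue f g → D) (inl x) = u x := rfl

@[simp] theorem lift_inr {D : Type} (u : A → D) (v : B → D) (h) (x : B) :
    (lift u v h : Glue f g → D) (inr x) = v x := rfl

theorem finite [Finite A] [Finite B] : Finite (Glue f g) := Quot.finite _

open Classical in
/-- A connected gluing of `v` pieces needs at least `v - 1` gluing points. -/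
theorem card_le [Fintype G] [Fintype A] [Fintype B] (k : Glue f g) :
    Fintype.card {x : A // (inl x : Glue f g) = k} + Fintype.card {x : B // (inr x : Glue f g) = k}
      ≤ Fintype.card {t : G // (inl (f t) : Glue f g) = k} + 1 := by
  let V := {x : A ⊕ B // (Quot.mk _ x : Glue f g) = k}
  let E := {t : G // (inl (f t) : Glue f g) = k}
  let H : SimpleGraph V := SimpleGraph.fromRel
    (fun x y => ∃ t, x.1 = Sum.inl (f t) ∧ y.1 = Sum.inr (g t))
  have hreach : ∀ x y : A ⊕ B,
      Relation.EqvGen (fun x y : A ⊕ B => ∃ t, x = Sum.inl (f t) ∧ y = Sum.inr (g t)) x y →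
      ∀ (hx : (Quot.mk _ x : Glue f g) = k) (hy : (Quot.mk _ y : Glue f g) = k),
        H.Reachable ⟨x, hx⟩ ⟨y, hy⟩ := by
    intro x y h
    induction h with
    | rel x y h =>
      intro hx hy
      refine SimpleGraph.Adj.reachable ?_
      rw [SimpleGraph.fromRel_adj]
      refine ⟨?_, Or.inl h⟩
      obtain ⟨t, h1, h2⟩ := h
      intro h3
      have := congrArg Subtype.val h3
      simp only [h1, h2] at this
      cases this
    | refl x => intro hx hy; exact SimpleGraph.Reachable.refl _
    | symm x y _ ih => intro hx hy; exact (ih hy hx).symm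
    | trans x y z h1 _ ih1 ih2 =>
      intro hx hz
      have hy : (Quot.mk _ y : Glue f g) = k := by
        rw [← hx]; exact (Quot.eqvGen_sound h1).symm
      exact (ih1 hx hy).trans (ih2 hy hz)
  have hne : Nonempty V := by
    obtain ⟨x, hx⟩ := Quot.exists_rep k
    exact ⟨⟨x, hx⟩⟩
  have hconn : H.Connected := by
    rw [SimpleGraph.connected_iff]
    refine ⟨?_, hne⟩
    rintro ⟨x, hx⟩ ⟨y, hy⟩
    exact hreach x y (Quot.eqvGen_exact (hx.trans hy.symm)) hx hy
  have h1 := hconn.card_vert_le_card_edgeSet_add_one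
  have h2 : Nat.card H.edgeSet ≤ Nat.card E := by
    have hl : ∀ t : E, (Quot.mk _ (Sum.inl (f t.1)) : Glue f g) = k := fun t => t.2
    have hr : ∀ t : E, (Quot.mk _ (Sum.inr (g t.1)) : Glue f g) = k :=
      fun t => (cond t.1).symm.trans t.2
    refine Nat.card_le_card_of_surjective
      (fun t : E => (⟨s(⟨_, hl t⟩, ⟨_, hr t⟩), ?_⟩ : H.edgeSet)) ?_
    · rw [SimpleGraph.mem_edgeSet, SimpleGraph.fromRel_adj]
      refine ⟨?_, Or.inl ⟨t.1, rfl, rfl⟩⟩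
      intro h3
      have := congrArg Subtype.val h3
      cases this
    · rintro ⟨e, he⟩
      induction e using Sym2.ind with
      | _ x y =>
        rw [SimpleGraph.mem_edgeSet, SimpleGraph.fromRel_adj] at he
        obtain ⟨x, hx⟩ := x
        obtain ⟨y, hy⟩ := y
        rcases he with ⟨_, ⟨t, h1, h2⟩ | ⟨t, h1, h2⟩⟩
        · simp only at h1 h2
          subst h1 h2
          exact ⟨⟨t, hx⟩, rfl⟩
        · simp only at h1 h2
          subst h1 h2
          exact ⟨⟨t, hy⟩, Subtype.ext (Sym2.eq_swap)⟩
  have h3 : Nat.card V = Fintype.card {x : A // (inl x : Glue f g) = k}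
      + Fintype.card {x : B // (inr x : Glue f g) = k} := by
    rw [← Fintype.card_sum, ← Nat.card_eq_fintype_card]
    refine Nat.card_congr
      { toFun := fun x => match x with
          | ⟨Sum.inl x, h⟩ => Sum.inl ⟨x, h⟩
          | ⟨Sum.inr x, h⟩ => Sum.inr ⟨x, h⟩
        invFun := fun x => match x with
          | Sum.inl x => ⟨Sum.inl x.1, x.2⟩
          | Sum.inr x => ⟨Sum.inr x.1, x.2⟩
        left_inv := by rintro ⟨x | x, h⟩ <;> rfl
        right_inv := by rintro (x | x) <;> rfl }
  rw [h3] at h1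
  have h4 : Nat.card E = Fintype.card {t : G // (inl (f t) : Glue f g) = k} :=
    Nat.card_eq_fintype_card
  omega

end Glue

/-- The position of a boundary point of the rectangle in the order in which one meets them when
walking along the top edge from left to right and then along the bottom edge from right to left.
`Sum.inl i` is the `i`-th point on the top, `Sum.inr j` the `j`-th point on the bottom. -/
def circPos (m n : ℕ) : Fin m ⊕ Fin n → ℕ :=
  Sum.elim (fun i => i.val) (fun j => m + j.rev.val)

theorem circPos_injective (m n : ℕ) : Function.Injective (circPos m n) := by
  rintro (i | i) (j | j) h <;> simp [circPos, Fin.ext_iff] at h ⊢ <;> omega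

/-- A planar 1-manifold in the rectangle with `m` boundary points on the top and `n` on the bottom:
`K` is its set of components, `bd` sends a boundary point to the component that contains it.
A component is an arc (two boundary points) or a circle (none), and arcs do not cross. The positions
of the circles are not recorded: by the neck relation below, diagrams that differ only in these
positions are isomorphic, and cobordisms with the same topological type are equal. -/
structure Curve (m n : ℕ) where
  K : Type
  finite : Finite K
  bd : Fin m ⊕ Fin n → K
  ends : ∀ k, Nat.card {p // bd p = k} = 0 ∨ Nat.card {p // bd p = k} = 2
  planar : ∀ p q r s, circPos m n p < circPos m n q → circPos m n q < circPos m n r →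
    circPos m n r < circPos m n s → bd p = bd r → bd q = bd s → bd p = bd q

namespace Curve

attribute [instance] Curve.finite

section parity
open Classical

/-- The indicator of a proposition. -/
noncomputable def ind (R : Type) [Zero R] [One R] (p : Prop) : R := if p then 1 else 0

theorem ind_pos {R : Type} [Zero R] [One R] {p : Prop} (h : p) : ind R p = 1 := if_pos h

theorem ind_neg {R : Type} [Zero R] [One R] {p : Prop} (h : ¬ p) : ind R p = 0 := if_neg h

variable {P K : Type} [Fintype P]

theorem natCard_fiber (b : P → K) (k : K) :
    Nat.card {p // b p = k} = ∑ p, ind ℕ (b p = k) := by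
  unfold ind
  rw [Nat.card_eq_fintype_card, Fintype.card_subtype, Finset.card_filter]

/-- The parity of the number of crossings of the chords `e` and `f`. -/
noncomputable def cross (pos : P → ℕ) (b : P → K) (e f : K) : ZMod 2 :=
  ∑ p, ∑ q, ind (ZMod 2) (b p = e) * ind (ZMod 2) (b q = f) * ind (ZMod 2) (pos p < pos q)

theorem cross_eq_sum (pos : P → ℕ) (b : P → K) (e f : K) :
    cross pos b e f = ∑ p ∈ Finset.univ.filter (b · = e), ∑ q ∈ Finset.univ.filter (b · = f),
      ind (ZMod 2) (pos p < pos q) := by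
  unfold cross ind
  rw [Finset.sum_filter]
  refine Finset.sum_congr rfl fun p _ => ?_
  rw [Finset.sum_filter]
  split_ifs with h
  · refine Finset.sum_congr rfl fun q _ => ?_
    split_ifs <;> simp
  · simp

theorem card_filter_fiber (b : P → K) (k : K) :
    (Finset.univ.filter (b · = k)).card = Nat.card {p // b p = k} := by
  rw [Nat.card_eq_fintype_card, Fintype.card_subtype]

theorem planar_iff (pos : P → ℕ) (hpos : Function.Injective pos) (b : P → K)
    (ends : ∀ k, Nat.card {p // b p = k} = 0 ∨ Nat.card {p // b p = k} = 2) :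
    (∀ p q r s, pos p < pos q → pos q < pos r → pos r < pos s → b p = b r → b q = b s →
      b p = b q) ↔ ∀ e f, e ≠ f → cross pos b e f = 0 := by
  have key : ∀ p r : P, p ≠ r → b p = b r →
      Finset.univ.filter (b · = b p) = {p, r} := by
    intro p r hpr hb
    symm
    apply Finset.eq_of_subset_of_card_le
    · intro x hx
      simp only [Finset.mem_insert, Finset.mem_singleton] at hx
      rcases hx with rfl | rfl <;> simp [hb]
    · rw [card_filter_fiber, Finset.card_pair hpr]
      rcases ends (b p) with h | h <;> omega
  constructor
  · intro h e f hef
    rw [cross_eq_sum]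
    rcases ends e with he | he
    · rw [← card_filter_fiber, Finset.card_eq_zero] at he
      rw [he, Finset.sum_empty]
    rcases ends f with hf | hf
    · rw [← card_filter_fiber, Finset.card_eq_zero] at hf
      simp [hf]
    rw [← card_filter_fiber, Finset.card_eq_two] at he hf
    obtain ⟨p, r, hpr, he⟩ := he
    obtain ⟨q, s, hqs, hf⟩ := hf
    have hp : b p = e := by
      have : p ∈ Finset.univ.filter (b · = e) := by rw [he]; simp
      simpa using this
    have hr : b r = e := by
      have : r ∈ Finset.univ.filter (b · = e) := by rw [he]; simp
      simpa using this
    have hq : b q = f := by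
      have : q ∈ Finset.univ.filter (b · = f) := by rw [hf]; simp
      simpa using this
    have hs : b s = f := by
      have : s ∈ Finset.univ.filter (b · = f) := by rw [hf]; simp
      simpa using this
    rw [he, hf, Finset.sum_pair hpr, Finset.sum_pair hqs, Finset.sum_pair hqs]
    unfold ind
    have n1 : pos p ≠ pos r := fun h => hpr (hpos h)
    have n2 : pos q ≠ pos s := fun h => hqs (hpos h)
    have n3 : pos p ≠ pos q := fun h => hef (by rw [← hp, ← hq, hpos h])
    have n4 : pos p ≠ pos s := fun h => hef (by rw [← hp, ← hs, hpos h])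
    have n5 : pos r ≠ pos q := fun h => hef (by rw [← hr, ← hq, hpos h])
    have n6 : pos r ≠ pos s := fun h => hef (by rw [← hr, ← hs, hpos h])
    have c1 : ∀ w x y z, ({w, y} : Finset P) = {p, r} → ({x, z} : Finset P) = {q, s} →
        ¬ (pos w < pos x ∧ pos x < pos y ∧ pos y < pos z) := by
      rintro w x y z h1 h2 ⟨l1, l2, l3⟩
      have hw : b w = e := by
        have : w ∈ Finset.univ.filter (b · = e) := by rw [he, ← h1]; simp
        simpa using this
      have hy : b y = e := by
        have : y ∈ Finset.univ.filter (b · = e) := by rw [he, ← h1]; simp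
        simpa using this
      have hx : b x = f := by
        have : x ∈ Finset.univ.filter (b · = f) := by rw [hf, ← h2]; simp
        simpa using this
      have hz : b z = f := by
        have : z ∈ Finset.univ.filter (b · = f) := by rw [hf, ← h2]; simp
        simpa using this
      exact hef (by rw [← hw, ← hx]; exact h w x y z l1 l2 l3 (hw.trans hy.symm) (hx.trans hz.symm))
    have c2 : ∀ w x y z, ({w, y} : Finset P) = {q, s} → ({x, z} : Finset P) = {p, r} →
        ¬ (pos w < pos x ∧ pos x < pos y ∧ pos y < pos z) := by
      rintro w x y z h1 h2 ⟨l1, l2, l3⟩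
      have hw : b w = f := by
        have : w ∈ Finset.univ.filter (b · = f) := by rw [hf, ← h1]; simp
        simpa using this
      have hy : b y = f := by
        have : y ∈ Finset.univ.filter (b · = f) := by rw [hf, ← h1]; simp
        simpa using this
      have hx : b x = e := by
        have : x ∈ Finset.univ.filter (b · = e) := by rw [he, ← h2]; simp
        simpa using this
      have hz : b z = e := by
        have : z ∈ Finset.univ.filter (b · = e) := by rw [he, ← h2]; simp
        simpa using this
      exact hef (by
        rw [← hw, ← hx]; exact (h w x y z l1 l2 l3 (hw.trans hy.symm) (hx.trans hz.symm)).symm)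
    have a1 := c1 p q r s rfl rfl
    have a2 := c1 p s r q rfl (Finset.pair_comm _ _)
    have a3 := c1 r q p s (Finset.pair_comm _ _) rfl
    have a4 := c1 r s p q (Finset.pair_comm _ _) (Finset.pair_comm _ _)
    have b1 := c2 q p s r rfl rfl
    have b2 := c2 q r s p rfl (Finset.pair_comm _ _)
    have b3 := c2 s p q r (Finset.pair_comm _ _) rfl
    have b4 := c2 s r q p (Finset.pair_comm _ _) (Finset.pair_comm _ _)
    clear c1 c2 key h hp hq hr hs he hf
    generalize pos p = x1 at *
    generalize pos q = x2 at *
    generalize pos r = x3 at *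
    generalize pos s = x4 at *
    split_ifs <;> first | decide | (exfalso; omega)
  · intro h p q r s l1 l2 l3 h1 h2
    by_contra hne
    have h0 := h _ _ hne
    rw [cross_eq_sum, key p r (by rintro rfl; omega) h1, key q s (by rintro rfl; omega) h2,
      Finset.sum_pair (by rintro rfl; omega), Finset.sum_pair (by rintro rfl; omega),
      Finset.sum_pair (by rintro rfl; omega), ind_pos l1, ind_pos (by omega), ind_neg (by omega),
      ind_pos l3] at h0
    exact absurd h0 (by decide)


theorem sum_fiber [Fintype K] (b : P → K)
    (ends : ∀ k, Nat.card {p // b p = k} = 0 ∨ Nat.card {p // b p = k} = 2)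
    (S : K → Prop) :
    ∃ U ≤ Fintype.card {e // S e}, ∑ p, ind ℕ (S (b p)) = 2 * U := by
  refine ⟨∑ e with S e, Nat.card {p // b p = e} / 2, ?_, ?_⟩
  · rw [Fintype.card_subtype, Finset.card_eq_sum_ones]
    refine Finset.sum_le_sum fun e _ => ?_
    rcases ends e with h | h <;> omega
  · rw [← Finset.sum_fiberwise Finset.univ b, Finset.sum_filter, Finset.mul_sum]
    refine Finset.sum_congr rfl fun e _ => ?_
    have : ∀ p ∈ Finset.univ.filter (b · = e), ind ℕ (S (b p)) = ind ℕ (S e) := by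
      intro p hp
      simp only [Finset.mem_filter, Finset.mem_univ, true_and] at hp
      rw [hp]
    rw [Finset.sum_congr rfl this, Finset.sum_const, card_filter_fiber]
    unfold ind
    split_ifs
    · rw [smul_eq_mul, mul_one]
      rcases ends e with h | h <;> rw [h] <;> rfl
    · simp

theorem sum_cross [Finite K] (pos : P → ℕ) (b : P → K)
    (h : ∀ e f, e ≠ f → cross pos b e f = 0) (u v : K → ZMod 2) (huv : ∀ e, u e * v e = 0) :
    ∑ p, ∑ q, u (b p) * v (b q) * ind (ZMod 2) (pos p < pos q) = 0 := by
  have := Fintype.ofFinite K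
  have h1 : ∑ e, ∑ f, u e * v f * cross pos b e f = 0 := by
    refine Finset.sum_eq_zero fun e _ => Finset.sum_eq_zero fun f _ => ?_
    by_cases hef : e = f
    · subst hef; rw [huv, zero_mul]
    · rw [h e f hef, mul_zero]
  rw [← h1]
  simp only [cross_eq_sum]
  refine (Finset.sum_fiberwise Finset.univ b _).symm.trans ?_
  refine Finset.sum_congr rfl fun e _ => ?_
  simp only [Finset.mul_sum]
  rw [Finset.sum_comm (s := (Finset.univ : Finset K))]
  refine Finset.sum_congr rfl fun p hp => ?_
  refine (Finset.sum_fiberwise Finset.univ b _).symm.trans ?_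
  refine Finset.sum_congr rfl fun f _ => ?_
  refine Finset.sum_congr rfl fun q hq => ?_
  simp only [Finset.mem_filter, Finset.mem_univ, true_and] at hp hq
  rw [hp, hq]

end parity

theorem two_dvd {m n : ℕ} (a : Curve m n) (S : a.K → Prop) :
    ∑ p, ind (ZMod 2) (S (a.bd p)) = 0 := by
  have := Fintype.ofFinite a.K
  obtain ⟨U, -, hU⟩ := sum_fiber a.bd a.ends S
  have := congrArg (Nat.cast : ℕ → ZMod 2) hU
  have hc : ∀ p : Prop, ((ind ℕ p : ℕ) : ZMod 2) = ind (ZMod 2) p := by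
    intro p; unfold ind; split_ifs <;> simp
  push_cast at this
  simp only [hc] at this
  rw [this, show (2 : ZMod 2) = 0 from rfl, zero_mul]

theorem cross_zero {m n : ℕ} (a : Curve m n) :
    ∀ e f, e ≠ f → cross (circPos m n) a.bd e f = 0 :=
  (planar_iff _ (circPos_injective m n) a.bd a.ends).1 a.planar

/-- Vertical stacking: `a` is placed on top of `b`. -/
@[reducible] def stack {m k n : ℕ} (a : Curve m k) (b : Curve k n) : Curve m n :=
  have ends : ∀ e : Glue (fun i => a.bd (Sum.inr i)) (fun i => b.bd (Sum.inl i)),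
      Nat.card {p // (Sum.elim (fun i => Glue.inl (a.bd (Sum.inl i)))
        (fun i => Glue.inr (b.bd (Sum.inr i))) : Fin m ⊕ Fin n → _) p = e} = 0 ∨
      Nat.card {p // (Sum.elim (fun i => Glue.inl (a.bd (Sum.inl i)))
        (fun i => Glue.inr (b.bd (Sum.inr i))) : Fin m ⊕ Fin n → _) p = e} = 2 := by
    classical
    intro e
    have := Fintype.ofFinite a.K
    have := Fintype.ofFinite b.K
    obtain ⟨U, hU, hU'⟩ := sum_fiber a.bd a.ends (fun x =>
      (Glue.inl x : Glue (fun i => a.bd (Sum.inr i)) (fun i => b.bd (Sum.inl i))) = e)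
    obtain ⟨V, hV, hV'⟩ := sum_fiber b.bd b.ends (fun x =>
      (Glue.inr x : Glue (fun i => a.bd (Sum.inr i)) (fun i => b.bd (Sum.inl i))) = e)
    have hc := Glue.card_le e
    rw [natCard_fiber]
    rw [Fintype.sum_sum_type] at hU' hV' ⊢
    simp only [Sum.elim_inl, Sum.elim_inr]
    rw [← Nat.card_eq_fintype_card (α := {t // Glue.inl (a.bd (Sum.inr t)) = e}), natCard_fiber] at hc
    simp only [← Glue.cond] at hV'
    omega
  { K := Glue (fun i => a.bd (Sum.inr i)) (fun i => b.bd (Sum.inl i))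
    finite := Glue.finite
    bd := Sum.elim (fun i => Glue.inl (a.bd (Sum.inl i))) (fun i => Glue.inr (b.bd (Sum.inr i)))
    ends := ends
    planar := by
      classical
      rw [planar_iff _ (circPos_injective m n) _ ends]
      intro e f hef
      let G := Glue (fun i => a.bd (Sum.inr i)) (fun i => b.bd (Sum.inl i))
      have huv : ∀ x : G, ind (ZMod 2) (x = e) * ind (ZMod 2) (x = f) = 0 := by
        intro x
        unfold ind
        split_ifs with h1 h2
        · exact absurd (h1.symm.trans h2) hef
        all_goals simp
      have h1 := sum_cross _ _ a.cross_zero (fun x => ind (ZMod 2) ((Glue.inl x : G) = e))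
        (fun x => ind (ZMod 2) ((Glue.inl x : G) = f)) (fun x => huv _)
      have h2 := sum_cross _ _ b.cross_zero (fun x => ind (ZMod 2) ((Glue.inr x : G) = e))
        (fun x => ind (ZMod 2) ((Glue.inr x : G) = f)) (fun x => huv _)
      have a1 := a.two_dvd (fun x => (Glue.inl x : G) = e)
      unfold cross
      simp only [Fintype.sum_sum_type, Sum.elim_inl, Sum.elim_inr, circPos, ← Glue.cond]
        at h1 h2 a1 ⊢
      have e1 : ∀ (x : ℕ) (i : Fin x) (j : ℕ), ind (ZMod 2) ((i : ℕ) < x + j) = 1 :=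
        fun x i j => ind_pos (by omega)
      have e2 : ∀ (x : ℕ) (i : Fin x) (j : ℕ), ind (ZMod 2) (x + j < (i : ℕ)) = 0 :=
        fun x i j => ind_neg (by omega)
      simp only [e1, e2, mul_one, mul_zero, Finset.sum_const_zero, zero_add,
        Finset.sum_add_distrib, ← Finset.mul_sum, ← Finset.sum_mul, add_lt_add_iff_left,
        Fin.val_fin_lt, Fin.rev_lt_rev] at h1 h2 ⊢
      have hm : (∑ x : Fin k, ∑ y : Fin k, ind (ZMod 2) ((Glue.inl (a.bd (Sum.inr x)) : G) = e) *
              ind (ZMod 2) ((Glue.inl (a.bd (Sum.inr y)) : G) = f) * ind (ZMod 2) (y < x))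
          + (∑ x : Fin k, ∑ y : Fin k, ind (ZMod 2) ((Glue.inl (a.bd (Sum.inr x)) : G) = e) *
              ind (ZMod 2) ((Glue.inl (a.bd (Sum.inr y)) : G) = f) * ind (ZMod 2) (x < y))
          = (∑ x : Fin k, ind (ZMod 2) ((Glue.inl (a.bd (Sum.inr x)) : G) = e)) *
            (∑ x : Fin k, ind (ZMod 2) ((Glue.inl (a.bd (Sum.inr x)) : G) = f)) := by
        rw [Finset.sum_mul_sum, ← Finset.sum_add_distrib]
        refine Finset.sum_congr rfl fun x _ => ?_
        rw [← Finset.sum_add_distrib]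
        refine Finset.sum_congr rfl fun y _ => ?_
        rcases lt_trichotomy x y with h | h | h
        · rw [ind_pos h, ind_neg h.not_gt]; ring
        · subst h; rw [huv]; simp
        · rw [ind_pos h, ind_neg h.not_gt]; ring
      have two : (2 : ZMod 2) = 0 := rfl
      linear_combination h1 + h2 - hm
        + ((∑ i : Fin n, ind (ZMod 2) ((Glue.inr (b.bd (Sum.inr i)) : G) = f))
          - ∑ i : Fin k, ind (ZMod 2) ((Glue.inl (a.bd (Sum.inr i)) : G) = f)) * a1
        - (∑ i : Fin k, ind (ZMod 2) ((Glue.inl (a.bd (Sum.inr i)) : G) = e))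
          * (∑ i : Fin n, ind (ZMod 2) ((Glue.inr (b.bd (Sum.inr i)) : G) = f)) * two }

end Curve



namespace Curve

/-- Vertical strands: the identity diagram `1_n`. -/
@[reducible] def one (n : ℕ) : Curve n n where
  K := Fin n
  finite := inferInstance
  bd := Sum.elim id id
  ends k := by
    right
    have h : ∑ x : Fin n, ind ℕ (x = k) = 1 := by
      rw [Finset.sum_eq_single k (fun x _ hx => ind_neg hx) (by simp), ind_pos rfl]
    rw [natCard_fiber, Fintype.sum_sum_type]
    simp only [Sum.elim_inl, Sum.elim_inr, id_eq, h]
  planar := by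
    rintro (p | p) (q | q) (r | r) (s | s) h1 h2 h3 h4 h5 <;>
      simp only [circPos, Sum.elim_inl, Sum.elim_inr, id_eq, Fin.val_rev] at h1 h2 h3 h4 h5 ⊢ <;>
      subst h4 h5 <;> omega

/-- A circle in the rectangle without boundary points. -/
@[reducible] def circle : Curve 0 0 where
  K := Unit
  finite := inferInstance
  bd := fun _ => ()
  ends _ := by left; simp
  planar _ _ _ _ _ _ _ _ _ := rfl

/-- The arc that joins two points on the bottom. -/
@[reducible] def cap : Curve 0 2 where
  K := Unit
  finite := inferInstance
  bd := fun _ => ()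
  ends _ := by right; simp
  planar _ _ _ _ _ _ _ _ _ := rfl

/-- The arc that joins two points on the top. -/
@[reducible] def cup : Curve 2 0 where
  K := Unit
  finite := inferInstance
  bd := fun _ => ()
  ends _ := by right; simp
  planar _ _ _ _ _ _ _ _ _ := rfl

theorem ind_inl_inl (R : Type) [Zero R] [One R] {A B : Type} (x y : A) :
    ind R ((Sum.inl x : A ⊕ B) = Sum.inl y) = ind R (x = y) :=
  congrArg _ (propext Sum.inl_injective.eq_iff)

theorem ind_inr_inr (R : Type) [Zero R] [One R] {A B : Type} (x y : B) :
    ind R ((Sum.inr x : A ⊕ B) = Sum.inr y) = ind R (x = y) :=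
  congrArg _ (propext Sum.inr_injective.eq_iff)

theorem ind_inl_inr (R : Type) [Zero R] [One R] {A B : Type} (x : A) (y : B) :
    ind R ((Sum.inl x : A ⊕ B) = Sum.inr y) = 0 := ind_neg (by simp)

theorem ind_inr_inl (R : Type) [Zero R] [One R] {A B : Type} (x : A) (y : B) :
    ind R ((Sum.inr y : A ⊕ B) = Sum.inl x) = 0 := ind_neg (by simp)

/-- Horizontal juxtaposition: `a` is placed to the left of `b`. -/
@[reducible] def juxt {m n m' n' : ℕ} (a : Curve m n) (b : Curve m' n') : Curve (m + m') (n + n') :=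
  have ends : ∀ k, Nat.card {p // (Sum.elim
        (Fin.addCases (fun i => Sum.inl (a.bd (Sum.inl i))) (fun i => Sum.inr (b.bd (Sum.inl i))))
        (Fin.addCases (fun i => Sum.inl (a.bd (Sum.inr i))) (fun i => Sum.inr (b.bd (Sum.inr i))))
        : Fin (m + m') ⊕ Fin (n + n') → a.K ⊕ b.K) p = k} = 0 ∨
      Nat.card {p // (Sum.elim
        (Fin.addCases (fun i => Sum.inl (a.bd (Sum.inl i))) (fun i => Sum.inr (b.bd (Sum.inl i))))
        (Fin.addCases (fun i => Sum.inl (a.bd (Sum.inr i))) (fun i => Sum.inr (b.bd (Sum.inr i))))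
        : Fin (m + m') ⊕ Fin (n + n') → a.K ⊕ b.K) p = k} = 2 := by
    rintro (k | k)
    · have h := a.ends k
      rw [natCard_fiber, Fintype.sum_sum_type] at h ⊢
      simp only [Fin.sum_univ_add, Sum.elim_inl, Sum.elim_inr, Fin.addCases_left,
        Fin.addCases_right, ind_inl_inl, ind_inr_inr, ind_inl_inr, ind_inr_inl,
        Finset.sum_const_zero, add_zero, zero_add]
      exact h
    · have h := b.ends k
      rw [natCard_fiber, Fintype.sum_sum_type] at h ⊢
      simp only [Fin.sum_univ_add, Sum.elim_inl, Sum.elim_inr, Fin.addCases_left,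
        Fin.addCases_right, ind_inl_inl, ind_inr_inr, ind_inl_inr, ind_inr_inl,
        Finset.sum_const_zero, add_zero, zero_add]
      exact h
  { K := a.K ⊕ b.K
    finite := inferInstance
    bd := Sum.elim
      (Fin.addCases (fun i => Sum.inl (a.bd (Sum.inl i))) (fun i => Sum.inr (b.bd (Sum.inl i))))
      (Fin.addCases (fun i => Sum.inl (a.bd (Sum.inr i))) (fun i => Sum.inr (b.bd (Sum.inr i))))
    ends := ends
    planar := by
      rw [planar_iff _ (circPos_injective _ _) _ ends]
      have b1 : ∀ (x y z : ℕ) (i : Fin x) (j : Fin y),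
          ind (ZMod 2) (z + ((Fin.castAdd y i).rev : ℕ) < z + ((Fin.natAdd x j).rev : ℕ)) = 0 :=
        fun x y z i j => ind_neg (by simp only [Fin.val_rev, Fin.val_castAdd, Fin.val_natAdd]; omega)
      have b2 : ∀ (x y z : ℕ) (i : Fin x) (j : Fin y),
          ind (ZMod 2) (z + ((Fin.natAdd x j).rev : ℕ) < z + ((Fin.castAdd y i).rev : ℕ)) = 1 :=
        fun x y z i j => ind_pos (by simp only [Fin.val_rev, Fin.val_castAdd, Fin.val_natAdd]; omega)
      have t1 : ∀ (x y z : ℕ) (i : Fin (x + y)), ind (ZMod 2) ((i : ℕ) < x + y + z) = 1 :=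
        fun x y z i => ind_pos (by omega)
      have t2 : ∀ (x y z : ℕ) (i : Fin (x + y)), ind (ZMod 2) (x + y + z < (i : ℕ)) = 0 :=
        fun x y z i => ind_neg (by omega)
      have t3 : ∀ (x y : ℕ) (i : Fin x) (j : Fin y),
          ind (ZMod 2) ((Fin.castAdd y i : ℕ) < (Fin.natAdd x j : ℕ)) = 1 :=
        fun x y i j => ind_pos (by simp only [Fin.val_castAdd, Fin.val_natAdd]; omega)
      have t4 : ∀ (x y : ℕ) (i : Fin x) (j : Fin y),
          ind (ZMod 2) ((Fin.natAdd x j : ℕ) < (Fin.castAdd y i : ℕ)) = 0 :=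
        fun x y i j => ind_neg (by simp only [Fin.val_castAdd, Fin.val_natAdd]; omega)
      have u1 : ∀ (x y z : ℕ) (i j : Fin x),
          ind (ZMod 2) (z + ((Fin.castAdd y i).rev : ℕ) < z + ((Fin.castAdd y j).rev : ℕ)) =
          ind (ZMod 2) (j < i) := fun x y z i j => congrArg _ (propext (by
            simp only [Fin.val_rev, Fin.val_castAdd, Fin.lt_def]; omega))
      have u2 : ∀ (x y z : ℕ) (i j : Fin y),
          ind (ZMod 2) (z + ((Fin.natAdd x i).rev : ℕ) < z + ((Fin.natAdd x j).rev : ℕ)) =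
          ind (ZMod 2) (j < i) := fun x y z i j => congrArg _ (propext (by
            simp only [Fin.val_rev, Fin.val_natAdd, Fin.lt_def]; omega))
      have u3 : ∀ (x y : ℕ) (i j : Fin x),
          ind (ZMod 2) ((Fin.castAdd y i : ℕ) < (Fin.castAdd y j : ℕ)) =
          ind (ZMod 2) (i < j) := fun x y i j => congrArg _ (propext (by
            simp only [Fin.val_castAdd, Fin.lt_def]))
      have u4 : ∀ (x y : ℕ) (i j : Fin y),
          ind (ZMod 2) ((Fin.natAdd x i : ℕ) < (Fin.natAdd x j : ℕ)) =
          ind (ZMod 2) (i < j) := fun x y i j => congrArg _ (propext (by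
            simp only [Fin.val_natAdd, Fin.lt_def]; omega))
      have u5 : ∀ (x y : ℕ) (i j : Fin y),
          ind (ZMod 2) (Fin.natAdd x i < Fin.natAdd x j) =
          ind (ZMod 2) (i < j) := fun x y i j => congrArg _ (propext (by
            simp only [Fin.val_natAdd, Fin.lt_def]; omega))
      have e1 : ∀ (x : ℕ) (i : Fin x) (j : ℕ), ind (ZMod 2) ((i : ℕ) < x + j) = 1 :=
        fun x i j => ind_pos (by omega)
      have e2 : ∀ (x : ℕ) (i : Fin x) (j : ℕ), ind (ZMod 2) (x + j < (i : ℕ)) = 0 :=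
        fun x i j => ind_neg (by omega)
      rintro (e | e) (f | f) hef
      · have h := a.cross_zero e f (fun h => hef (congrArg _ h))
        unfold cross at h ⊢
        simp only [Fintype.sum_sum_type, Sum.elim_inl, Sum.elim_inr, circPos, Fin.sum_univ_add,
          Fin.addCases_left, Fin.addCases_right, ind_inl_inl, ind_inr_inr, ind_inl_inr, ind_inr_inl, b1, b2, t1, t2, t3, t4, u1, u2,
          u3, u4, u5, e1, e2, mul_zero, zero_mul, mul_one, Finset.sum_const_zero, add_zero, zero_add,
          add_lt_add_iff_left, Fin.val_fin_lt, Fin.rev_lt_rev] at h ⊢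
        exact h
      · have h := b.two_dvd (fun x => x = f)
        unfold cross
        simp only [Fintype.sum_sum_type, Sum.elim_inl, Sum.elim_inr, circPos, Fin.sum_univ_add,
          Fin.addCases_left, Fin.addCases_right, ind_inl_inl, ind_inr_inr, ind_inl_inr, ind_inr_inl, b1, b2, t1, t2, t3, t4, u1, u2,
          u3, u4, u5, e1, e2, mul_zero, zero_mul, mul_one, Finset.sum_const_zero, add_zero, zero_add,
          ← Finset.mul_sum, ← Finset.sum_mul, Finset.sum_add_distrib] at h ⊢
        rw [← mul_add, h, mul_zero]
      · have h := a.two_dvd (fun x => x = f)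
        have h' := b.two_dvd (fun x => x = e)
        unfold cross
        simp only [Fintype.sum_sum_type, Sum.elim_inl, Sum.elim_inr, circPos, Fin.sum_univ_add,
          Fin.addCases_left, Fin.addCases_right, ind_inl_inl, ind_inr_inr, ind_inl_inr, ind_inr_inl, b1, b2, t1, t2, t3, t4, u1, u2,
          u3, u4, u5, e1, e2, mul_zero, zero_mul, mul_one, Finset.sum_const_zero, add_zero, zero_add,
          ← Finset.mul_sum, ← Finset.sum_mul, Finset.sum_add_distrib] at h h' ⊢
        rw [← add_mul, h', zero_mul]
      · have h := b.cross_zero e f (fun h => hef (congrArg _ h))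
        unfold cross at h ⊢
        simp only [Fintype.sum_sum_type, Sum.elim_inl, Sum.elim_inr, circPos, Fin.sum_univ_add,
          Fin.addCases_left, Fin.addCases_right, ind_inl_inl, ind_inr_inr, ind_inl_inr, ind_inr_inl, b1, b2, t1, t2, t3, t4, u1, u2,
          u3, u4, u5, e1, e2, mul_zero, zero_mul, mul_one, Finset.sum_const_zero, add_zero, zero_add,
          add_lt_add_iff_left, Fin.val_fin_lt, Fin.rev_lt_rev] at h ⊢
        exact h }

/-- `1_x ⊔ a ⊔ 1_z`. -/
def widen (x z : ℕ) {m n : ℕ} (a : Curve m n) : Curve (x + m + z) (x + n + z) :=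
  ((one x).juxt a).juxt (one z)

/-- Reflection in a horizontal line. -/
@[reducible] def dual {m n : ℕ} (a : Curve m n) : Curve n m where
  K := a.K
  finite := a.finite
  bd := a.bd ∘ Sum.swap
  ends k := by
    have h : Nat.card {p // (a.bd ∘ Sum.swap) p = k} = Nat.card {p // a.bd p = k} :=
      Nat.card_congr ((Equiv.sumComm _ _).subtypeEquiv fun p => Iff.rfl)
    rw [h]
    exact a.ends k
  planar := by
    have h : ∀ p, circPos m n p.swap + circPos n m p + 1 = m + n := by
      rintro (i | i) <;> simp only [circPos, Sum.swap, Sum.elim_inl, Sum.elim_inr, Fin.val_rev] <;>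
        omega
    intro p q r s h1 h2 h3 h4 h5
    have hp := h p
    have hq := h q
    have hr := h r
    have hs := h s
    exact (h4.trans (a.planar s.swap r.swap q.swap p.swap (by omega) (by omega) (by omega)
      h5.symm h4.symm).symm).trans h5.symm

/-- Transport along an equality of the numbers of boundary points. -/
def cast {m n m' n' : ℕ} (hm : m = m') (hn : n = n') (a : Curve m n) : Curve m' n' where
  K := a.K
  finite := a.finite
  bd := a.bd ∘ Sum.map (Fin.cast hm.symm) (Fin.cast hn.symm)
  ends := by subst hm hn; simpa using a.ends
  planar := by subst hm hn; simpa using a.planar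

end Curve



namespace Curve

variable {m n k m' n' : ℕ}

/-- The Euler characteristic of each component: `1` for arcs, `0` for circles. -/
noncomputable def chi (a : Curve m n) : a.K →₀ ℤ :=
  Finsupp.equivFunOnFinite.symm fun k => ind ℤ (∃ p, a.bd p = k)

theorem two_chi (a : Curve m n) : 2 • a.chi = ∑ p, Finsupp.single (a.bd p) 1 := by
  classical
  ext k
  have hs : (∑ p, Finsupp.single (a.bd p) (1 : ℤ)) k = (Nat.card {p // a.bd p = k} : ℕ) := by
    rw [natCard_fiber, Finsupp.finsetSum_apply, Nat.cast_sum]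
    refine Finset.sum_congr rfl fun p _ => ?_
    rw [Finsupp.single_apply]
    unfold ind
    split_ifs <;> simp
  rw [hs]
  simp only [chi, Finsupp.coe_smul, Pi.smul_apply, Finsupp.equivFunOnFinite_symm_apply_apply]
  rcases a.ends k with h | h <;> rw [h]
  · rw [ind_neg]; · simp
    rintro ⟨p, hp⟩
    rw [Nat.card_eq_zero] at h
    rcases h with h | h
    · exact h.elim ⟨p, hp⟩
    · exact h.not_finite inferInstance
  · rw [ind_pos]; · simp
    have : Nonempty {p // a.bd p = k} := Nat.card_pos_iff.1 (by omega) |>.1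
    obtain ⟨p, hp⟩ := this
    exact ⟨p, hp⟩

theorem chi_ext {K : Type} {x y : K →₀ ℤ} (h : 2 • x = 2 • y) : x = y := by
  ext k
  have := DFunLike.congr_fun h k
  simp only [Finsupp.coe_smul, Pi.smul_apply, nsmul_eq_mul] at this
  push_cast at this
  omega

theorem mapDomain_sub {A B : Type} (f : A → B) (x y : A →₀ ℤ) :
    Finsupp.mapDomain f (x - y) = Finsupp.mapDomain f x - Finsupp.mapDomain f y :=
  map_sub (Finsupp.mapDomain.addMonoidHom f) x y

theorem mapDomain_two {A B : Type} (f : A → B) (x : A →₀ ℤ) :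
    2 • Finsupp.mapDomain f x = Finsupp.mapDomain f (2 • x) :=
  (map_nsmul (Finsupp.mapDomain.addMonoidHom f) 2 x).symm

theorem chi_one (n : ℕ) : (one n).chi = ∑ p : Fin n, Finsupp.single p 1 := by
  apply chi_ext
  rw [two_chi, Fintype.sum_sum_type, two_nsmul]
  rfl

end Curve

/-- Push forward Euler characteristics `u`, `v` of the pieces to the pieces glued along `G`, where
`w` is the Euler characteristic of the parts along which one glues. -/
noncomputable def Glue.push {G A B : Type} (f : G → A) (g : G → B) (w : G →₀ ℤ) (u : A →₀ ℤ)
    (v : B →₀ ℤ) : Glue f g →₀ ℤ :=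
  Finsupp.mapDomain Glue.inl u + Finsupp.mapDomain Glue.inr v
    - Finsupp.mapDomain (fun t => Glue.inl (f t)) w

namespace Curve

variable {m n k m' n' : ℕ}

theorem chi_stack (a : Curve m k) (b : Curve k n) :
    (a.stack b).chi = Glue.push (fun i => a.bd (Sum.inr i)) (fun i => b.bd (Sum.inl i))
      (one k).chi a.chi b.chi := by
  apply chi_ext
  rw [two_chi]
  unfold Glue.push
  rw [smul_sub, smul_add, mapDomain_two, mapDomain_two, two_chi, two_chi,
    chi_one]
  simp only [Finsupp.mapDomain_finsetSum, Finsupp.mapDomain_add, Finsupp.mapDomain_single, Fintype.sum_sum_type,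
    stack, Sum.elim_inl, Sum.elim_inr, ← Glue.cond]
  abel

theorem chi_juxt (a : Curve m n) (b : Curve m' n') :
    (a.juxt b).chi = Finsupp.mapDomain Sum.inl a.chi + Finsupp.mapDomain Sum.inr b.chi := by
  apply chi_ext
  rw [two_chi, smul_add, mapDomain_two, mapDomain_two, two_chi, two_chi]
  simp only [Finsupp.mapDomain_finsetSum, Finsupp.mapDomain_add, Finsupp.mapDomain_single, Fintype.sum_sum_type,
    juxt, Sum.elim_inl, Sum.elim_inr, Fin.sum_univ_add, Fin.addCases_left, Fin.addCases_right]
  abel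

theorem chi_dual (a : Curve m n) : a.dual.chi = a.chi := by
  apply chi_ext
  rw [two_chi, two_chi]
  simp only [Fintype.sum_sum_type, dual, Function.comp, Sum.swap_inl, Sum.swap_inr]
  exact add_comm _ _

/-- The total Euler characteristic of `a` is the number of arcs. -/
theorem two_total (a : Curve m n) : 2 * a.chi.sum (fun _ x => x) = m + n := by
  have h : ∀ x : a.K →₀ ℤ, x.sum (fun _ x => x) = Finsupp.liftAddHom (fun _ => AddMonoidHom.id ℤ) x :=
    fun x => rfl
  have h2 := congrArg (Finsupp.liftAddHom (fun _ : a.K => AddMonoidHom.id ℤ)) a.two_chi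
  rw [map_nsmul, map_sum] at h2
  simp only [Finsupp.liftAddHom_apply_single, AddMonoidHom.id_apply, Finset.sum_const,
    Finset.card_univ, Fintype.card_sum, Fintype.card_fin, nsmul_eq_mul] at h2
  rw [h]
  push_cast at h2
  linarith

end Curve

/-- The topological type of a dotted cobordism from `a` to `b` in the cylinder over the rectangle,
up to homeomorphism relative to the boundary. `C` is the set of components of the surface, `src` and
`tgt` send a component of the bottom `a` and of the top `b` to the component of the surface that
contains it, `side` says that these agree along the vertical boundary `{p} × [0,1]`, and `chi` and
`dots` give the Euler characteristic and the number of dots of each component. -/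
structure Surf {m n : ℕ} (a b : Curve m n) where
  C : Type
  src : a.K → C
  tgt : b.K → C
  side : ∀ p, src (a.bd p) = tgt (b.bd p)
  chi : C →₀ ℤ
  dots : C →₀ ℕ

namespace Surf

variable {m n k m' n' : ℕ}

/-- Equality of topological types. -/
def Homeo {a b : Curve m n} (S T : Surf a b) : Prop :=
  ∃ e : S.C ≃ T.C, (∀ x, e (S.src x) = T.src x) ∧ (∀ x, e (S.tgt x) = T.tgt x) ∧
    S.chi.mapDomain e = T.chi ∧ S.dots.mapDomain e = T.dots

theorem Homeo.of {a b : Curve m n} {S T : Surf a b} (u : S.C → T.C) (v : T.C → S.C)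
    (hu : ∀ x, v (u x) = x) (hv : ∀ x, u (v x) = x) (h1 : ∀ x, u (S.src x) = T.src x)
    (h2 : ∀ x, u (S.tgt x) = T.tgt x) (h3 : S.chi.mapDomain u = T.chi)
    (h4 : S.dots.mapDomain u = T.dots) : S.Homeo T :=
  ⟨⟨u, v, hu, hv⟩, h1, h2, h3, h4⟩

/-- The product cobordism given by an identification of the components of `a` and `b`. -/
@[reducible] noncomputable def cyl {a b : Curve m n} (e : a.K ≃ b.K) (he : ∀ p, e (a.bd p) = b.bd p) :
    Surf a b where
  C := b.K
  src := e
  tgt := id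
  side := he
  chi := b.chi
  dots := 0

/-- The identity cobordism `a × [0,1]`. -/
@[reducible] noncomputable def id (a : Curve m n) : Surf a a := cyl (Equiv.refl _) (fun _ => rfl)

/-- Composition: first `S`, then `T`, glued along `b`. -/
@[reducible] noncomputable def comp {a b c : Curve m n} (S : Surf a b) (T : Surf b c) : Surf a c where
  C := Glue S.tgt T.src
  src x := Glue.inl (S.src x)
  tgt x := Glue.inr (T.tgt x)
  side p := by rw [S.side, Glue.cond, T.side]
  chi := Glue.push S.tgt T.src b.chi S.chi T.chi
  dots := S.dots.mapDomain Glue.inl + T.dots.mapDomain Glue.inr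

/-- Vertical stacking of cobordisms, glued along the `k` strips over the common boundary points. -/
@[reducible] noncomputable def stack {a b : Curve m k} {a' b' : Curve k n} (S : Surf a b) (S' : Surf a' b') :
    Surf (a.stack a') (b.stack b') where
  C := Glue (fun i => S.src (a.bd (Sum.inr i))) (fun i => S'.src (a'.bd (Sum.inl i)))
  src := Glue.lift (fun x => Glue.inl (S.src x)) (fun x => Glue.inr (S'.src x)) (fun i => Glue.cond i)
  tgt := Glue.lift (fun x => Glue.inl (S.tgt x)) (fun x => Glue.inr (S'.tgt x))
    (fun i => by rw [← S.side, ← S'.side]; exact Glue.cond i)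
  side := by
    rintro (p | p)
    · exact congrArg Glue.inl (S.side _)
    · exact congrArg Glue.inr (S'.side _)
  chi := Glue.push _ _ (Curve.one k).chi S.chi S'.chi
  dots := S.dots.mapDomain Glue.inl + S'.dots.mapDomain Glue.inr

/-- Horizontal juxtaposition of cobordisms. -/
@[reducible] noncomputable def juxt {a b : Curve m n} {a' b' : Curve m' n'} (S : Surf a b) (S' : Surf a' b') :
    Surf (a.juxt a') (b.juxt b') where
  C := S.C ⊕ S'.C
  src := Sum.map S.src S'.src
  tgt := Sum.map S.tgt S'.tgt
  side := by
    rintro (p | p) <;> refine Fin.addCases (fun i => ?_) (fun i => ?_) p <;>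
      simp [Curve.juxt, S.side, S'.side]
  chi := S.chi.mapDomain Sum.inl + S'.chi.mapDomain Sum.inr
  dots := S.dots.mapDomain Sum.inl + S'.dots.mapDomain Sum.inr

/-- Reflection of the rectangle in a horizontal line and reversal of the direction of `[0,1]`. -/
@[reducible] def dual {a b : Curve m n} (S : Surf a b) : Surf b.dual a.dual where
  C := S.C
  src := S.tgt
  tgt := S.src
  side p := (S.side p.swap).symm
  chi := S.chi
  dots := S.dots

/-- One more dot on the component `c`. -/
noncomputable def addDot {a b : Curve m n} (S : Surf a b) (c : S.C) : Surf a b :=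
  { S with dots := S.dots + Finsupp.single c 1 }

/-- A disk with boundary circle at the top. -/
noncomputable def birth : Surf (Curve.one 0) Curve.circle where
  C := Unit
  src _ := ()
  tgt _ := ()
  side _ := rfl
  chi := Finsupp.single () 1
  dots := 0

/-- A disk with boundary circle at the bottom. -/
noncomputable def death : Surf Curve.circle (Curve.one 0) where
  C := Unit
  src _ := ()
  tgt _ := ()
  side _ := rfl
  chi := Finsupp.single () 1
  dots := 0

/-- The saddle from two vertical strands to a cup over a cap. -/
noncomputable def saddle : Surf (Curve.one 2) (Curve.cup.stack Curve.cap) where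
  C := Unit
  src _ := ()
  tgt _ := ()
  side _ := rfl
  chi := Finsupp.single () 1
  dots := 0

/-- The saddle from a cup over a cap to two vertical strands. -/
noncomputable def saddle' : Surf (Curve.cup.stack Curve.cap) (Curve.one 2) where
  C := Unit
  src _ := ()
  tgt _ := ()
  side _ := rfl
  chi := Finsupp.single () 1
  dots := 0

/-- The sphere with `d` dots. -/
noncomputable def sphere (d : ℕ) : Surf (Curve.one 0) (Curve.one 0) where
  C := Unit
  src _ := ()
  tgt _ := ()
  side _ := rfl
  chi := Finsupp.single () 2
  dots := Finsupp.single () d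

/-- A disk with `i` dots at the bottom and a disk with `j` dots at the top. -/
noncomputable def disks (i j : ℕ) : Surf Curve.circle Curve.circle where
  C := Bool
  src _ := false
  tgt _ := true
  side p := p.elim Fin.elim0 Fin.elim0
  chi := Finsupp.single false 1 + Finsupp.single true 1
  dots := Finsupp.single false i + Finsupp.single true j

/-- A sheet over a vertical strand with Euler characteristic `x` and `d` dots. -/
noncomputable def sheet (x : ℤ) (d : ℕ) : Surf (Curve.one 1) (Curve.one 1) where
  C := Unit
  src _ := ()
  tgt _ := ()
  side _ := rfl
  chi := Finsupp.single () x
  dots := Finsupp.single () d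

theorem mapDomain_id' {A M : Type} [AddCommMonoid M] (x : A →₀ M) :
    Finsupp.mapDomain (fun a => a) x = x := Finsupp.mapDomain_id

theorem id_comp {a b : Curve m n} (S : Surf a b) : ((id a).comp S).Homeo S := by
  refine .of (Glue.lift S.src _root_.id (fun _ => rfl)) Glue.inr
    (Glue.ind (fun x => (Glue.cond x).symm) (fun _ => rfl)) (fun _ => rfl)
    (fun _ => rfl) (fun _ => rfl) ?_ ?_
  · simp only [comp, Glue.push, id, cyl, Finsupp.mapDomain_add, Curve.mapDomain_sub,
      ← Finsupp.mapDomain_comp, Function.comp_def]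
    exact (add_sub_cancel_left _ _).trans (mapDomain_id' _)
  · simp only [comp, id, cyl, Finsupp.mapDomain_add, Finsupp.mapDomain_zero,
      ← Finsupp.mapDomain_comp, Function.comp_def]
    exact (zero_add _).trans (mapDomain_id' _)

theorem comp_id {a b : Curve m n} (S : Surf a b) : (S.comp (id b)).Homeo S := by
  refine .of (Glue.lift _root_.id S.tgt (fun _ => rfl)) Glue.inl
    (Glue.ind (fun _ => rfl) (fun x => Glue.cond x)) (fun _ => rfl)
    (fun _ => rfl) (fun _ => rfl) ?_ ?_
  · simp only [comp, Glue.push, id, cyl, Finsupp.mapDomain_add, Curve.mapDomain_sub,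
      ← Finsupp.mapDomain_comp, Function.comp_def]
    exact (add_sub_cancel_right _ _).trans (mapDomain_id' _)
  · simp only [comp, id, cyl, Finsupp.mapDomain_add, Finsupp.mapDomain_zero,
      ← Finsupp.mapDomain_comp, Function.comp_def]
    exact (add_zero _).trans (mapDomain_id' _)

theorem comp_assoc {a b c d : Curve m n} (S : Surf a b) (T : Surf b c) (U : Surf c d) :
    ((S.comp T).comp U).Homeo (S.comp (T.comp U)) := by
  refine .of
    (Glue.lift (Glue.lift Glue.inl (fun x => Glue.inr (Glue.inl x)) (fun x => Glue.cond x))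
      (fun x => Glue.inr (Glue.inr x)) (fun x => congrArg Glue.inr (Glue.cond x)))
    (Glue.lift (fun x => Glue.inl (Glue.inl x)) (Glue.lift (fun x => Glue.inl (Glue.inr x)) Glue.inr
      (fun x => Glue.cond x)) (fun x => congrArg Glue.inl (Glue.cond x)))
    (Glue.ind (Glue.ind (fun _ => rfl) (fun _ => rfl)) (fun _ => rfl))
    (Glue.ind (fun _ => rfl) (Glue.ind (fun _ => rfl) (fun _ => rfl)))
    (fun _ => rfl) (fun _ => rfl) ?_ ?_
  · simp only [comp, Glue.push, Finsupp.mapDomain_add, Curve.mapDomain_sub,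
      ← Finsupp.mapDomain_comp, Function.comp_def, Equiv.coe_fn_mk]
    abel!
  · simp only [comp, Finsupp.mapDomain_add,
      ← Finsupp.mapDomain_comp, Function.comp_def, Equiv.coe_fn_mk]
    abel!

theorem stack_id (a : Curve m k) (a' : Curve k n) :
    ((id a).stack (id a')).Homeo (id (a.stack a')) := by
  refine .of (fun x => x) (fun x => x) (fun _ => rfl) (fun _ => rfl)
    (Glue.ind (fun _ => rfl) (fun _ => rfl)) (Glue.ind (fun _ => rfl) (fun _ => rfl)) ?_ ?_
  · refine Finsupp.mapDomain_id.trans ?_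
    exact (Curve.chi_stack a a').symm
  · refine Finsupp.mapDomain_id.trans ?_
    simp only [stack, id, cyl, Finsupp.mapDomain_zero, add_zero]
    rfl

theorem stack_comp {a b c : Curve m k} {a' b' c' : Curve k n} (S : Surf a b) (T : Surf b c)
    (S' : Surf a' b') (T' : Surf b' c') :
    ((S.comp T).stack (S'.comp T')).Homeo ((S.stack S').comp (T.stack T')) := by
  have hb : ∀ p, S.src (a.bd p) = S.tgt (b.bd p) := S.side
  have hb' : ∀ p, S'.src (a'.bd p) = S'.tgt (b'.bd p) := S'.side
  have h1 : ∀ i : Fin k, (Glue.inl (S.tgt (b.bd (Sum.inr i))) :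
      (S.stack S').C) = Glue.inr (S'.tgt (b'.bd (Sum.inl i))) := by
    intro i; rw [← hb, ← hb']; exact Glue.cond i
  refine .of
    (Glue.lift (Glue.lift (fun x => Glue.inl (Glue.inl x)) (fun x => Glue.inr (Glue.inl x))
        (fun x => Glue.cond (f := (S.stack S').tgt) (g := (T.stack T').src) (Glue.inl x)))
      (Glue.lift (fun x => Glue.inl (Glue.inr x)) (fun x => Glue.inr (Glue.inr x))
        (fun x => Glue.cond (f := (S.stack S').tgt) (g := (T.stack T').src) (Glue.inr x)))
      (fun i => congrArg Glue.inl (Glue.cond i)))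
    (Glue.lift (Glue.lift (fun x => Glue.inl (Glue.inl x)) (fun x => Glue.inr (Glue.inl x))
        (fun i => Glue.cond i))
      (Glue.lift (fun x => Glue.inl (Glue.inr x)) (fun x => Glue.inr (Glue.inr x)) ?_)
      (Glue.ind (fun x => congrArg Glue.inl (Glue.cond x))
        (fun x => congrArg Glue.inr (Glue.cond x))))
    (Glue.ind (Glue.ind (fun _ => rfl) (fun _ => rfl)) (Glue.ind (fun _ => rfl) (fun _ => rfl)))
    (Glue.ind (Glue.ind (fun _ => rfl) (fun _ => rfl)) (Glue.ind (fun _ => rfl) (fun _ => rfl)))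
    (Glue.ind (fun _ => rfl) (fun _ => rfl)) (Glue.ind (fun _ => rfl) (fun _ => rfl)) ?_ ?_
  · intro i
    rw [← Glue.cond, ← Glue.cond, ← hb, ← hb']
    exact Glue.cond i
  · have hw : ∀ i : Fin k, (Glue.inr (Glue.inl (T.src (b.bd (Sum.inr i)))) :
        ((S.stack S').comp (T.stack T')).C) = Glue.inl (Glue.inl (S.src (a.bd (Sum.inr i)))) := by
      intro i
      rw [hb]
      exact (Glue.cond (f := (S.stack S').tgt) (g := (T.stack T').src)
        (Glue.inl (b.bd (Sum.inr i)))).symm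
    have hc := Curve.chi_stack b b'
    simp only [comp, stack] at hw
    simp only [comp, Glue.push, Finsupp.mapDomain_add, Curve.mapDomain_sub,
      ← Finsupp.mapDomain_comp, Function.comp_def, Equiv.coe_fn_mk,
      hc, stack, hw, hb]
    abel!
  · simp only [comp, stack, Finsupp.mapDomain_add,
      ← Finsupp.mapDomain_comp, Function.comp_def, Equiv.coe_fn_mk]
    abel!

theorem juxt_id (a : Curve m n) (a' : Curve m' n') :
    ((id a).juxt (id a')).Homeo (id (a.juxt a')) := by
  refine .of (fun x => x) (fun x => x) (fun _ => rfl) (fun _ => rfl)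
    (by rintro (x | x) <;> rfl) (by rintro (x | x) <;> rfl) ?_ ?_
  · refine Finsupp.mapDomain_id.trans ?_
    exact (Curve.chi_juxt a a').symm
  · refine Finsupp.mapDomain_id.trans ?_
    simp only [juxt, id, cyl, Finsupp.mapDomain_zero, add_zero]

theorem juxt_comp {a b c : Curve m n} {a' b' c' : Curve m' n'} (S : Surf a b) (T : Surf b c)
    (S' : Surf a' b') (T' : Surf b' c') :
    ((S.comp T).juxt (S'.comp T')).Homeo ((S.juxt S').comp (T.juxt T')) := by
  refine .of
    (Sum.elim
      (Glue.lift (fun x => Glue.inl (Sum.inl x)) (fun x => Glue.inr (Sum.inl x))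
        (fun x => Glue.cond (f := (S.juxt S').tgt) (g := (T.juxt T').src) (Sum.inl x)))
      (Glue.lift (fun x => Glue.inl (Sum.inr x)) (fun x => Glue.inr (Sum.inr x))
        (fun x => Glue.cond (f := (S.juxt S').tgt) (g := (T.juxt T').src) (Sum.inr x))))
    (Glue.lift (Sum.map Glue.inl Glue.inl) (Sum.map Glue.inr Glue.inr) ?_) ?_ ?_ ?_ ?_ ?_ ?_
  · rintro (x | x)
    · exact congrArg Sum.inl (Glue.cond x)
    · exact congrArg Sum.inr (Glue.cond x)
  · rintro (x | x) <;> revert x <;> exact Glue.ind (fun _ => rfl) (fun _ => rfl)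
  · refine Glue.ind ?_ ?_ <;> rintro (x | x) <;> rfl
  · rintro (x | x) <;> rfl
  · rintro (x | x) <;> rfl
  · have hc := Curve.chi_juxt b b'
    simp only [comp, juxt, Glue.push, Finsupp.mapDomain_add, Curve.mapDomain_sub,
      ← Finsupp.mapDomain_comp, Function.comp_def, Equiv.coe_fn_mk,
      Sum.elim_inl, Sum.elim_inr, Sum.map_inl, Sum.map_inr, hc]
    abel!
  · simp only [comp, juxt, Finsupp.mapDomain_add,
      ← Finsupp.mapDomain_comp, Function.comp_def, Equiv.coe_fn_mk,
      Sum.elim_inl, Sum.elim_inr]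
    abel!

theorem dual_id (a : Curve m n) : (id a).dual.Homeo (id a.dual) := by
  refine .of (fun x => x) (fun x => x) (fun _ => rfl) (fun _ => rfl) (fun _ => rfl)
    (fun _ => rfl) ?_ ?_
  · refine Finsupp.mapDomain_id.trans ?_
    exact (Curve.chi_dual a).symm
  · refine Finsupp.mapDomain_id.trans ?_
    rfl

theorem dual_comp {a b c : Curve m n} (S : Surf a b) (T : Surf b c) :
    (S.comp T).dual.Homeo (T.dual.comp S.dual) := by
  refine .of (Glue.lift (fun x => Glue.inr x) (fun x => Glue.inl x) (fun x => ?_))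
    (Glue.lift (fun x => Glue.inr x) (fun x => Glue.inl x) (fun x => ?_))
    (Glue.ind (fun _ => rfl) (fun _ => rfl)) (Glue.ind (fun _ => rfl) (fun _ => rfl))
    (fun _ => rfl) (fun _ => rfl) ?_ ?_
  · exact (Glue.cond (f := T.dual.tgt) (g := S.dual.src) x).symm
  · exact (Glue.cond (f := S.tgt) (g := T.src) x).symm
  · have hc := Curve.chi_dual b
    have hw : ∀ x, (Glue.inr (S.tgt x) : (T.dual.comp S.dual).C) = Glue.inl (T.src x) :=
      fun x => (Glue.cond (f := T.dual.tgt) (g := S.dual.src) x).symm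
    have key : ∀ p q r r' : (T.dual.comp S.dual).C →₀ ℤ, r = r' → p + q - r = q + p - r' := by
      rintro p q r _ rfl
      rw [add_comm]
    simp only [comp, dual, Glue.push, Finsupp.mapDomain_add, Curve.mapDomain_sub,
      ← Finsupp.mapDomain_comp, Function.comp_def]
    rw [hc]
    exact key _ _ _ _ (congrArg (fun f => Finsupp.mapDomain f b.chi) (funext hw))
  · simp only [comp, dual, Finsupp.mapDomain_add,
      ← Finsupp.mapDomain_comp, Function.comp_def, Equiv.coe_fn_mk]
    exact add_comm _ _

end Surf

/-- The topological types of the dotted cobordisms that embed in the cylinder over the rectangle: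
those generated by cylinders, births, deaths, saddles and dots under composition, gluing and
reflection. -/
inductive IsCob : ∀ {m n : ℕ} {a b : Curve m n}, Surf a b → Prop
  | homeo {m n : ℕ} {a b : Curve m n} {S T : Surf a b} : S.Homeo T → IsCob S → IsCob T
  | cyl {m n : ℕ} {a b : Curve m n} (e : a.K ≃ b.K) (he : ∀ p, e (a.bd p) = b.bd p) :
      IsCob (Surf.cyl e he)
  | birth : IsCob Surf.birth
  | death : IsCob Surf.death
  | saddle : IsCob Surf.saddle
  | saddle' : IsCob Surf.saddle'
  | dot {m n : ℕ} {a b : Curve m n} {S : Surf a b} (c : S.C) : IsCob S → IsCob (S.addDot c)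
  | comp {m n : ℕ} {a b c : Curve m n} {S : Surf a b} {T : Surf b c} :
      IsCob S → IsCob T → IsCob (S.comp T)
  | stack {m k n : ℕ} {a b : Curve m k} {a' b' : Curve k n} {S : Surf a b} {S' : Surf a' b'} :
      IsCob S → IsCob S' → IsCob (S.stack S')
  | juxt {m n m' n' : ℕ} {a b : Curve m n} {a' b' : Curve m' n'} {S : Surf a b}
      {S' : Surf a' b'} : IsCob S → IsCob S' → IsCob (S.juxt S')
  | dual {m n : ℕ} {a b : Curve m n} {S : Surf a b} : IsCob S → IsCob S.dual

/-- Dotted cobordisms from `a` to `b`. -/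
def Cob {m n : ℕ} (a b : Curve m n) : Type 1 := {S : Surf a b // IsCob S}

namespace Cob

variable {m n k m' n' : ℕ}

noncomputable def id (a : Curve m n) : Cob a a := ⟨Surf.id a, .cyl _ _⟩

noncomputable def comp {a b c : Curve m n} (S : Cob a b) (T : Cob b c) : Cob a c :=
  ⟨S.1.comp T.1, .comp S.2 T.2⟩

noncomputable def stack {a b : Curve m k} {a' b' : Curve k n} (S : Cob a b) (S' : Cob a' b') :
    Cob (a.stack a') (b.stack b') := ⟨S.1.stack S'.1, .stack S.2 S'.2⟩

noncomputable def juxt {a b : Curve m n} {a' b' : Curve m' n'} (S : Cob a b) (S' : Cob a' b') :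
    Cob (a.juxt a') (b.juxt b') := ⟨S.1.juxt S'.1, .juxt S.2 S'.2⟩

def dual {a b : Curve m n} (S : Cob a b) : Cob b.dual a.dual := ⟨S.1.dual, .dual S.2⟩

/-- The degree of a cobordism without degree shifts; a dot has degree two. -/
noncomputable def deg {a b : Curve m n} (S : Cob a b) : ℤ :=
  -(S.1.chi.sum fun _ x => x) + 2 * (S.1.dots.sum fun _ d => (d : ℤ)) + (m + n) / 2

end Cob

/-- The coefficient ring `ℤ[α]`, with `α = X`. -/
abbrev Coef : Type := Polynomial ℤ

/-- Linear combinations of cobordisms. -/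
abbrev FreeCob {m n : ℕ} (a b : Curve m n) : Type 1 := Cob a b →₀ Coef

/-- The bilinear extension of a map `φ` on basis elements. -/
noncomputable def bilin {A B C : Type 1} (φ : A → B → C) :
    (A →₀ Coef) →ₗ[Coef] (B →₀ Coef) →ₗ[Coef] (C →₀ Coef) :=
  Finsupp.linearCombination Coef fun x => Finsupp.lmapDomain Coef Coef (φ x)

theorem bilin_single {A B C : Type 1} (φ : A → B → C) (x : A) (y : B) :
    bilin φ (Finsupp.single x 1) (Finsupp.single y 1) = Finsupp.single (φ x y) 1 := by
  simp [bilin]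

/-- The linear extension of the reflection of cobordisms. -/
noncomputable def FreeCob.dual {m n : ℕ} {a b : Curve m n} :
    FreeCob a b →ₗ[Coef] FreeCob b.dual a.dual := Finsupp.lmapDomain Coef Coef Cob.dual

/-- The linear combinations of cobordisms that are zero: the consequences of homeomorphism
invariance and of the local relations for spheres, necks and handles. -/
inductive Null : ∀ {m n : ℕ} {a b : Curve m n}, FreeCob a b → Prop
  | zero {m n : ℕ} {a b : Curve m n} : Null (0 : FreeCob a b)
  | add {m n : ℕ} {a b : Curve m n} {x y : FreeCob a b} : Null x → Null y → Null (x + y)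
  | smul {m n : ℕ} {a b : Curve m n} (r : Coef) {x : FreeCob a b} : Null x → Null (r • x)
  | comp_left {m n : ℕ} {a b c : Curve m n} {x : FreeCob a b} (y : FreeCob b c) :
      Null x → Null (bilin Cob.comp x y)
  | comp_right {m n : ℕ} {a b c : Curve m n} (x : FreeCob a b) {y : FreeCob b c} :
      Null y → Null (bilin Cob.comp x y)
  | stack_left {m k n : ℕ} {a b : Curve m k} {a' b' : Curve k n} {x : FreeCob a b}
      (y : FreeCob a' b') : Null x → Null (bilin Cob.stack x y)
  | stack_right {m k n : ℕ} {a b : Curve m k} {a' b' : Curve k n} (x : FreeCob a b)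
      {y : FreeCob a' b'} : Null y → Null (bilin Cob.stack x y)
  | juxt_left {m n m' n' : ℕ} {a b : Curve m n} {a' b' : Curve m' n'} {x : FreeCob a b}
      (y : FreeCob a' b') : Null x → Null (bilin Cob.juxt x y)
  | juxt_right {m n m' n' : ℕ} {a b : Curve m n} {a' b' : Curve m' n'} (x : FreeCob a b)
      {y : FreeCob a' b'} : Null y → Null (bilin Cob.juxt x y)
  | dual {m n : ℕ} {a b : Curve m n} {x : FreeCob a b} : Null x → Null (FreeCob.dual x)
  | homeo {m n : ℕ} {a b : Curve m n} (S T : Cob a b) : S.1.Homeo T.1 →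
      Null (Finsupp.single S 1 - Finsupp.single T 1)
  | sphere0 (S : Cob (Curve.one 0) (Curve.one 0)) : S.1.Homeo (Surf.sphere 0) →
      Null (Finsupp.single S 1)
  | sphere1 (S : Cob (Curve.one 0) (Curve.one 0)) : S.1.Homeo (Surf.sphere 1) →
      Null (Finsupp.single S 1 - Finsupp.single (Cob.id _) 1)
  | sphere2 (S : Cob (Curve.one 0) (Curve.one 0)) : S.1.Homeo (Surf.sphere 2) →
      Null (Finsupp.single S 1)
  | sphere3 (S : Cob (Curve.one 0) (Curve.one 0)) : S.1.Homeo (Surf.sphere 3) →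
      Null (Finsupp.single S 1 - Finsupp.single (Cob.id _) Polynomial.X)
  | neck (S T U : Cob Curve.circle Curve.circle) : S.1.Homeo (Surf.id _) →
      T.1.Homeo (Surf.disks 1 0) → U.1.Homeo (Surf.disks 0 1) →
      Null (Finsupp.single S 1 - Finsupp.single T 1 - Finsupp.single U 1)
  | handle (S T : Cob (Curve.one 1) (Curve.one 1)) : S.1.Homeo (Surf.sheet (-1) 0) →
      T.1.Homeo (Surf.sheet 1 1) → Null (Finsupp.single S 1 - Finsupp.single T 2)

noncomputable def nullSub {m n : ℕ} (a b : Curve m n) : Submodule Coef (FreeCob a b) where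
  carrier := {x | Null x}
  zero_mem' := .zero
  add_mem' := .add
  smul_mem' := fun r _ h => .smul r h

/-- Morphisms of all degrees from `a` to `b`: linear combinations of cobordisms modulo relations. -/
abbrev CHom {m n : ℕ} (a b : Curve m n) : Type 1 := FreeCob a b ⧸ nullSub a b

/-- The map that a bilinear map induces on quotients. -/
noncomputable def quotBilin {M N P : Type 1} [AddCommGroup M] [AddCommGroup N] [AddCommGroup P] [Module Coef M]
    [Module Coef N] [Module Coef P] (f : M →ₗ[Coef] N →ₗ[Coef] P) (p : Submodule Coef M)
    (q : Submodule Coef N) (r : Submodule Coef P) (h1 : ∀ x ∈ p, ∀ y, f x y ∈ r)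
    (h2 : ∀ x, ∀ y ∈ q, f x y ∈ r) : (M ⧸ p) →ₗ[Coef] (N ⧸ q) →ₗ[Coef] (P ⧸ r) :=
  p.liftQ
    { toFun := fun x => q.mapQ r (f x) (h2 x)
      map_add' := fun x y => by ext; simp
      map_smul' := fun c x => by ext; simp }
    (fun x hx => by
      rw [LinearMap.mem_ker]
      ext y
      simpa using h1 x hx y)

theorem quotBilin_mk {M N P : Type 1} [AddCommGroup M] [AddCommGroup N] [AddCommGroup P]
    [Module Coef M] [Module Coef N] [Module Coef P] (f : M →ₗ[Coef] N →ₗ[Coef] P)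
    (p : Submodule Coef M) (q : Submodule Coef N) (r : Submodule Coef P) (h1) (h2) (x : M) (y : N) :
    quotBilin f p q r h1 h2 (Submodule.Quotient.mk x) (Submodule.Quotient.mk y) =
      Submodule.Quotient.mk (f x y) := rfl

namespace CHom

variable {m n k m' n' : ℕ}

/-- The class of a cobordism. -/
noncomputable def mk {a b : Curve m n} (S : Cob a b) : CHom a b :=
  Submodule.Quotient.mk (Finsupp.single S 1)

theorem mk_eq {a b : Curve m n} {S T : Cob a b} (h : S.1.Homeo T.1) : mk S = mk T :=
  (Submodule.Quotient.eq _).2 (.homeo S T h)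

theorem ind {a b : Curve m n} {p : CHom a b → Prop} (h0 : p 0) (ha : ∀ x y, p x → p y → p (x + y))
    (hs : ∀ (r : Coef) x, p x → p (r • x)) (hm : ∀ S, p (mk S)) (x : CHom a b) : p x := by
  obtain ⟨x, rfl⟩ := Submodule.Quotient.mk_surjective _ x
  induction x using Finsupp.induction_linear with
  | zero => exact h0
  | add x y hx hy => exact ha _ _ hx hy
  | single S r =>
    have : Finsupp.single S r = r • Finsupp.single S (1 : Coef) := by simp
    rw [this]
    exact hs r _ (hm S)

noncomputable def id (a : Curve m n) : CHom a a := mk (Cob.id a)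

noncomputable def comp {a b c : Curve m n} : CHom a b →ₗ[Coef] CHom b c →ₗ[Coef] CHom a c :=
  quotBilin (bilin Cob.comp) _ _ _ (fun _ h y => .comp_left y h) (fun x _ h => .comp_right x h)

noncomputable def stack {a b : Curve m k} {a' b' : Curve k n} :
    CHom a b →ₗ[Coef] CHom a' b' →ₗ[Coef] CHom (a.stack a') (b.stack b') :=
  quotBilin (bilin Cob.stack) _ _ _ (fun _ h y => .stack_left y h) (fun x _ h => .stack_right x h)

noncomputable def juxt {a b : Curve m n} {a' b' : Curve m' n'} :
    CHom a b →ₗ[Coef] CHom a' b' →ₗ[Coef] CHom (a.juxt a') (b.juxt b') :=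
  quotBilin (bilin Cob.juxt) _ _ _ (fun _ h y => .juxt_left y h) (fun x _ h => .juxt_right x h)

noncomputable def dual {a b : Curve m n} : CHom a b →ₗ[Coef] CHom b.dual a.dual :=
  Submodule.mapQ _ _ FreeCob.dual (fun _ h => .dual h)

theorem comp_mk {a b c : Curve m n} (S : Cob a b) (T : Cob b c) :
    comp (mk S) (mk T) = mk (S.comp T) :=
  (quotBilin_mk ..).trans (congrArg _ (bilin_single ..))

theorem stack_mk {a b : Curve m k} {a' b' : Curve k n} (S : Cob a b) (T : Cob a' b') :
    stack (mk S) (mk T) = mk (S.stack T) :=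
  (quotBilin_mk ..).trans (congrArg _ (bilin_single ..))

theorem juxt_mk {a b : Curve m n} {a' b' : Curve m' n'} (S : Cob a b) (T : Cob a' b') :
    juxt (mk S) (mk T) = mk (S.juxt T) :=
  (quotBilin_mk ..).trans (congrArg _ (bilin_single ..))

theorem dual_mk {a b : Curve m n} (S : Cob a b) : dual (mk S) = mk S.dual :=
  congrArg Submodule.Quotient.mk (Finsupp.mapDomain_single)

theorem id_comp {a b : Curve m n} (x : CHom a b) : comp (id a) x = x := by
  induction x using ind with
  | h0 => simp
  | ha x y hx hy => rw [map_add, hx, hy]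
  | hs r x hx => rw [map_smul, hx]
  | hm S => exact (comp_mk _ _).trans (mk_eq (Surf.id_comp S.1))

theorem comp_id {a b : Curve m n} (x : CHom a b) : comp x (id b) = x := by
  induction x using ind with
  | h0 => simp
  | ha x y hx hy => rw [map_add, LinearMap.add_apply, hx, hy]
  | hs r x hx => rw [map_smul, LinearMap.smul_apply, hx]
  | hm S => exact (comp_mk _ _).trans (mk_eq (Surf.comp_id S.1))

theorem comp_assoc {a b c d : Curve m n} (x : CHom a b) (y : CHom b c) (z : CHom c d) :
    comp (comp x y) z = comp x (comp y z) := by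
  induction x using ind with
  | h0 => simp
  | ha x x' hx hx' => simp only [map_add, LinearMap.add_apply, hx, hx']
  | hs r x hx => simp only [map_smul, LinearMap.smul_apply, hx]
  | hm S =>
  induction y using ind with
  | h0 => simp
  | ha x x' hx hx' => simp only [map_add, LinearMap.add_apply, hx, hx']
  | hs r x hx => simp only [map_smul, LinearMap.smul_apply, hx]
  | hm T =>
  induction z using ind with
  | h0 => simp
  | ha x x' hx hx' => simp only [map_add, hx, hx']
  | hs r x hx => simp only [map_smul, hx]
  | hm U =>
    rw [comp_mk, comp_mk, comp_mk, comp_mk]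
    exact mk_eq (Surf.comp_assoc S.1 T.1 U.1)

theorem stack_id (a : Curve m k) (a' : Curve k n) :
    stack (id a) (id a') = id (a.stack a') :=
  (stack_mk _ _).trans (mk_eq (Surf.stack_id a a'))

theorem stack_comp {a b c : Curve m k} {a' b' c' : Curve k n} (x : CHom a b) (y : CHom b c)
    (x' : CHom a' b') (y' : CHom b' c') :
    stack (comp x y) (comp x' y') = comp (stack x x') (stack y y') := by
  induction x using ind with
  | h0 => simp
  | ha x x' hx hx' => simp only [map_add, LinearMap.add_apply, hx, hx']
  | hs r x hx => simp only [map_smul, LinearMap.smul_apply, hx]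
  | hm S =>
  induction y using ind with
  | h0 => simp
  | ha x x' hx hx' => simp only [map_add, LinearMap.add_apply, hx, hx']
  | hs r x hx => simp only [map_smul, LinearMap.smul_apply, hx]
  | hm T =>
  induction x' using ind with
  | h0 => simp
  | ha x x' hx hx' => simp only [map_add, LinearMap.add_apply, hx, hx']
  | hs r x hx => simp only [map_smul, LinearMap.smul_apply, hx]
  | hm S' =>
  induction y' using ind with
  | h0 => simp
  | ha x x' hx hx' => simp only [map_add, hx, hx']
  | hs r x hx => simp only [map_smul, hx]
  | hm T' =>
    rw [comp_mk, comp_mk, stack_mk, stack_mk, stack_mk, comp_mk]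
    exact mk_eq (Surf.stack_comp S.1 T.1 S'.1 T'.1)

theorem juxt_id (a : Curve m n) (a' : Curve m' n') :
    juxt (id a) (id a') = id (a.juxt a') :=
  (juxt_mk _ _).trans (mk_eq (Surf.juxt_id a a'))

theorem juxt_comp {a b c : Curve m n} {a' b' c' : Curve m' n'} (x : CHom a b) (y : CHom b c)
    (x' : CHom a' b') (y' : CHom b' c') :
    juxt (comp x y) (comp x' y') = comp (juxt x x') (juxt y y') := by
  induction x using ind with
  | h0 => simp
  | ha x x' hx hx' => simp only [map_add, LinearMap.add_apply, hx, hx']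
  | hs r x hx => simp only [map_smul, LinearMap.smul_apply, hx]
  | hm S =>
  induction y using ind with
  | h0 => simp
  | ha x x' hx hx' => simp only [map_add, LinearMap.add_apply, hx, hx']
  | hs r x hx => simp only [map_smul, LinearMap.smul_apply, hx]
  | hm T =>
  induction x' using ind with
  | h0 => simp
  | ha x x' hx hx' => simp only [map_add, LinearMap.add_apply, hx, hx']
  | hs r x hx => simp only [map_smul, LinearMap.smul_apply, hx]
  | hm S' =>
  induction y' using ind with
  | h0 => simp
  | ha x x' hx hx' => simp only [map_add, hx, hx']
  | hs r x hx => simp only [map_smul, hx]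
  | hm T' =>
    rw [comp_mk, comp_mk, juxt_mk, juxt_mk, juxt_mk, comp_mk]
    exact mk_eq (Surf.juxt_comp S.1 T.1 S'.1 T'.1)

theorem dual_id (a : Curve m n) : dual (id a) = id a.dual :=
  (dual_mk _).trans (mk_eq (Surf.dual_id a))

theorem dual_comp {a b c : Curve m n} (x : CHom a b) (y : CHom b c) :
    dual (comp x y) = comp (dual y) (dual x) := by
  induction x using ind with
  | h0 => simp
  | ha x x' hx hx' => simp only [map_add, LinearMap.add_apply, hx, hx']
  | hs r x hx => simp only [map_smul, LinearMap.smul_apply, hx]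
  | hm S =>
  induction y using ind with
  | h0 => simp
  | ha x x' hx hx' => simp only [map_add, LinearMap.add_apply, hx, hx']
  | hs r x hx => simp only [map_smul, LinearMap.smul_apply, hx]
  | hm T =>
    rw [comp_mk, dual_mk, dual_mk, dual_mk, comp_mk]
    exact mk_eq (Surf.dual_comp S.1 T.1)

end CHom

namespace Cob

variable {m n k m' n' : ℕ}

theorem sum_eq {A : Type} (x : A →₀ ℤ) :
    x.sum (fun _ x => x) = Finsupp.liftAddHom (fun _ => AddMonoidHom.id ℤ) x := rfl

theorem sum_eq' {A : Type} (x : A →₀ ℕ) :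
    x.sum (fun _ d => (d : ℤ)) = Finsupp.liftAddHom (fun _ => Nat.castAddMonoidHom ℤ) x := rfl

theorem sum_map {A B : Type} (f : A → B) (x : A →₀ ℤ) :
    Finsupp.liftAddHom (fun _ => AddMonoidHom.id ℤ) (x.mapDomain f) =
      Finsupp.liftAddHom (fun _ => AddMonoidHom.id ℤ) x :=
  Finsupp.sum_mapDomain_index_addMonoidHom (fun _ => AddMonoidHom.id ℤ)

theorem sum_map' {A B : Type} (f : A → B) (x : A →₀ ℕ) :
    Finsupp.liftAddHom (fun _ => Nat.castAddMonoidHom ℤ) (x.mapDomain f) =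
      Finsupp.liftAddHom (fun _ => Nat.castAddMonoidHom ℤ) x :=
  Finsupp.sum_mapDomain_index_addMonoidHom (fun _ => Nat.castAddMonoidHom ℤ)

theorem deg_id (a : Curve m n) : (id a).deg = 0 := by
  have h := a.two_total
  simp only [deg, id, Surf.id, Surf.cyl, Finsupp.sum_zero_index]
  omega

theorem deg_comp {a b c : Curve m n} (S : Cob a b) (T : Cob b c) :
    (S.comp T).deg = S.deg + T.deg := by
  have h := b.two_total
  simp only [deg, comp, Surf.comp, Glue.push, sum_eq, sum_eq', map_add, map_sub, sum_map,
    sum_map'] at h ⊢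
  omega

theorem deg_stack {a b : Curve m k} {a' b' : Curve k n} (S : Cob a b) (S' : Cob a' b') :
    (S.stack S').deg = S.deg + S'.deg := by
  have h := (Curve.one k).two_total
  have h1 := a.two_total
  have h2 := a'.two_total
  simp only [deg, stack, Surf.stack, Glue.push, sum_eq, sum_eq', map_add, map_sub, sum_map,
    sum_map'] at h h1 h2 ⊢
  omega

theorem deg_juxt {a b : Curve m n} {a' b' : Curve m' n'} (S : Cob a b) (S' : Cob a' b') :
    (S.juxt S').deg = S.deg + S'.deg := by
  have h1 := a.two_total
  have h2 := a'.two_total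
  simp only [deg, juxt, Surf.juxt, sum_eq, sum_eq', map_add, map_sub, sum_map,
    sum_map'] at h1 h2 ⊢
  push_cast
  omega

theorem deg_dual {a b : Curve m n} (S : Cob a b) : S.dual.deg = S.deg := by
  simp only [deg, dual, Surf.dual, add_comm (n : ℤ)]

end Cob

/-- The morphisms of degree `d`, where `α` has degree four. -/
noncomputable def homog {m n : ℕ} (a b : Curve m n) (d : ℤ) : AddSubgroup (CHom a b) :=
  AddSubgroup.closure {f | ∃ (i : ℕ) (S : Cob a b), 4 * i + S.deg = d ∧
    f = (Polynomial.X ^ i : Coef) • CHom.mk S}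

theorem closure_bilin {M N P : Type 1} [AddCommGroup M] [AddCommGroup N] [AddCommGroup P]
    [Module Coef M] [Module Coef N] [Module Coef P] (f : M →ₗ[Coef] N →ₗ[Coef] P) {s : Set M}
    {t : Set N} {u : AddSubgroup P} (h : ∀ x ∈ s, ∀ y ∈ t, f x y ∈ u) {x : M} {y : N}
    (hx : x ∈ AddSubgroup.closure s) (hy : y ∈ AddSubgroup.closure t) : f x y ∈ u := by
  induction hx using AddSubgroup.closure_induction with
  | zero => simp
  | add x x' _ _ h h' => simpa using u.add_mem h h'
  | neg x _ h => simpa using u.neg_mem h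
  | mem x hx =>
  induction hy using AddSubgroup.closure_induction with
  | zero => simp
  | add x x' _ _ h h' => simpa using u.add_mem h h'
  | neg x _ h => simpa using u.neg_mem h
  | mem y hy => exact h x hx y hy

namespace homog

variable {m n k m' n' : ℕ}

theorem id_mem (a : Curve m n) : CHom.id a ∈ homog a a 0 :=
  AddSubgroup.subset_closure ⟨0, Cob.id a, by simp [Cob.deg_id], by simp [CHom.id]⟩

theorem comp_mem {a b c : Curve m n} {x : CHom a b} {y : CHom b c} {d e f : ℤ} (h : d + e = f)
    (hx : x ∈ homog a b d) (hy : y ∈ homog b c e) : CHom.comp x y ∈ homog a c f := by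
  refine closure_bilin _ ?_ hx hy
  rintro _ ⟨i, S, h1, rfl⟩ _ ⟨j, T, h2, rfl⟩
  refine AddSubgroup.subset_closure ⟨i + j, S.comp T, ?_, ?_⟩
  · rw [Cob.deg_comp]; push_cast; omega
  · rw [map_smul, map_smul, LinearMap.smul_apply, CHom.comp_mk, smul_smul, ← pow_add, add_comm]

theorem stack_mem {a b : Curve m k} {a' b' : Curve k n} {x : CHom a b} {y : CHom a' b'}
    {d e f : ℤ} (h : d + e = f) (hx : x ∈ homog a b d) (hy : y ∈ homog a' b' e) :
    CHom.stack x y ∈ homog (a.stack a') (b.stack b') f := by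
  refine closure_bilin _ ?_ hx hy
  rintro _ ⟨i, S, h1, rfl⟩ _ ⟨j, T, h2, rfl⟩
  refine AddSubgroup.subset_closure ⟨i + j, S.stack T, ?_, ?_⟩
  · rw [Cob.deg_stack]; push_cast; omega
  · rw [map_smul, map_smul, LinearMap.smul_apply, CHom.stack_mk, smul_smul, ← pow_add, add_comm]

theorem juxt_mem {a b : Curve m n} {a' b' : Curve m' n'} {x : CHom a b} {y : CHom a' b'}
    {d e f : ℤ} (h : d + e = f) (hx : x ∈ homog a b d) (hy : y ∈ homog a' b' e) :
    CHom.juxt x y ∈ homog (a.juxt a') (b.juxt b') f := by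
  refine closure_bilin _ ?_ hx hy
  rintro _ ⟨i, S, h1, rfl⟩ _ ⟨j, T, h2, rfl⟩
  refine AddSubgroup.subset_closure ⟨i + j, S.juxt T, ?_, ?_⟩
  · rw [Cob.deg_juxt]; push_cast; omega
  · rw [map_smul, map_smul, LinearMap.smul_apply, CHom.juxt_mk, smul_smul, ← pow_add, add_comm j i]

theorem dual_mem {a b : Curve m n} {x : CHom a b} {d e : ℤ} (h : d = e) (hx : x ∈ homog a b d) :
    CHom.dual x ∈ homog b.dual a.dual e := by
  subst h
  induction hx using AddSubgroup.closure_induction with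
  | zero => simp
  | add x x' _ _ h h' => simpa using AddSubgroup.add_mem _ h h'
  | neg x _ h => simpa using AddSubgroup.neg_mem _ h
  | mem x hx =>
    obtain ⟨i, S, h1, rfl⟩ := hx
    refine AddSubgroup.subset_closure ⟨i, S.dual, ?_, ?_⟩
    · rw [Cob.deg_dual, h1]
    · rw [map_smul, CHom.dual_mk]

end homog

/-- A diagram with a degree shift: the object `q ^ shift * curve`. -/
structure GCob (m n : ℕ) where
  curve : Curve m n
  shift : ℤ

namespace GCob

variable {m n k : ℕ}

/-- The category of shifted diagrams, with the morphisms of degree zero. -/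
noncomputable instance : Category (GCob m n) where
  Hom X Y := homog X.curve Y.curve (X.shift - Y.shift)
  id X := ⟨CHom.id _, by rw [sub_self]; exact homog.id_mem _⟩
  comp f g := ⟨CHom.comp f.1 g.1, homog.comp_mem (by ring) f.2 g.2⟩
  id_comp f := Subtype.ext (CHom.id_comp f.1)
  comp_id f := Subtype.ext (CHom.comp_id f.1)
  assoc f g h := Subtype.ext (CHom.comp_assoc f.1 g.1 h.1)

noncomputable instance : Preadditive (GCob m n) where
  homGroup X Y := inferInstanceAs (AddCommGroup (homog X.curve Y.curve (X.shift - Y.shift)))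
  add_comp _ _ _ f f' g := Subtype.ext (by
    change CHom.comp (f.1 + f'.1) g.1 = CHom.comp f.1 g.1 + CHom.comp f'.1 g.1
    rw [map_add, LinearMap.add_apply])
  comp_add _ _ _ f g g' := Subtype.ext (by
    change CHom.comp f.1 (g.1 + g'.1) = CHom.comp f.1 g.1 + CHom.comp f.1 g'.1
    rw [map_add])

/-- Vertical stacking as a bifunctor. -/
noncomputable def stack (m k n : ℕ) : GCob m k ⥤ GCob k n ⥤ GCob m n where
  obj X :=
    { obj := fun Y => ⟨X.curve.stack Y.curve, X.shift + Y.shift⟩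
      map := fun {Y Y'} g => ⟨CHom.stack (CHom.id X.curve) g.1,
        homog.stack_mem (by ring) (homog.id_mem _) g.2⟩
      map_id := fun Y => Subtype.ext (CHom.stack_id _ _)
      map_comp := fun f g => Subtype.ext (by
        change CHom.stack (CHom.id X.curve) (CHom.comp f.1 g.1) = CHom.comp _ _
        rw [← CHom.stack_comp, CHom.id_comp]) }
  map {X X'} f :=
    { app := fun Y => ⟨CHom.stack f.1 (CHom.id Y.curve),
        homog.stack_mem (by ring) f.2 (homog.id_mem _)⟩
      naturality := fun Y Y' g => Subtype.ext (by
        change CHom.comp (CHom.stack (CHom.id X.curve) g.1) (CHom.stack f.1 (CHom.id Y'.curve)) =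
          CHom.comp (CHom.stack f.1 (CHom.id Y.curve)) (CHom.stack (CHom.id X'.curve) g.1)
        rw [← CHom.stack_comp, ← CHom.stack_comp, CHom.id_comp, CHom.id_comp, CHom.comp_id,
          CHom.comp_id]) }
  map_id X := by ext Y; exact Subtype.ext (CHom.stack_id _ _)
  map_comp f g := by
    ext Y
    refine Subtype.ext ?_
    change CHom.stack (CHom.comp f.1 g.1) (CHom.id Y.curve) =
      CHom.comp (CHom.stack f.1 (CHom.id Y.curve)) (CHom.stack g.1 (CHom.id Y.curve))
    rw [← CHom.stack_comp, CHom.id_comp]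

/-- The functor that adds `x` vertical strands on the left and `z` on the right. -/
noncomputable def widen (x z m n : ℕ) : GCob m n ⥤ GCob (x + m + z) (x + n + z) where
  obj X := ⟨X.curve.widen x z, X.shift⟩
  map {X Y} f := ⟨CHom.juxt (CHom.juxt (CHom.id (Curve.one x)) f.1) (CHom.id (Curve.one z)),
    homog.juxt_mem (add_zero _) (homog.juxt_mem (zero_add _) (homog.id_mem _) f.2)
      (homog.id_mem _)⟩
  map_id X := Subtype.ext (by
    change CHom.juxt (CHom.juxt (CHom.id (Curve.one x)) (CHom.id X.curve))
      (CHom.id (Curve.one z)) = CHom.id _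
    rw [CHom.juxt_id, CHom.juxt_id])
  map_comp f g := Subtype.ext (by
    change CHom.juxt (CHom.juxt (CHom.id (Curve.one x)) (CHom.comp f.1 g.1))
      (CHom.id (Curve.one z)) = CHom.comp (CHom.juxt (CHom.juxt (CHom.id (Curve.one x)) f.1)
      (CHom.id (Curve.one z))) (CHom.juxt (CHom.juxt (CHom.id (Curve.one x)) g.1)
      (CHom.id (Curve.one z)))
    rw [← CHom.juxt_comp, ← CHom.juxt_comp, CHom.id_comp, CHom.id_comp])

/-- The contravariant duality functor: reflect diagrams and negate degree shifts. -/
noncomputable def dual (m n : ℕ) : (GCob m n)ᵒᵖ ⥤ GCob n m where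
  obj X := ⟨X.unop.curve.dual, -X.unop.shift⟩
  map f := ⟨CHom.dual f.unop.1, homog.dual_mem (by ring) f.unop.2⟩
  map_id X := Subtype.ext (CHom.dual_id _)
  map_comp f g := Subtype.ext (CHom.dual_comp g.unop.1 f.unop.1)

end GCob

/-- Which kind of infinite sums to adjoin: countable direct sums or countable direct products. -/
inductive Mode
  | sum
  | prod

/-- The objects of the closure of `C` under countable direct sums, respectively products: formal
sums (products) of countable families of objects. When `C` consists of finite formal sums of
diagrams, these are the same as countable formal sums of diagrams. -/
structure Completion (t : Mode) (C : Type 1) where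
  ι : Type
  countable : Countable ι
  X : ι → C

namespace Completion

variable {C : Type 1} [Category.{1} C] [Preadditive C]

/-- A matrix has finite columns (in the case of sums), respectively finite rows (in the case of
products). The entry `M i j` is the component from the `i`-th to the `j`-th summand. -/
def IsFinite (t : Mode) {I J : Type} {X : I → C} {Y : J → C} (M : ∀ i j, X i ⟶ Y j) : Prop :=
  match t with
  | .sum => ∀ i, {j | M i j ≠ 0}.Finite
  | .prod => ∀ j, {i | M i j ≠ 0}.Finite

/-- The group of matrices with finite columns, respectively rows. -/
def matrices (t : Mode) (X Y : Completion t C) : AddSubgroup (∀ i j, X.X i ⟶ Y.X j) where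
  carrier := {M | IsFinite t M}
  zero_mem' := by cases t <;> intro i <;> simp
  add_mem' := by
    intro a b ha hb
    cases t <;> intro i <;> refine ((ha i).union (hb i)).subset fun j hj => ?_ <;> by_contra h <;>
      simp only [Set.mem_union, Set.mem_ofPred_eq, not_or, not_not] at h <;>
      exact hj (by simp [h.1, h.2])
  neg_mem' := by
    intro a ha
    cases t <;> intro i <;> refine (ha i).subset fun j hj => ?_ <;> simpa using hj

variable {t : Mode}

theorem finite_pairs {I J K L : Type} {X : I → C} {Y : J → C} {Z : K → C} {W : L → C}
    {M : ∀ i j, X i ⟶ Y j} {N : ∀ j k, Y j ⟶ Z k} {P : ∀ k l, Z k ⟶ W l} (hM : IsFinite t M)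
    (hN : IsFinite t N) (hP : IsFinite t P) (i : I) (l : L) :
    {x : J × K | M i x.1 ≫ N x.1 x.2 ≫ P x.2 l ≠ 0}.Finite := by
  cases t
  · refine ((hM i).biUnion (t := fun j => (fun k => (j, k)) '' {k | N j k ≠ 0})
      fun j _ => (hN j).image _).subset ?_
    rintro ⟨j, k⟩ h
    simp only [Set.mem_iUnion, Set.mem_image, Set.mem_ofPred_eq, exists_prop] at h ⊢
    refine ⟨j, fun h0 => h (by simp [h0]), k, fun h0 => h (by simp [h0]), rfl⟩
  · refine ((hP l).biUnion (t := fun k => (fun j => (j, k)) '' {j | N j k ≠ 0})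
      fun k _ => (hN k).image _).subset ?_
    rintro ⟨j, k⟩ h
    simp only [Set.mem_iUnion, Set.mem_image, Set.mem_ofPred_eq, exists_prop] at h ⊢
    refine ⟨k, fun h0 => h (by simp [h0]), j, fun h0 => h (by simp [h0]), rfl⟩

theorem finite_comp {I J K : Type} {X : I → C} {Y : J → C} {Z : K → C}
    {M : ∀ i j, X i ⟶ Y j} {N : ∀ j k, Y j ⟶ Z k} (hM : IsFinite t M) (hN : IsFinite t N) (i : I)
    (k : K) : {j | M i j ≫ N j k ≠ 0}.Finite := by
  cases t
  · exact (hM i).subset fun j hj h => hj (by simp [h])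
  · exact (hN k).subset fun j hj h => hj (by simp [h])

theorem isFinite_comp {I J K : Type} {X : I → C} {Y : J → C} {Z : K → C}
    {M : ∀ i j, X i ⟶ Y j} {N : ∀ j k, Y j ⟶ Z k} (hM : IsFinite t M) (hN : IsFinite t N) :
    IsFinite t (fun i k => ∑ᶠ j, M i j ≫ N j k) := by
  cases t
  · intro i
    refine ((hM i).biUnion (t := fun j => {k | N j k ≠ 0}) fun j _ => hN j).subset ?_
    intro k hk
    obtain ⟨j, hj⟩ : ∃ j, M i j ≫ N j k ≠ 0 := by
      by_contra h
      push Not at h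
      exact hk (finsum_eq_zero_of_forall_eq_zero h)
    simp only [Set.mem_iUnion, Set.mem_ofPred_eq, exists_prop]
    exact ⟨j, fun h0 => hj (by simp [h0]), fun h0 => hj (by simp [h0])⟩
  · intro k
    refine ((hN k).biUnion (t := fun j => {i | M i j ≠ 0}) fun j _ => hM j).subset ?_
    intro i hi
    obtain ⟨j, hj⟩ : ∃ j, M i j ≫ N j k ≠ 0 := by
      by_contra h
      push Not at h
      exact hi (finsum_eq_zero_of_forall_eq_zero h)
    simp only [Set.mem_iUnion, Set.mem_ofPred_eq, exists_prop]
    exact ⟨j, fun h0 => hj (by simp [h0]), fun h0 => hj (by simp [h0])⟩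

open Classical in
theorem isFinite_id {I : Type} (X : I → C) :
    IsFinite t (fun i j => if h : i = j then eqToHom (congrArg X h) else 0 : ∀ i j, X i ⟶ X j) := by
  cases t
  · refine fun i => (Set.finite_singleton i).subset fun j hj => ?_
    by_contra h
    exact hj (dif_neg fun h' => h h'.symm)
  · refine fun i => (Set.finite_singleton i).subset fun j hj => ?_
    by_contra h
    exact hj (dif_neg fun h' => h h')

open Classical in
/-- Morphisms are matrices with finite columns (for sums), respectively rows (for products), and
composition is multiplication of matrices. -/
noncomputable instance : Category.{1} (Completion t C) where
  Hom X Y := matrices t X Y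
  id X := ⟨fun i j => if h : i = j then eqToHom (congrArg X.X h) else 0, isFinite_id X.X⟩
  comp f g := ⟨fun i k => ∑ᶠ j, f.1 i j ≫ g.1 j k, isFinite_comp f.2 g.2⟩
  id_comp f := Subtype.ext (by
    funext i k
    refine (finsum_eq_single _ i fun j hj => ?_).trans ?_
    · simp [hj.symm]
    · simp)
  comp_id f := Subtype.ext (by
    funext i k
    refine (finsum_eq_single _ k fun j hj => ?_).trans ?_
    · simp [hj]
    · simp)
  assoc f g h := Subtype.ext (by
    funext i l
    have hp := finite_pairs f.2 g.2 h.2 i l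
    have h1 : ∀ k, (∑ᶠ j, f.1 i j ≫ g.1 j k) ≫ h.1 k l =
        ∑ᶠ j, f.1 i j ≫ g.1 j k ≫ h.1 k l := fun k => by
      refine ((Preadditive.rightComp _ (h.1 k l)).map_finsum (finite_comp f.2 g.2 i k)).trans ?_
      exact finsum_congr fun j => Category.assoc _ _ _
    have h2 : ∀ j, f.1 i j ≫ (∑ᶠ k, g.1 j k ≫ h.1 k l) =
        ∑ᶠ k, f.1 i j ≫ g.1 j k ≫ h.1 k l := fun j =>
      (Preadditive.leftComp _ (f.1 i j)).map_finsum (finite_comp g.2 h.2 j l)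
    simp only [h1, h2]
    rw [← finsum_curry (fun x => f.1 i x.1 ≫ g.1 x.1 x.2 ≫ h.1 x.2 l) hp]
    rw [← finsum_curry (fun x => f.1 i x.2 ≫ g.1 x.2 x.1 ≫ h.1 x.1 l)
      (hp.preimage (f := Prod.swap) Prod.swap_injective.injOn)]
    exact finsum_comp_equiv (Equiv.prodComm _ _) (f := fun x => f.1 i x.1 ≫ g.1 x.1 x.2 ≫ h.1 x.2 l))

open Classical in
theorem id_val (X : Completion t C) (i : X.ι) : (𝟙 X : X ⟶ X).1 i i = 𝟙 (X.X i) := by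
  change (if h : i = i then eqToHom (congrArg X.X h) else 0) = _
  rw [dif_pos rfl, eqToHom_refl]

noncomputable instance : Preadditive (Completion t C) where
  homGroup X Y := inferInstanceAs (AddCommGroup (matrices t X Y))
  add_comp _ _ _ f f' g := Subtype.ext (by
    funext i k
    refine Eq.trans ?_ (finsum_add_distrib (finite_comp f.2 g.2 i k) (finite_comp f'.2 g.2 i k))
    exact finsum_congr fun j => Preadditive.add_comp _ _ _ _ _ _)
  comp_add _ _ _ f g g' := Subtype.ext (by
    funext i k
    refine Eq.trans ?_ (finsum_add_distrib (finite_comp f.2 g.2 i k) (finite_comp f.2 g'.2 i k))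
    exact finsum_congr fun j => Preadditive.comp_add _ _ _ _ _ _)

theorem isFinite_of_finite (t : Mode) {I J : Type} [Finite I] [Finite J] {X : I → C} {Y : J → C}
    (M : ∀ i j, X i ⟶ Y j) : IsFinite t M := by
  cases t <;> exact fun _ => Set.toFinite _

/-- The embedding of `C` as sums (products) with one term. -/
noncomputable def incl (t : Mode) (C : Type 1) [Category.{1} C] [Preadditive C] :
    C ⥤ Completion t C where
  obj X := ⟨Unit, inferInstance, fun _ => X⟩
  map f := ⟨fun _ _ => f, isFinite_of_finite t _⟩
  map_id X := Subtype.ext (by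
    funext i j
    exact (id_val (⟨Unit, inferInstance, fun _ => X⟩ : Completion t C) i).symm)
  map_comp f g := Subtype.ext (by
    funext i j
    exact (finsum_eq_single _ () fun k hk => (hk rfl).elim).symm)

instance : (incl t C).Additive where

end Completion

section Tot

variable {A B E : Type 1} [Category.{1} A] [Category.{1} B] [Category.{1} E] [Preadditive A]
  [Preadditive B] [Preadditive E]

open Classical in
/-- The identity of `K.X i` if `i = j`, and zero otherwise. -/
noncomputable def idOr (K : CochainComplex A ℤ) (i j : ℤ) : K.X i ⟶ K.X j :=
  if h : i = j then eqToHom (congrArg K.X h) else 0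

theorem idOr_self (K : CochainComplex A ℤ) (i : ℤ) : idOr K i i = 𝟙 _ := dif_pos rfl

theorem idOr_ne (K : CochainComplex A ℤ) {i j : ℤ} (h : i ≠ j) : idOr K i j = 0 := dif_neg h

/-- The action of a bifunctor on a pair of morphisms. -/
def biMap (F : A ⥤ B ⥤ E) {X X' : A} {Y Y' : B} (f : X ⟶ X') (g : Y ⟶ Y') :
    (F.obj X).obj Y ⟶ (F.obj X').obj Y' := (F.map f).app Y ≫ (F.obj X').map g

theorem biMap_comp (F : A ⥤ B ⥤ E) {X X' X'' : A} {Y Y' Y'' : B} (f : X ⟶ X') (f' : X' ⟶ X'')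
    (g : Y ⟶ Y') (g' : Y' ⟶ Y'') : biMap F f g ≫ biMap F f' g' = biMap F (f ≫ f') (g ≫ g') := by
  simp [biMap]

variable (F : A ⥤ B ⥤ E) [F.Additive] [∀ X, (F.obj X).Additive]

theorem biMap_zero_left {X X' : A} {Y Y' : B} (g : Y ⟶ Y') : biMap F (0 : X ⟶ X') g = 0 := by
  simp [biMap]

theorem biMap_zero_right {X X' : A} {Y Y' : B} (f : X ⟶ X') : biMap F f (0 : Y ⟶ Y') = 0 := by
  simp [biMap]

variable (K : CochainComplex A ℤ) (L : CochainComplex B ℤ)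

theorem finite_of_near {P : ℤ × ℤ → Prop} {s : Set {x // P x}} (x y : ℤ × ℤ)
    (h : ∀ z ∈ s, z.1 = x ∨ z.1 = y) : s.Finite := by
  refine ((Set.toFinite {x, y}).preimage (f := Subtype.val) Subtype.val_injective.injOn).subset ?_
  intro z hz
  exact h z hz

/-- The chain objects of the total complex. -/
noncomputable def totX (t : Mode) (p : ℤ) : Completion t E where
  ι := {x : ℤ × ℤ // x.1 + x.2 = p}
  countable := inferInstance
  X x := (F.obj (K.X x.1.1)).obj (L.X x.1.2)

/-- The part of the differential of the total complex that comes from `K`. -/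
noncomputable def totH (t : Mode) (p p' : ℤ) : totX F K L t p ⟶ totX F K L t p' :=
  ⟨fun x y => biMap F (K.d x.1.1 y.1.1) (idOr L x.1.2 y.1.2), by
    have h : ∀ (x : {x : ℤ × ℤ // x.1 + x.2 = p}) (y : {x : ℤ × ℤ // x.1 + x.2 = p'}),
        biMap F (K.d x.1.1 y.1.1) (idOr L x.1.2 y.1.2) ≠ 0 → x.1.1 + 1 = y.1.1 ∧ x.1.2 = y.1.2 := by
      intro x y h
      constructor
      · by_contra h'
        exact h (by rw [K.shape _ _ h', biMap_zero_left])
      · by_contra h'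
        exact h (by rw [idOr_ne _ h', biMap_zero_right])
    cases t
    · refine fun x => finite_of_near (x.1.1 + 1, x.1.2) (x.1.1 + 1, x.1.2) fun y hy => ?_
      obtain ⟨h1, h2⟩ := h x y hy
      exact Or.inl (Prod.ext h1.symm h2.symm)
    · refine fun y => finite_of_near (y.1.1 - 1, y.1.2) (y.1.1 - 1, y.1.2) fun x hx => ?_
      obtain ⟨h1, h2⟩ := h x y hx
      exact Or.inl (Prod.ext (by simp only; omega) h2)⟩

/-- The part of the differential of the total complex that comes from `L`. -/
noncomputable def totV (t : Mode) (p p' : ℤ) : totX F K L t p ⟶ totX F K L t p' :=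
  ⟨fun x y => (x.1.1.negOnePow : ℤ) • biMap F (idOr K x.1.1 y.1.1) (L.d x.1.2 y.1.2), by
    have h : ∀ (x : {x : ℤ × ℤ // x.1 + x.2 = p}) (y : {x : ℤ × ℤ // x.1 + x.2 = p'}),
        (x.1.1.negOnePow : ℤ) • biMap F (idOr K x.1.1 y.1.1) (L.d x.1.2 y.1.2) ≠ 0 →
        x.1.1 = y.1.1 ∧ x.1.2 + 1 = y.1.2 := by
      intro x y h
      constructor
      · by_contra h'
        exact h (by rw [idOr_ne _ h', biMap_zero_left, smul_zero])
      · by_contra h'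
        exact h (by rw [L.shape _ _ h', biMap_zero_right, smul_zero])
    cases t
    · refine fun x => finite_of_near (x.1.1, x.1.2 + 1) (x.1.1, x.1.2 + 1) fun y hy => ?_
      obtain ⟨h1, h2⟩ := h x y hy
      exact Or.inl (Prod.ext h1.symm h2.symm)
    · refine fun y => finite_of_near (y.1.1, y.1.2 - 1) (y.1.1, y.1.2 - 1) fun x hx => ?_
      obtain ⟨h1, h2⟩ := h x y hx
      exact Or.inl (Prod.ext h1 (by simp only; omega))⟩

theorem totH_totH (t : Mode) (p p' p'' : ℤ) : totH F K L t p p' ≫ totH F K L t p' p'' = 0 :=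
  Subtype.ext (by
    funext x z
    refine finsum_eq_zero_of_forall_eq_zero fun y => ?_
    refine (biMap_comp ..).trans ?_
    rw [K.d_comp_d, biMap_zero_left]
    rfl)

theorem totV_totV (t : Mode) (p p' p'' : ℤ) : totV F K L t p p' ≫ totV F K L t p' p'' = 0 :=
  Subtype.ext (by
    funext x z
    refine finsum_eq_zero_of_forall_eq_zero fun y => ?_
    refine (Preadditive.zsmul_comp ..).trans ?_
    refine (congrArg _ (Preadditive.comp_zsmul ..)).trans ?_
    refine (congrArg _ (congrArg _ (biMap_comp ..))).trans ?_
    rw [L.d_comp_d, biMap_zero_right]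
    have h0 : ∀ (u v : ℤ) (X Y : E), u • v • (0 : X ⟶ Y) = 0 := by simp
    exact h0 _ _ _ _)

theorem d_idOr (K : CochainComplex A ℤ) (i j : ℤ) : K.d i (i + 1) ≫ idOr K (i + 1) j = K.d i j := by
  by_cases h : i + 1 = j
  · subst h
    rw [idOr_self, Category.comp_id]
  · rw [idOr_ne _ h, Limits.comp_zero, K.shape _ _ h]

theorem totH_totV (t : Mode) (p p' p'' : ℤ) (h : p + 1 = p') (x : (totX F K L t p).ι)
    (z : (totX F K L t p'').ι) : (totH F K L t p p' ≫ totV F K L t p' p'').1 x z =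
      ((x.1.1 + 1).negOnePow : ℤ) • biMap F (K.d x.1.1 z.1.1) (L.d x.1.2 z.1.2) := by
  refine (finsum_eq_single _ (⟨(x.1.1 + 1, x.1.2), by have := x.2; simp only; omega⟩ :
    {x : ℤ × ℤ // x.1 + x.2 = p'}) fun y hy => ?_).trans ?_
  · have h0 : biMap F (K.d x.1.1 y.1.1) (idOr L x.1.2 y.1.2) = 0 := by
      by_cases h1 : x.1.1 + 1 = y.1.1
      · rw [idOr_ne, biMap_zero_right]
        exact fun h2 => hy (Subtype.ext (Prod.ext h1.symm h2.symm))
      · rw [K.shape _ _ h1, biMap_zero_left]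
    exact (congrArg (· ≫ _) h0).trans Limits.zero_comp
  · refine (Preadditive.comp_zsmul ..).trans ?_
    refine (congrArg _ (biMap_comp ..)).trans ?_
    rw [d_idOr, idOr_self, Category.id_comp]
    rfl

theorem totV_totH (t : Mode) (p p' p'' : ℤ) (h : p + 1 = p') (x : (totX F K L t p).ι)
    (z : (totX F K L t p'').ι) : (totV F K L t p p' ≫ totH F K L t p' p'').1 x z =
      (x.1.1.negOnePow : ℤ) • biMap F (K.d x.1.1 z.1.1) (L.d x.1.2 z.1.2) := by
  refine (finsum_eq_single _ (⟨(x.1.1, x.1.2 + 1), by have := x.2; simp only; omega⟩ :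
    {x : ℤ × ℤ // x.1 + x.2 = p'}) fun y hy => ?_).trans ?_
  · have h0 : (x.1.1.negOnePow : ℤ) • biMap F (idOr K x.1.1 y.1.1) (L.d x.1.2 y.1.2) = 0 := by
      by_cases h1 : x.1.2 + 1 = y.1.2
      · rw [idOr_ne, biMap_zero_left, smul_zero]
        exact fun h2 => hy (Subtype.ext (Prod.ext h2.symm h1.symm))
      · rw [L.shape _ _ h1, biMap_zero_right, smul_zero]
    exact (congrArg (· ≫ _) h0).trans Limits.zero_comp
  · refine (Preadditive.zsmul_comp ..).trans ?_
    refine (congrArg _ (biMap_comp ..)).trans ?_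
    rw [d_idOr, idOr_self, Category.id_comp]
    rfl

/-- The total complex of `F(K, L)`, with the sign rule
`d = F(d, 1) + (-1) ^ i F(1, d)` on `F(K ^ i, L ^ j)`. -/
noncomputable def tot (t : Mode) : CochainComplex (Completion t E) ℤ where
  X p := totX F K L t p
  d p p' := totH F K L t p p' + totV F K L t p p'
  shape p p' h := Subtype.ext (by
    have h' : p + 1 ≠ p' := h
    funext x y
    have hx := x.2
    have hy := y.2
    change biMap F (K.d x.1.1 y.1.1) (idOr L x.1.2 y.1.2) +
      (x.1.1.negOnePow : ℤ) • biMap F (idOr K x.1.1 y.1.1) (L.d x.1.2 y.1.2) = 0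
    have h1 : biMap F (K.d x.1.1 y.1.1) (idOr L x.1.2 y.1.2) = 0 := by
      by_cases h1 : x.1.1 + 1 = y.1.1
      · rw [idOr_ne, biMap_zero_right]
        exact fun h2 => h' (by omega)
      · rw [K.shape _ _ h1, biMap_zero_left]
    have h2 : biMap F (idOr K x.1.1 y.1.1) (L.d x.1.2 y.1.2) = 0 := by
      by_cases h1 : x.1.2 + 1 = y.1.2
      · rw [idOr_ne, biMap_zero_left]
        exact fun h2 => h' (by omega)
      · rw [L.shape _ _ h1, biMap_zero_right]
    rw [h1, h2, smul_zero, add_zero])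
  d_comp_d' p p' p'' h h' := by
    rw [Preadditive.add_comp, Preadditive.comp_add, Preadditive.comp_add, totH_totH, totV_totV,
      zero_add, add_zero]
    refine Subtype.ext ?_
    funext x z
    refine (congrArg₂ (· + ·) (totH_totV F K L t p p' p'' h x z)
      (totV_totH F K L t p p' p'' h x z)).trans ?_
    rw [Int.negOnePow_succ]
    simp only [Units.val_neg, neg_smul]
    exact neg_add_cancel _

end Tot

section MatBi

variable {A B E : Type 1} [Category.{1} A] [Category.{1} B] [Category.{1} E] [Preadditive A]
  [Preadditive B] [Preadditive E] (F : A ⥤ B ⥤ E) [F.Additive] [∀ X, (F.obj X).Additive]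

theorem biMap_sum_left {I : Type} [Fintype I] {X X' : A} {Y Y' : B} (f : I → (X ⟶ X'))
    (g : Y ⟶ Y') : biMap F (∑ i, f i) g = ∑ i, biMap F (f i) g := by
  simp [biMap, Functor.map_sum, NatTrans.app_sum, Preadditive.sum_comp]

theorem biMap_sum_right {I : Type} [Fintype I] {X X' : A} {Y Y' : B} (f : X ⟶ X')
    (g : I → (Y ⟶ Y')) : biMap F f (∑ i, g i) = ∑ i, biMap F f (g i) := by
  simp [biMap, Functor.map_sum, Preadditive.comp_sum]

/-- The matrix with entries `F(f i i', g j j')`. -/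
noncomputable def matMap {M M' : Mat_ A} {N N' : Mat_ B} (f : M ⟶ M') (g : N ⟶ N') :
    (⟨M.ι × N.ι, fun x => (F.obj (M.X x.1)).obj (N.X x.2)⟩ : Mat_ E) ⟶
      ⟨M'.ι × N'.ι, fun x => (F.obj (M'.X x.1)).obj (N'.X x.2)⟩ :=
  fun x y => biMap F (f x.1 y.1) (g x.2 y.2)

theorem matMap_id (M : Mat_ A) (N : Mat_ B) : matMap F (𝟙 M) (𝟙 N) = 𝟙 _ := by
  ext ⟨i, j⟩ ⟨i', j'⟩
  by_cases hi : i = i'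
  · subst hi
    by_cases hj : j = j'
    · subst hj
      simp [matMap, biMap]
    · rw [Mat_.id_apply_of_ne _ _ _ (by simpa using hj)]
      simp only [matMap]
      rw [Mat_.id_apply_of_ne _ _ _ hj, biMap_zero_right]
  · rw [Mat_.id_apply_of_ne _ _ _ (by simp [hi])]
    simp only [matMap]
    rw [Mat_.id_apply_of_ne _ _ _ hi, biMap_zero_left]

theorem matMap_comp {M M' M'' : Mat_ A} {N N' N'' : Mat_ B} (f : M ⟶ M') (f' : M' ⟶ M'')
    (g : N ⟶ N') (g' : N' ⟶ N'') :
    matMap F (f ≫ f') (g ≫ g') = matMap F f g ≫ matMap F f' g' := by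
  ext x y
  simp only [matMap, Mat_.comp_apply, biMap_sum_left, biMap_sum_right, Fintype.sum_prod_type,
    biMap_comp]
  exact Finset.sum_comm

/-- The extension of a bilinear functor to formal finite direct sums. -/
noncomputable def matBi : Mat_ A ⥤ Mat_ B ⥤ Mat_ E where
  obj M :=
    { obj := fun N => ⟨M.ι × N.ι, fun x => (F.obj (M.X x.1)).obj (N.X x.2)⟩
      map := fun g => matMap F (𝟙 M) g
      map_id := fun N => matMap_id F M N
      map_comp := fun g g' => by rw [← matMap_comp, Category.comp_id] }
  map f :=
    { app := fun N => matMap F f (𝟙 N)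
      naturality := fun N N' g => by
        rw [← matMap_comp, ← matMap_comp, Category.comp_id f, Category.id_comp f,
          Category.comp_id g, Category.id_comp g] }
  map_id M := by ext N : 2; exact matMap_id F M N
  map_comp f f' := by
    ext N : 2
    change matMap F (f ≫ f') (𝟙 N) = matMap F f (𝟙 N) ≫ matMap F f' (𝟙 N)
    rw [← matMap_comp, Category.comp_id]

instance : (matBi F).Additive where
  map_add {M M'} f f' := by
    ext N : 2
    funext x y
    change (F.map (f x.1 y.1 + f' x.1 y.1)).app _ ≫ _ = (F.map (f x.1 y.1)).app _ ≫ _ +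
      (F.map (f' x.1 y.1)).app _ ≫ _
    rw [F.map_add, NatTrans.app_add, Preadditive.add_comp]

instance (M : Mat_ A) : ((matBi F).obj M).Additive where
  map_add {N N'} g g' := by
    funext x y
    exact (congrArg (_ ≫ ·) ((F.obj _).map_add)).trans (Preadditive.comp_add ..)

instance {G : A ⥤ B} [G.Additive] : G.mapMat_.Additive where
  map_add {M N} f g := by
    funext x y
    exact G.map_add

end MatBi

instance (m k n : ℕ) : (GCob.stack m k n).Additive where
  map_add {X X'} f g := by
    ext Y
    refine Subtype.ext ?_
    change CHom.stack (f.1 + g.1) (CHom.id Y.curve) = CHom.stack f.1 _ + CHom.stack g.1 _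
    rw [map_add, LinearMap.add_apply]
    rfl

instance (m k n : ℕ) (X : GCob m k) : ((GCob.stack m k n).obj X).Additive where
  map_add {Y Y'} f g := by
    refine Subtype.ext ?_
    change CHom.stack (CHom.id X.curve) (f.1 + g.1) = CHom.stack _ f.1 + CHom.stack _ g.1
    rw [map_add]
    rfl

instance (x z m n : ℕ) : (GCob.widen x z m n).Additive where
  map_add {Y Y'} f g := by
    refine Subtype.ext ?_
    change CHom.juxt (CHom.juxt _ (f.1 + g.1)) _ = CHom.juxt (CHom.juxt _ f.1) _ +
      CHom.juxt (CHom.juxt _ g.1) _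
    rw [map_add, map_add, LinearMap.add_apply]
    rfl

/-- Formal finite direct sums of shifted diagrams. -/
abbrev BN (m n : ℕ) : Type 1 := Mat_ (GCob m n)

namespace BN

variable {m n k : ℕ}

/-- A shifted diagram `q ^ d * a` as a sum with one term. -/
noncomputable def of (a : Curve m n) (d : ℤ) : BN m n := (Mat_.embedding (GCob m n)).obj ⟨a, d⟩

/-- Vertical stacking of sums of diagrams; the first argument is on top. -/
noncomputable def stack (m k n : ℕ) : BN m k ⥤ BN k n ⥤ BN m n := matBi (GCob.stack m k n)

noncomputable instance : (stack m k n).Additive := inferInstanceAs (matBi _).Additive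

noncomputable instance (X : BN m k) : ((stack m k n).obj X).Additive :=
  inferInstanceAs ((matBi _).obj _).Additive

noncomputable instance (Y : BN k n) : ((stack m k n).flip.obj Y).Additive where
  map_add {X X'} f g := by
    change ((stack m k n).map (f + g)).app Y = _
    rw [Functor.map_add]
    rfl

/-- The dual of a morphism: the transposed matrix with reflected entries. -/
noncomputable def dualMap {X Y : BN m n} (f : X ⟶ Y) :
    (⟨Y.ι, fun i => (GCob.dual m n).obj (.op (Y.X i))⟩ : BN n m) ⟶
      ⟨X.ι, fun i => (GCob.dual m n).obj (.op (X.X i))⟩ :=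
  fun i j => (GCob.dual m n).map (f j i).op

theorem dualMap_zero {X Y : BN m n} : dualMap (0 : X ⟶ Y) = 0 := by
  funext i j
  exact Subtype.ext (map_zero CHom.dual)

theorem dual_sum {X Y : GCob m n} {I : Type} [Fintype I] (f : I → (X ⟶ Y)) :
    (GCob.dual m n).map (∑ i, f i).op = ∑ i, (GCob.dual m n).map (f i).op := by
  let φ : (X ⟶ Y) →+ ((GCob.dual m n).obj (.op Y) ⟶ (GCob.dual m n).obj (.op X)) :=
    AddMonoidHom.mk' (fun f => (GCob.dual m n).map f.op)
      (fun f g => Subtype.ext (map_add CHom.dual f.1 g.1))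
  exact map_sum φ f Finset.univ

theorem dualMap_comp {X Y Z : BN m n} (f : X ⟶ Y) (g : Y ⟶ Z) :
    dualMap (f ≫ g) = dualMap g ≫ dualMap f := by
  funext i j
  refine (dual_sum _).trans ?_
  exact Finset.sum_congr rfl fun k _ => (GCob.dual m n).map_comp _ _

/-- The dual complex, with `k`-th term the dual of the term of degree `-k` and differential the
negative of the dual of the differential. -/
noncomputable def dual (K : CochainComplex (BN m n) ℤ) : CochainComplex (BN n m) ℤ where
  X k := ⟨(K.X (-k)).ι, fun i => (GCob.dual m n).obj (.op ((K.X (-k)).X i))⟩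
  d i j := -dualMap (K.d (-j) (-i))
  shape i j h := by
    rw [K.shape, dualMap_zero, neg_zero]
    intro h'
    have h1 : i + 1 ≠ j := h
    have h2 : -j + 1 = -i := h'
    omega
  d_comp_d' i j k _ _ := by
    rw [Preadditive.neg_comp, Preadditive.comp_neg, ← dualMap_comp, K.d_comp_d, dualMap_zero,
      neg_zero, neg_zero]

/-- The complex `1_x ⊔ K ⊔ 1_z`. -/
noncomputable def widen (x z : ℕ) (K : CochainComplex (BN m n) ℤ) :
    CochainComplex (BN (x + m + z) (x + n + z)) ℤ :=
  ((GCob.widen x z m n).mapMat_.mapHomologicalComplex _).obj K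

end BN

/-- The complex is homotopy equivalent to zero. -/
def Contractible {C : Type 1} [Category.{1} C] [Preadditive C] (K : CochainComplex C ℤ) : Prop :=
  Nonempty (Homotopy (𝟙 K) 0)

/-- The complex becomes contractible when one joins two adjacent points on the top by an arc. -/
def KillsAbove {n m : ℕ} (K : CochainComplex (BN n m) ℤ) : Prop :=
  ∀ (i j : ℕ) (h : i + 2 + j = n), Contractible
    ((((BN.stack _ n m).obj (BN.of ((Curve.cap.widen i j).cast rfl h) 0)).mapHomologicalComplex
      _).obj K)

/-- The complex becomes contractible when one joins two adjacent points on the bottom by an arc. -/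
def KillsBelow {n m : ℕ} (K : CochainComplex (BN n m) ℤ) : Prop :=
  ∀ (i j : ℕ) (h : i + 2 + j = m), Contractible
    ((((BN.stack n m _).flip.obj
      (BN.of ((Curve.cup.widen i j).cast h rfl) 0)).mapHomologicalComplex _).obj K)

/-- Universal projectors: complexes in nonpositive degrees with the identity diagram in degree zero
that is not a summand (with any shift) in other degrees, and that kill turnbacks. -/
structure IsUniversalProjector (n : ℕ) (P : CochainComplex (BN n n) ℤ) : Prop where
  nonpos : ∀ i > 0, Limits.IsZero (P.X i)
  zero : Nonempty (P.X 0 ≅ BN.of (Curve.one n) 0)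
  ne_zero : ∀ i ≠ 0, ∀ d, IsEmpty (Retract (BN.of (Curve.one n) d) (P.X i))
  above : KillsAbove P
  below : KillsBelow P

/-- The stacked complex `K ⊗ L` with direct sum or direct product totalization. -/
noncomputable def stackTot (t : Mode) {m k n : ℕ} (K : CochainComplex (BN m k) ℤ)
    (L : CochainComplex (BN k n) ℤ) : CochainComplex (Completion t (BN m n)) ℤ :=
  tot (BN.stack m k n) K L t

/-- Homotopy equivalence, after embedding the finite sums, of a complex over the completion with a
complex of finite sums of diagrams. -/
def EquivTo {t : Mode} {m n : ℕ} (K : CochainComplex (Completion t (BN m n)) ℤ)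
    (L : CochainComplex (BN m n) ℤ) : Prop :=
  Nonempty (HomotopyEquiv K
    (((Completion.incl t (BN m n)).mapHomologicalComplex _).obj L))

/-!
In the bicomplex formed by stacking `1_x ⊔ P_y` on top of `P_a`, every row of nonzero index is
contractible. Indeed, a planar diagram with `n` points on the top and on the bottom that is not
made of vertical strands and circles has an innermost arc on the bottom
(`Curve.joinsBelow_of_arc`), so up to circles it ends with a cap. Circles can be split off by
delooping (`GCob.retractAddCircle`), so the diagram is a shifted direct summand of one that
factors through a turnback (`GCob.exists_retract_stack_capAt`), and `P_a` kills turnbacks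
(`BN.contractible_stack`). The same delooping shows that a diagram of vertical strands and circles
has a shift of the identity diagram as a summand (`GCob.exists_retract_one`); hence all diagrams
in the terms of `P_y` of nonzero degree contain turnbacks, and so do their duals and their
widenings.

The row of index zero is `P_a` itself, and it is a subcomplex or a quotient complex of the
bicomplex, since `P_y` lives in nonpositive degrees and its dual in nonnegative ones. Let `h` be
the sum of the contractions of the other rows, and let `ι` and `ρ` be the inclusion of and the
projection to the row of index zero. Then `d h + h d + ρ ι = 1 - u`, where `u` comes from the
horizontal differential and raises the row index by one. If `1 - u` is invertible, then `ι` (for a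
subcomplex) or `ρ` (for a quotient complex) is a homotopy equivalence
(`nonempty_homotopyEquiv_of_inclusion`, `nonempty_homotopyEquiv_of_projection`). The geometric
series `∑ u ^ k` is a matrix, but it has finite columns or finite rows only under a boundedness
condition on the bicomplex (`Completion.isIso_of_unitriangular`): direct sums need the row indices
to be bounded above along each diagonal, and direct products need them to be bounded below. This
decides which totalizations are admitted in the theorem (`nonempty_homotopyEquiv_tot`).

The statements about `P_a` on top follow by interchanging the two factors of the bicomplex
(`totSwapIso`), and those about the dual of `P_a` from the fact that reflection interchanges
killing turnbacks on the top and on the bottom (`KillsBelow.dual`, `KillsAbove.dual`).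
-/


/-! ### Gluing surfaces along product cobordisms -/

namespace Glue

/-- Gluing in three pieces does not depend on the bracketing. -/
def assoc {G H A B D : Type} (f : G → A) (g : G → B) (f' : H → B) (g' : H → D) :
    Glue (fun t => (inr (f' t) : Glue f g)) g' ≃ Glue f (fun t => (inl (g t) : Glue f' g')) where
  toFun := lift (lift inl (fun x => inr (inl x)) (fun t => cond t)) (fun x => inr (inr x))
    (fun t => congrArg inr (cond t))
  invFun := lift (fun x => inl (inl x)) (lift (fun x => inl (inr x)) inr (fun t => cond t))
    (fun t => congrArg inl (cond t))
  left_inv := ind (ind (fun _ => rfl) (fun _ => rfl)) (fun _ => rfl)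
  right_inv := ind (fun _ => rfl) (ind (fun _ => rfl) (fun _ => rfl))

/-- Gluing onto `G` itself does nothing. -/
def idLeft {G B : Type} (g : G → B) : Glue (fun t : G => t) g ≃ B where
  toFun := lift g (fun x => x) (fun _ => rfl)
  invFun := inr
  left_inv := ind (fun t => (cond t).symm) (fun _ => rfl)
  right_inv _ := rfl

/-- Gluing onto `G` itself does nothing. -/
def idRight {G A : Type} (f : G → A) : Glue f (fun t : G => t) ≃ A where
  toFun := lift (fun x => x) f (fun _ => rfl)
  invFun := inl
  left_inv := ind (fun _ => rfl) (fun t => cond t)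
  right_inv _ := rfl

/-- Gluing is symmetric. -/
def swap {G A B : Type} (f : G → A) (g : G → B) : Glue f g ≃ Glue g f where
  toFun := lift inr inl (fun t => (cond t).symm)
  invFun := lift inr inl (fun t => (cond t).symm)
  left_inv := ind (fun _ => rfl) (fun _ => rfl)
  right_inv := ind (fun _ => rfl) (fun _ => rfl)

theorem mapDomain_push {G A B D : Type} {f : G → A} {g : G → B} (F : Glue f g → D) (w : G →₀ ℤ)
    (u : A →₀ ℤ) (v : B →₀ ℤ) : (push f g w u v).mapDomain F =
      u.mapDomain (fun x => F (inl x)) + v.mapDomain (fun x => F (inr x)) -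
        w.mapDomain (fun t => F (inl (f t))) := by
  simp only [push, Finsupp.mapDomain_add, Curve.mapDomain_sub, ← Finsupp.mapDomain_comp,
    Function.comp_def]

theorem mapDomain_inl_add_inr {G A B D M : Type} [AddCommMonoid M] {f : G → A} {g : G → B}
    (F : Glue f g → D) (u : A →₀ M) (v : B →₀ M) :
    (u.mapDomain inl + v.mapDomain inr : Glue f g →₀ M).mapDomain F =
      u.mapDomain (fun x => F (inl x)) + v.mapDomain (fun x => F (inr x)) := by
  simp only [Finsupp.mapDomain_add, ← Finsupp.mapDomain_comp, Function.comp_def]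

end Glue

namespace Curve

variable {m n k l : ℕ}

/-- The Euler characteristics of the components are determined by the boundary points. -/
theorem chi_equiv {a b : Curve m n} (e : a.K ≃ b.K) (he : ∀ p, e (a.bd p) = b.bd p) :
    a.chi.mapDomain e = b.chi := by
  apply chi_ext
  rw [mapDomain_two, two_chi, two_chi, Finsupp.mapDomain_finsetSum]
  simp only [Finsupp.mapDomain_single, he]

/-- The components of three stacked diagrams. -/
def assocK (a : Curve m k) (b : Curve k l) (c : Curve l n) :
    ((a.stack b).stack c).K ≃ (a.stack (b.stack c)).K := Glue.assoc _ _ _ _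

theorem assocK_bd (a : Curve m k) (b : Curve k l) (c : Curve l n) (p) :
    assocK a b c (((a.stack b).stack c).bd p) = (a.stack (b.stack c)).bd p := by
  rcases p with p | p <;> rfl

/-- The components of a diagram below the identity diagram. -/
def oneStackK (a : Curve m n) : ((one m).stack a).K ≃ a.K := Glue.idLeft _

theorem oneStackK_bd (a : Curve m n) (p) : oneStackK a (((one m).stack a).bd p) = a.bd p := by
  rcases p with p | p <;> rfl

/-- The components of a diagram above the identity diagram. -/
def stackOneK (a : Curve m n) : (a.stack (one n)).K ≃ a.K := Glue.idRight _

theorem stackOneK_bd (a : Curve m n) (p) : stackOneK a ((a.stack (one n)).bd p) = a.bd p := by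
  rcases p with p | p <;> rfl

/-- The components of the reflection of two stacked diagrams. -/
def dualStackK (a : Curve m k) (b : Curve k n) : (a.stack b).dual.K ≃ (b.dual.stack a.dual).K :=
  Glue.swap _ _

theorem dualStackK_bd (a : Curve m k) (b : Curve k n) (p) :
    dualStackK a b ((a.stack b).dual.bd p) = (b.dual.stack a.dual).bd p := by
  rcases p with p | p <;> rfl

end Curve

namespace Surf

variable {m n k l : ℕ}

/-- A homeomorphism of surfaces that restricts to given identifications of the ends gives a
commuting square with the corresponding product cobordisms. -/
theorem comp_cyl_homeo {a b a' b' : Curve m n} (S : Surf a b) (S' : Surf a' b')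
    (ea : a.K ≃ a'.K) (hea : ∀ p, ea (a.bd p) = a'.bd p)
    (eb : b.K ≃ b'.K) (heb : ∀ p, eb (b.bd p) = b'.bd p)
    (u : S.C → S'.C) (v : S'.C → S.C) (hvu : ∀ x, v (u x) = x) (huv : ∀ x, u (v x) = x)
    (hs : ∀ x, u (S.src x) = S'.src (ea x)) (ht : ∀ x, u (S.tgt x) = S'.tgt (eb x))
    (hchi : S.chi.mapDomain u = S'.chi) (hdots : S.dots.mapDomain u = S'.dots) :
    (S.comp (cyl eb heb)).Homeo ((cyl ea hea).comp S') := by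
  refine .of (Glue.lift (fun x => Glue.inr (u x)) (fun y => Glue.inr (S'.tgt y))
      (fun x => congrArg Glue.inr (ht x)))
    (Glue.lift (fun x => Glue.inl (S.src (ea.symm x))) (fun c => Glue.inl (v c)) ?_)
    (Glue.ind (fun x => ?_) (fun y => ?_)) (Glue.ind (fun x => ?_) (fun y => ?_))
    (fun x => ?_) (fun y => rfl) ?_ ?_
  · intro t
    refine congrArg Glue.inl ?_
    rw [← hvu (S.src _), hs, Equiv.apply_symm_apply]
    rfl
  · exact congrArg Glue.inl (hvu x)
  · obtain ⟨x, rfl⟩ := eb.surjective y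
    refine Eq.trans ?_ (Glue.cond x)
    refine congrArg Glue.inl ?_
    rw [← ht, hvu]
  · refine (congrArg Glue.inr (hs _)).trans ?_
    rw [Equiv.apply_symm_apply]
    exact (Glue.cond (f := (cyl ea hea).tgt) x).symm
  · exact congrArg Glue.inr (huv y)
  · refine (congrArg Glue.inr (hs _)).trans ?_
    exact (Glue.cond (f := (cyl ea hea).tgt) (ea x)).symm
  · have h1 := Curve.chi_equiv eb heb
    simp only [comp, Glue.push, cyl, Finsupp.mapDomain_add, Curve.mapDomain_sub, ← hchi, ← h1,
      ← Finsupp.mapDomain_comp, Function.comp_def, Glue.lift_inl, Glue.lift_inr, ht, id]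
    abel!
  · simp only [comp, cyl, Finsupp.mapDomain_add, ← hdots,
      ← Finsupp.mapDomain_comp, Function.comp_def, Glue.lift_inl, Glue.lift_inr,
      Finsupp.mapDomain_zero]
    abel!

theorem assoc_homeo {a a' : Curve m k} {b b' : Curve k l} {c c' : Curve l n} (S : Surf a a')
    (T : Surf b b') (U : Surf c c') :
    (((S.stack T).stack U).comp (cyl _ (Curve.assocK_bd a' b' c'))).Homeo
      ((cyl _ (Curve.assocK_bd a b c)).comp (S.stack (T.stack U))) := by
  refine comp_cyl_homeo _ _ _ _ _ _
    (Glue.lift (Glue.lift Glue.inl (fun x => Glue.inr (Glue.inl x)) (fun t => Glue.cond t))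
      (fun x => Glue.inr (Glue.inr x)) (fun t => congrArg Glue.inr (Glue.cond t)))
    (Glue.lift (fun x => Glue.inl (Glue.inl x)) (Glue.lift (fun x => Glue.inl (Glue.inr x)) Glue.inr
      (fun t => Glue.cond t)) (fun t => congrArg Glue.inl (Glue.cond t)))
    (Glue.ind (Glue.ind (fun _ => rfl) (fun _ => rfl)) (fun _ => rfl))
    (Glue.ind (fun _ => rfl) (Glue.ind (fun _ => rfl) (fun _ => rfl)))
    (Glue.ind (Glue.ind (fun _ => rfl) (fun _ => rfl)) (fun _ => rfl))
    (Glue.ind (Glue.ind (fun _ => rfl) (fun _ => rfl)) (fun _ => rfl)) ?_ ?_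
  · refine (Glue.mapDomain_push ..).trans ?_
    simp only [Glue.push, Finsupp.mapDomain_add, Curve.mapDomain_sub,
      ← Finsupp.mapDomain_comp, Function.comp_def, Glue.lift_inl, Glue.lift_inr]
    abel!
  · refine (Glue.mapDomain_inl_add_inr ..).trans ?_
    simp only [Finsupp.mapDomain_add,
      ← Finsupp.mapDomain_comp, Function.comp_def, Glue.lift_inl, Glue.lift_inr]
    abel!

theorem one_stack_homeo {a b : Curve m n} (S : Surf a b) :
    (((id (Curve.one m)).stack S).comp (cyl _ (Curve.oneStackK_bd b))).Homeo
      ((cyl _ (Curve.oneStackK_bd a)).comp S) := by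
  refine comp_cyl_homeo _ _ _ _ _ _
    (Glue.lift (fun i => S.src (a.bd (Sum.inl i))) (fun x => x) (fun _ => rfl)) Glue.inr
    (Glue.ind (fun t => (Glue.cond t).symm) (fun _ => rfl)) (fun _ => rfl)
    (Glue.ind (fun _ => rfl) (fun _ => rfl))
    (Glue.ind (fun x => S.side _) (fun _ => rfl)) ?_ ?_
  · refine (Glue.mapDomain_push ..).trans ?_
    exact (add_sub_cancel_left _ _).trans (mapDomain_id' _)
  · refine (Glue.mapDomain_inl_add_inr ..).trans ?_
    simp only [Finsupp.mapDomain_zero]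
    exact (zero_add _).trans (mapDomain_id' _)

theorem stack_one_homeo {a b : Curve m n} (S : Surf a b) :
    ((S.stack (id (Curve.one n))).comp (cyl _ (Curve.stackOneK_bd b))).Homeo
      ((cyl _ (Curve.stackOneK_bd a)).comp S) := by
  refine comp_cyl_homeo _ _ _ _ _ _
    (Glue.lift (fun x => x) (fun i => S.src (a.bd (Sum.inr i))) (fun _ => rfl)) Glue.inl
    (Glue.ind (fun _ => rfl) (fun t => Glue.cond t)) (fun _ => rfl)
    (Glue.ind (fun _ => rfl) (fun _ => rfl))
    (Glue.ind (fun _ => rfl) (fun x => S.side _)) ?_ ?_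
  · refine (Glue.mapDomain_push ..).trans ?_
    exact (add_sub_cancel_right _ _).trans (mapDomain_id' _)
  · refine (Glue.mapDomain_inl_add_inr ..).trans ?_
    simp only [Finsupp.mapDomain_zero]
    exact (add_zero _).trans (mapDomain_id' _)

theorem dual_stack_homeo {a a' : Curve m k} {b b' : Curve k n} (S : Surf a a') (T : Surf b b') :
    ((S.stack T).dual.comp (cyl _ (Curve.dualStackK_bd a b))).Homeo
      ((cyl _ (Curve.dualStackK_bd a' b')).comp (T.dual.stack S.dual)) := by
  let u : (S.stack T).dual.C → (T.dual.stack S.dual).C :=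
    Glue.lift Glue.inr Glue.inl (fun i => by
      rw [S.side, T.side]
      exact (Glue.cond (f := fun i => T.dual.src (b'.dual.bd (Sum.inr i)))
        (g := fun i => S.dual.src (a'.dual.bd (Sum.inl i))) i).symm)
  let v : (T.dual.stack S.dual).C → (S.stack T).dual.C :=
    Glue.lift Glue.inr Glue.inl (fun i => by
      change Glue.inr (T.tgt (b'.bd (Sum.inl i))) = Glue.inl (S.tgt (a'.bd (Sum.inr i)))
      rw [← S.side, ← T.side]
      exact (Glue.cond (f := fun i => S.src (a.bd (Sum.inr i)))
        (g := fun i => T.src (b.bd (Sum.inl i))) i).symm)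
  refine comp_cyl_homeo _ _ _ _ _ _ u v
    (Glue.ind (fun _ => rfl) (fun _ => rfl)) (Glue.ind (fun _ => rfl) (fun _ => rfl))
    (Glue.ind (fun _ => rfl) (fun _ => rfl)) (Glue.ind (fun _ => rfl) (fun _ => rfl)) ?_ ?_
  · have hw : ∀ i, (u (Glue.inl (S.src (a.bd (Sum.inr i)))) : (T.dual.stack S.dual).C) =
        Glue.inl (T.tgt (b'.bd (Sum.inl i))) := fun i => by
      refine Eq.trans ?_ (Glue.cond (f := fun i => T.dual.src (b'.dual.bd (Sum.inr i)))
          (g := fun i => S.dual.src (a'.dual.bd (Sum.inl i))) i).symm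
      rw [S.side]
      rfl
    have key : ∀ p q r r' : (T.dual.stack S.dual).C →₀ ℤ, r = r' → p + q - r = q + p - r' := by
      rintro p q r _ rfl
      rw [add_comm]
    simp only [stack, dual, Glue.push, Finsupp.mapDomain_add, Curve.mapDomain_sub,
      ← Finsupp.mapDomain_comp, Function.comp_def]
    exact key _ _ _ _ (congrArg (fun f => Finsupp.mapDomain f (Curve.one k).chi) (funext hw))
  · simp only [stack, dual, Finsupp.mapDomain_add,
      ← Finsupp.mapDomain_comp, Function.comp_def]
    exact add_comm _ _

end Surf

/-! ### Product cobordisms and stacking isomorphisms -/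

/-- The product cobordism of an identification of components. -/
noncomputable def Cob.cyl {m n : ℕ} {a b : Curve m n} (e : a.K ≃ b.K)
    (he : ∀ p, e (a.bd p) = b.bd p) : Cob a b := ⟨Surf.cyl e he, .cyl e he⟩

namespace CHom

variable {m n k l : ℕ}

/-- The class of the product cobordism of an identification of components. -/
noncomputable def cyl {a b : Curve m n} (e : a.K ≃ b.K) (he : ∀ p, e (a.bd p) = b.bd p) :
    CHom a b := mk (Cob.cyl e he)

theorem cyl_mem {a b : Curve m n} (e : a.K ≃ b.K) (he : ∀ p, e (a.bd p) = b.bd p) :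
    cyl e he ∈ homog a b 0 := by
  refine AddSubgroup.subset_closure ⟨0, Cob.cyl e he, ?_, by simp [cyl]⟩
  have h := b.two_total
  simp only [Cob.deg, Cob.cyl, Surf.cyl, Finsupp.sum_zero_index]
  omega

theorem cyl_comp_cyl_symm {a b : Curve m n} (e : a.K ≃ b.K) (he : ∀ p, e (a.bd p) = b.bd p)
    (he' : ∀ p, e.symm (b.bd p) = a.bd p) : comp (cyl e he) (cyl e.symm he') = id a := by
  refine Eq.trans ?_ (id_comp (id a))
  refine (comp_mk _ _).trans (Eq.trans (mk_eq ?_) (comp_mk _ _).symm)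
  exact Surf.comp_cyl_homeo (Surf.cyl e he) (Surf.id a) (Equiv.refl _) (fun _ => rfl) e.symm he'
    e.symm e e.apply_symm_apply e.symm_apply_apply e.symm_apply_apply (fun _ => rfl)
    (Curve.chi_equiv e.symm he') Finsupp.mapDomain_zero

/-- The associativity of stacking is natural with respect to cobordisms. -/
theorem comp_assocK {a a' : Curve m k} {b b' : Curve k l} {c c' : Curve l n} (x : CHom a a')
    (y : CHom b b') (z : CHom c c') :
    comp (stack (stack x y) z) (cyl _ (Curve.assocK_bd a' b' c')) =
      comp (cyl _ (Curve.assocK_bd a b c)) (stack x (stack y z)) := by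
  induction x using ind with
  | h0 => simp
  | ha x x' hx hx' => simp only [map_add, LinearMap.add_apply, hx, hx']
  | hs r x hx => simp only [map_smul, LinearMap.smul_apply, hx]
  | hm S =>
  induction y using ind with
  | h0 => simp
  | ha x x' hx hx' => simp only [map_add, LinearMap.add_apply, hx, hx']
  | hs r x hx => simp only [map_smul, LinearMap.smul_apply, hx]
  | hm T =>
  induction z using ind with
  | h0 => simp
  | ha x x' hx hx' => simp only [map_add, LinearMap.add_apply, hx, hx']
  | hs r x hx => simp only [map_smul, LinearMap.smul_apply, hx]
  | hm U =>
    rw [cyl, cyl, stack_mk, stack_mk, stack_mk, stack_mk, comp_mk, comp_mk]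
    exact mk_eq (Surf.assoc_homeo S.1 T.1 U.1)

theorem comp_oneStackK {a b : Curve m n} (x : CHom a b) :
    comp (stack (id (Curve.one m)) x) (cyl _ (Curve.oneStackK_bd b)) =
      comp (cyl _ (Curve.oneStackK_bd a)) x := by
  induction x using ind with
  | h0 => simp
  | ha x x' hx hx' => simp only [map_add, LinearMap.add_apply, hx, hx']
  | hs r x hx => simp only [map_smul, LinearMap.smul_apply, hx]
  | hm S =>
    rw [cyl, cyl, id, stack_mk, comp_mk, comp_mk]
    exact mk_eq (Surf.one_stack_homeo S.1)

theorem comp_stackOneK {a b : Curve m n} (x : CHom a b) :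
    comp (stack x (id (Curve.one n))) (cyl _ (Curve.stackOneK_bd b)) =
      comp (cyl _ (Curve.stackOneK_bd a)) x := by
  induction x using ind with
  | h0 => simp
  | ha x x' hx hx' => simp only [map_add, LinearMap.add_apply, hx, hx']
  | hs r x hx => simp only [map_smul, LinearMap.smul_apply, hx]
  | hm S =>
    rw [cyl, cyl, id, stack_mk, comp_mk, comp_mk]
    exact mk_eq (Surf.stack_one_homeo S.1)

/-- Reflection reverses stacking, naturally with respect to cobordisms. -/
theorem comp_dualStackK {a a' : Curve m k} {b b' : Curve k n} (x : CHom a a') (y : CHom b b') :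
    comp (dual (stack x y)) (cyl _ (Curve.dualStackK_bd a b)) =
      comp (cyl _ (Curve.dualStackK_bd a' b')) (stack (dual y) (dual x)) := by
  induction x using ind with
  | h0 => simp
  | ha x x' hx hx' => simp only [map_add, LinearMap.add_apply, hx, hx']
  | hs r x hx => simp only [map_smul, LinearMap.smul_apply, hx]
  | hm S =>
  induction y using ind with
  | h0 => simp
  | ha x x' hx hx' => simp only [map_add, LinearMap.add_apply, hx, hx']
  | hs r x hx => simp only [map_smul, LinearMap.smul_apply, hx]
  | hm T =>
    rw [cyl, cyl, stack_mk, dual_mk, dual_mk, dual_mk, stack_mk, comp_mk, comp_mk]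
    exact mk_eq (Surf.dual_stack_homeo S.1 T.1)

end CHom

namespace GCob

variable {m n k l : ℕ}

/-- Diagrams with the same arcs and equally many circles are isomorphic: the product cobordism of a
bijection of their components is invertible. -/
noncomputable def isoOfEquiv {X Y : GCob m n} (e : X.curve.K ≃ Y.curve.K)
    (he : ∀ p, e (X.curve.bd p) = Y.curve.bd p) (hs : X.shift = Y.shift) : X ≅ Y where
  hom := ⟨CHom.cyl e he, by rw [hs, sub_self]; exact CHom.cyl_mem e he⟩
  inv := ⟨CHom.cyl e.symm (fun p => by rw [← he, e.symm_apply_apply]), by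
    rw [hs, sub_self]; exact CHom.cyl_mem _ _⟩
  hom_inv_id := Subtype.ext (CHom.cyl_comp_cyl_symm e he _)
  inv_hom_id := Subtype.ext (CHom.cyl_comp_cyl_symm e.symm _ he)

/-- Associativity of stacking, natural in the diagram on the bottom. -/
noncomputable def stackAssocBelow (X : GCob m k) (Y : GCob k l) :
    (stack m l n).obj (((stack m k l).obj X).obj Y) ≅
      (stack k l n).obj Y ⋙ (stack m k n).obj X :=
  NatIso.ofComponents
    (fun Z => isoOfEquiv (X := ⟨(X.curve.stack Y.curve).stack Z.curve, X.shift + Y.shift + Z.shift⟩)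
      (Y := ⟨X.curve.stack (Y.curve.stack Z.curve), X.shift + (Y.shift + Z.shift)⟩) _
      (Curve.assocK_bd X.curve Y.curve Z.curve) (add_assoc _ _ _))
    (fun {Z Z'} f => Subtype.ext (by
      refine Eq.trans ?_ (CHom.comp_assocK (CHom.id X.curve) (CHom.id Y.curve) f.1)
      change CHom.comp (CHom.stack (CHom.id _) f.1) _ = _
      rw [CHom.stack_id]
      rfl))

/-- Associativity of stacking, natural in the diagram on the top. -/
noncomputable def stackAssocAbove (Y : GCob k l) (Z : GCob l n) :
    (stack m k n).flip.obj (((stack k l n).obj Y).obj Z) ≅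
      (stack m k l).flip.obj Y ⋙ (stack m l n).flip.obj Z :=
  (NatIso.ofComponents
    (fun X => isoOfEquiv (X := ⟨(X.curve.stack Y.curve).stack Z.curve, X.shift + Y.shift + Z.shift⟩)
      (Y := ⟨X.curve.stack (Y.curve.stack Z.curve), X.shift + (Y.shift + Z.shift)⟩) _
      (Curve.assocK_bd X.curve Y.curve Z.curve) (add_assoc _ _ _))
    (fun {X X'} f => Subtype.ext (by
      refine (CHom.comp_assocK f.1 (CHom.id Y.curve) (CHom.id Z.curve)).trans ?_
      change _ = CHom.comp _ (CHom.stack f.1 (CHom.id _))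
      rw [CHom.stack_id]
      rfl))).symm

/-- Stacking the identity diagram on top does nothing. -/
noncomputable def oneStack : (stack m m n).obj ⟨Curve.one m, 0⟩ ≅ 𝟭 (GCob m n) :=
  NatIso.ofComponents
    (fun Z => isoOfEquiv (X := ⟨(Curve.one m).stack Z.curve, 0 + Z.shift⟩) _
      (Curve.oneStackK_bd Z.curve) (zero_add _))
    (fun f => Subtype.ext (CHom.comp_oneStackK f.1))

/-- Stacking the identity diagram on the bottom does nothing. -/
noncomputable def stackOne : (stack m n n).flip.obj ⟨Curve.one n, 0⟩ ≅ 𝟭 (GCob m n) :=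
  NatIso.ofComponents
    (fun Z => isoOfEquiv (X := ⟨Z.curve.stack (Curve.one n), Z.shift + 0⟩) _
      (Curve.stackOneK_bd Z.curve) (add_zero _))
    (fun f => Subtype.ext (CHom.comp_stackOneK f.1))

end GCob

/-! ### Turnbacks and through-strands in crossingless diagrams -/

namespace Curve

variable {m n : ℕ}

/-- At most two boundary points lie on a component. -/
theorem eq_or_eq_or_eq (a : Curve m n) {p q r : Fin m ⊕ Fin n} (h1 : a.bd p = a.bd q)
    (h2 : a.bd p = a.bd r) : p = q ∨ p = r ∨ q = r := by
  classical
  by_contra! h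
  obtain ⟨hpq, hpr, hqr⟩ := h
  have hs : ({p, q, r} : Finset _) ⊆ Finset.univ.filter (a.bd · = a.bd p) := by
    intro x hx
    simp only [Finset.mem_insert, Finset.mem_singleton] at hx
    rw [Finset.mem_filter]
    rcases hx with rfl | rfl | rfl
    exacts [⟨Finset.mem_univ _, rfl⟩, ⟨Finset.mem_univ _, h1.symm⟩, ⟨Finset.mem_univ _, h2.symm⟩]
  have := Finset.card_le_card hs
  rw [Finset.card_eq_three.2 ⟨p, q, r, hpq, hpr, hqr, rfl⟩, card_filter_fiber] at this
  rcases a.ends (a.bd p) with h | h <;> omega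

theorem exists_partner (a : Curve m n) (p : Fin m ⊕ Fin n) : ∃ q ≠ p, a.bd q = a.bd p := by
  have h2 : Nat.card {q // a.bd q = a.bd p} = 2 := by
    refine (a.ends (a.bd p)).resolve_left fun h => ?_
    rw [Nat.card_eq_zero] at h
    rcases h with h | h
    · exact h.elim ⟨p, rfl⟩
    · exact h.not_finite inferInstance
  have : Nontrivial {q // a.bd q = a.bd p} := by
    rw [← Finite.one_lt_card_iff_nontrivial]
    omega
  obtain ⟨q, hq⟩ := exists_ne (⟨p, rfl⟩ : {q // a.bd q = a.bd p})
  exact ⟨q.1, fun h => hq (Subtype.ext h), q.2⟩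

/-- Two adjacent points on the bottom are joined by an arc. -/
def JoinsBelow (a : Curve m n) : Prop :=
  ∃ (i : ℕ) (h : i + 1 < n), a.bd (Sum.inr ⟨i, by omega⟩) = a.bd (Sum.inr ⟨i + 1, h⟩)

/-- Two adjacent points on the top are joined by an arc. -/
def JoinsAbove (a : Curve m n) : Prop :=
  ∃ (i : ℕ) (h : i + 1 < m), a.bd (Sum.inl ⟨i, by omega⟩) = a.bd (Sum.inl ⟨i + 1, h⟩)

/-- Below an arc that joins two points on the bottom there is an innermost one: by planarity, the
point next to the left end of the arc is joined to another point below the arc. -/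
theorem joinsBelow_of_arc (a : Curve m n) (d : ℕ) : ∀ p q : Fin n, (p : ℕ) + d = q → p ≠ q →
    a.bd (Sum.inr p) = a.bd (Sum.inr q) → a.JoinsBelow := by
  induction d using Nat.strong_induction_on with
  | _ d ih =>
  intro p q hd hne h
  have hpq : (p : ℕ) ≠ q := fun h' => hne (Fin.ext h')
  by_cases h1 : (p : ℕ) + 1 = q
  · refine ⟨p, by omega, ?_⟩
    rw [Fin.eta, h]
    exact congrArg (fun x => a.bd (Sum.inr x)) (Fin.ext h1.symm)
  let r : Fin n := ⟨p + 1, by omega⟩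
  obtain ⟨s, hs, hsr⟩ := a.exists_partner (Sum.inr r)
  have hrv : (r : ℕ) = p + 1 := rfl
  -- the third point on the arc through `p` and `q` would be `r`
  have hno : a.bd (Sum.inr p) ≠ a.bd (Sum.inr r) := by
    intro h'
    rcases a.eq_or_eq_or_eq h h' with h | h | h <;>
      (have := congrArg (Sum.elim (fun _ => 0) Fin.val) h; simp only [Sum.elim_inr] at this; omega)
  have pos : ∀ j : Fin n, circPos m n (Sum.inr j) = m + (n - (j + 1)) := fun j => by
    simp [circPos, Fin.val_rev]
  have hp := pos p
  have hq := pos q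
  have hr := pos r
  have outer : circPos m n s < circPos m n (Sum.inr q) → False := fun hlt =>
    hno (by rw [h, ← a.planar s (Sum.inr q) (Sum.inr r) (Sum.inr p) hlt (by omega) (by omega) hsr
      h.symm, hsr])
  rcases s with t | t
  · exact (outer (by rw [hq]; simp only [circPos, Sum.elim_inl]; omega)).elim
  · have ht := pos t
    have htr : (t : ℕ) ≠ r := fun h => hs (congrArg Sum.inr (Fin.ext h))
    rcases lt_trichotomy (t : ℕ) q with h2 | h2 | h2
    · rcases lt_trichotomy (t : ℕ) p with h3 | h3 | h3
      · refine (hno ?_).elim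
        rw [h]
        exact a.planar (Sum.inr q) (Sum.inr r) (Sum.inr p) (Sum.inr t) (by omega) (by omega)
          (by omega) h.symm hsr.symm
      · exact (hno (by rw [← hsr, Fin.ext h3])).elim
      · exact ih (t - r) (by omega) r t (by omega) (fun h => htr (congrArg Fin.val h.symm)) hsr.symm
    · exact (hno (by rw [← hsr, Fin.ext h2, h])).elim
    · exact (outer (by omega)).elim

/-- A planar diagram without an arc that joins two adjacent points on the bottom consists of
vertical strands and circles. -/
theorem bd_eq_of_not_joinsBelow (a : Curve n n) (h : ¬ a.JoinsBelow) (t : Fin n) :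
    a.bd (Sum.inl t) = a.bd (Sum.inr t) := by
  have harc : ∀ p q : Fin n, p ≠ q → a.bd (Sum.inr p) ≠ a.bd (Sum.inr q) := by
    intro p q hne hb
    rcases Nat.lt_or_gt_of_ne (fun h' => hne (Fin.ext h')) with h' | h'
    · exact h (a.joinsBelow_of_arc (q - p) p q (by omega) hne hb)
    · exact h (a.joinsBelow_of_arc (p - q) q p (by omega) hne.symm hb.symm)
  have hf : ∀ j : Fin n, ∃ i : Fin n, a.bd (Sum.inl i) = a.bd (Sum.inr j) := by
    intro j
    obtain ⟨s | s, hs, hsj⟩ := a.exists_partner (Sum.inr j)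
    · exact ⟨s, hsj⟩
    · exact (harc s j (fun h => hs (congrArg _ h)) hsj).elim
  choose f hf using hf
  have hmono : StrictMono f := by
    intro p q hpq
    have hne : f p ≠ f q := fun h' => harc p q hpq.ne (by rw [← hf, ← hf, h'])
    by_contra hlt
    have hlt' : f q < f p := lt_of_le_of_ne (not_lt.1 hlt) hne.symm
    refine harc p q hpq.ne ?_
    rw [← hf p, ← hf q]
    refine (a.planar (Sum.inl (f q)) (Sum.inl (f p)) (Sum.inr q) (Sum.inr p) ?_ ?_ ?_ (hf q)
      (hf p)).symm <;>
      simp only [circPos, Sum.elim_inl, Sum.elim_inr, Fin.val_rev] <;> omega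
  have hid : f = id := (StrictMono.range_inj hmono strictMono_id).1 (by
    rw [(Finite.injective_iff_surjective.1 hmono.injective).range_eq, Set.range_id])
  rw [← hf t, hid, id]

theorem joinsBelow_of_ne (a : Curve n n) (h : ¬ ∀ t, a.bd (Sum.inl t) = a.bd (Sum.inr t)) :
    a.JoinsBelow := by
  by_contra h'
  exact h (a.bd_eq_of_not_joinsBelow h')

theorem joinsAbove_of_ne (a : Curve n n) (h : ¬ ∀ t, a.bd (Sum.inl t) = a.bd (Sum.inr t)) :
    a.JoinsAbove :=
  a.dual.joinsBelow_of_ne fun h' => h fun t => (h' t).symm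

/-- Removal of the circle `k`. -/
def erase (a : Curve m n) (k : a.K) (hk : ∀ p, a.bd p ≠ k) : Curve m n where
  K := {x // x ≠ k}
  finite := inferInstance
  bd p := ⟨a.bd p, hk p⟩
  ends x := by simpa only [Subtype.ext_iff] using a.ends x.1
  planar p q r s h1 h2 h3 h4 h5 := Subtype.ext (a.planar p q r s h1 h2 h3
    (congrArg Subtype.val h4) (congrArg Subtype.val h5))

/-- A circle is placed to the right of `a`. -/
def addCircle (a : Curve m n) : Curve m n := a.juxt circle

theorem juxt_zero_bd (a : Curve m n) (b : Curve 0 0) (p : Fin m ⊕ Fin n) :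
    (a.juxt b : Curve m n).bd p = Sum.inl (a.bd p) := by
  rcases p with p | p
  · exact Fin.addCases_left (m := m) (n := 0) (motive := fun _ => a.K ⊕ b.K)
      (left := fun i => Sum.inl (a.bd (Sum.inl i))) (right := fun i => Sum.inr (b.bd (Sum.inl i))) p
  · exact Fin.addCases_left (m := n) (n := 0) (motive := fun _ => a.K ⊕ b.K)
      (left := fun i => Sum.inl (a.bd (Sum.inr i))) (right := fun i => Sum.inr (b.bd (Sum.inr i))) p

theorem addCircle_bd (a : Curve m n) (p) : a.addCircle.bd p = Sum.inl (a.bd p) :=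
  a.juxt_zero_bd circle p

open Classical in
theorem exists_equiv_erase (a : Curve m n) (k : a.K) (hk : ∀ p, a.bd p ≠ k) :
    ∃ e : (a.erase k hk).addCircle.K ≃ a.K, ∀ p, e ((a.erase k hk).addCircle.bd p) = a.bd p := by
  have : Unique {x // ¬ x ≠ k} := ⟨⟨⟨k, by simp⟩⟩, fun x => Subtype.ext (by simpa using x.2)⟩
  refine ⟨(Equiv.sumCongr (Equiv.refl _) (Equiv.ofUnique Unit {x // ¬ x ≠ k})).trans
    (Equiv.sumCompl (· ≠ k)), fun p => ?_⟩
  rw [addCircle_bd]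
  rfl

end Curve

/-- A sphere with one dot is the empty cobordism. -/
theorem CHom.birth_comp_death : CHom.comp (CHom.mk ⟨Surf.birth, .birth⟩)
    (CHom.mk ⟨Surf.death.addDot (), .dot () .death⟩) = CHom.id (Curve.one 0) := by
  refine (CHom.comp_mk _ _).trans ((Submodule.Quotient.eq _).2 (.sphere1 _ ?_))
  refine .of (fun _ => ()) (fun _ => Glue.inl ()) (Glue.ind (fun _ => rfl)
    (fun _ => Glue.cond (f := Surf.birth.tgt) (g := Surf.death.src) ())) (fun _ => rfl)
    (fun _ => rfl) (fun _ => rfl) ?_ ?_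
  · refine (Glue.mapDomain_push ..).trans ?_
    have h : Curve.circle.chi = 0 := by
      ext
      exact Curve.ind_neg (by rintro ⟨p | p, -⟩ <;> exact p.elim0)
    refine (congrArg _ ((congrArg _ h).trans Finsupp.mapDomain_zero)).trans ((sub_zero _).trans ?_)
    refine (congrArg₂ (· + ·) Finsupp.mapDomain_single Finsupp.mapDomain_single).trans ?_
    exact (Finsupp.single_add _ _ _).symm
  · refine (Glue.mapDomain_inl_add_inr ..).trans ?_
    refine (congrArg₂ (· + ·) Finsupp.mapDomain_zero ((congrArg _ (zero_add _)).trans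
      Finsupp.mapDomain_single)).trans ?_
    exact zero_add _

namespace GCob

variable {m n : ℕ}

/-- A diagram is a shifted direct summand of its union with a circle: the inclusion is the birth of
the circle, the projection is its death with a dot. -/
noncomputable def retractAddCircle (a : Curve m n) (s : ℤ) :
    Retract (⟨a, s⟩ : GCob m n) ⟨a.addCircle, s + 1⟩ := by
  let b : Curve m n := a.juxt (Curve.one 0)
  let e : (⟨b, s⟩ : GCob m n) ≅ ⟨a, s⟩ := isoOfEquiv (Equiv.sumEmpty a.K (Fin 0))
    (fun p => congrArg (Equiv.sumEmpty a.K (Fin 0)) (a.juxt_zero_bd (Curve.one 0) p)) rfl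
  refine Retract.trans (Retract.ofIso e.symm) ?_
  refine ⟨⟨CHom.juxt (CHom.id a) (CHom.mk ⟨Surf.birth, .birth⟩), ?_⟩,
    ⟨CHom.juxt (CHom.id a) (CHom.mk ⟨Surf.death.addDot (), .dot () .death⟩), ?_⟩, ?_⟩
  · refine homog.juxt_mem (d := 0) (e := -1) (by simp) (homog.id_mem _)
      (AddSubgroup.subset_closure ⟨0, ⟨Surf.birth, .birth⟩, ?_, by rw [pow_zero, one_smul]⟩)
    simp [Cob.deg, Surf.birth]
  · refine homog.juxt_mem (d := 0) (e := 1) (by simp) (homog.id_mem _)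
      (AddSubgroup.subset_closure ⟨0, ⟨Surf.death.addDot (), .dot () .death⟩, ?_,
        by rw [pow_zero, one_smul]⟩)
    simp [Cob.deg, Surf.death, Surf.addDot]
  · refine Subtype.ext ?_
    change CHom.comp (CHom.juxt _ _) (CHom.juxt _ _) = CHom.id (a.juxt (Curve.one 0))
    rw [← CHom.juxt_comp, CHom.id_comp, CHom.birth_comp_death, CHom.juxt_id]

/-- A diagram of vertical strands and circles has a shift of the identity diagram as a direct
summand. -/
theorem exists_retract_one (N : ℕ) : ∀ (a : Curve n n) (_ : Nat.card a.K = N) (s : ℤ)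
    (_ : ∀ t, a.bd (Sum.inl t) = a.bd (Sum.inr t)),
    ∃ d, Nonempty (Retract (⟨Curve.one n, d⟩ : GCob n n) ⟨a, s⟩) := by
  induction N using Nat.strong_induction_on with
  | _ N ih =>
  intro a ha s h
  by_cases hk : ∃ k, ∀ p, a.bd p ≠ k
  · obtain ⟨k, hk⟩ := hk
    obtain ⟨e, he⟩ := a.exists_equiv_erase k hk
    have hcard : Nat.card (a.erase k hk).K < N := by
      rw [← ha]
      exact Finite.card_subtype_lt (x := k) (by simp)
    obtain ⟨d, ⟨r⟩⟩ := ih _ hcard (a.erase k hk) rfl (s - 1) (fun t => Subtype.ext (h t))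
    exact ⟨d, ⟨(r.trans (retractAddCircle _ _)).trans
      (Retract.ofIso (isoOfEquiv e he (sub_add_cancel s 1)))⟩⟩
  · push Not at hk
    refine ⟨s, ⟨Retract.ofIso (isoOfEquiv (Equiv.ofBijective (fun t : Fin n => a.bd (Sum.inl t))
      ⟨fun t t' htt => ?_, fun k => ?_⟩) ?_ rfl)⟩⟩
    · rcases a.eq_or_eq_or_eq htt (h t) with h | h | h
      · exact Sum.inl_injective h
      · cases h
      · cases h
    · obtain ⟨p | p, rfl⟩ := hk k
      · exact ⟨p, rfl⟩
      · exact ⟨p, h p⟩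
    · rintro (p | p)
      · rfl
      · exact h p

end GCob

/-! ### Widening, caps and cups -/

namespace Curve

variable {m n : ℕ}

theorem forall_fin_add {x y z : ℕ} {p : Fin (x + y + z) → Prop}
    (h1 : ∀ s : Fin x, p (Fin.castAdd z (Fin.castAdd y s)))
    (h2 : ∀ s : Fin y, p (Fin.castAdd z (Fin.natAdd x s)))
    (h3 : ∀ s : Fin z, p (Fin.natAdd (x + y) s)) (t) : p t :=
  Fin.addCases (Fin.addCases h1 h2) h3 t

section widen

variable (x z : ℕ) (a : Curve m n)

theorem widen_bd_inl_left (s : Fin x) :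
    (a.widen x z).bd (Sum.inl (Fin.castAdd z (Fin.castAdd m s))) = Sum.inl (Sum.inl s) := by
  simp only [widen, juxt, Sum.elim_inl, Fin.addCases_left, id]

theorem widen_bd_inl_mid (s : Fin m) :
    (a.widen x z).bd (Sum.inl (Fin.castAdd z (Fin.natAdd x s))) =
      Sum.inl (Sum.inr (a.bd (Sum.inl s))) := by
  simp only [widen, juxt, Sum.elim_inl, Fin.addCases_left, Fin.addCases_right]

theorem widen_bd_inl_right (s : Fin z) :
    (a.widen x z).bd (Sum.inl (Fin.natAdd (x + m) s)) = Sum.inr s := by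
  simp only [widen, juxt, Sum.elim_inl, Fin.addCases_right, id]

theorem widen_bd_inr_left (s : Fin x) :
    (a.widen x z).bd (Sum.inr (Fin.castAdd z (Fin.castAdd n s))) = Sum.inl (Sum.inl s) := by
  simp only [widen, juxt, Sum.elim_inr, Fin.addCases_left, id]

theorem widen_bd_inr_mid (s : Fin n) :
    (a.widen x z).bd (Sum.inr (Fin.castAdd z (Fin.natAdd x s))) =
      Sum.inl (Sum.inr (a.bd (Sum.inr s))) := by
  simp only [widen, juxt, Sum.elim_inr, Fin.addCases_left, Fin.addCases_right]

theorem widen_bd_inr_right (s : Fin z) :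
    (a.widen x z).bd (Sum.inr (Fin.natAdd (x + n) s)) = Sum.inr s := by
  simp only [widen, juxt, Sum.elim_inr, Fin.addCases_right, id]

theorem JoinsBelow.widen {a : Curve m n} (h : a.JoinsBelow) : (a.widen x z).JoinsBelow := by
  obtain ⟨i, hi, h⟩ := h
  exact ⟨x + i, by omega, (a.widen_bd_inr_mid x z ⟨i, by omega⟩).trans
    ((congrArg (fun k => Sum.inl (Sum.inr k)) h).trans
      (a.widen_bd_inr_mid x z ⟨i + 1, by omega⟩).symm)⟩

theorem JoinsAbove.widen {a : Curve m n} (h : a.JoinsAbove) : (a.widen x z).JoinsAbove := by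
  obtain ⟨i, hi, h⟩ := h
  exact ⟨x + i, by omega, (a.widen_bd_inl_mid x z ⟨i, by omega⟩).trans
    ((congrArg (fun k => Sum.inl (Sum.inr k)) h).trans
      (a.widen_bd_inl_mid x z ⟨i + 1, by omega⟩).symm)⟩

/-- A widened identity diagram is an identity diagram. -/
theorem exists_equiv_widen_one (y : ℕ) : ∃ e : ((one y).widen x z).K ≃ (one (x + y + z)).K,
    ∀ p, e (((one y).widen x z).bd p) = (one (x + y + z)).bd p := by
  refine ⟨(Equiv.sumCongr finSumFinEquiv (Equiv.refl _)).trans finSumFinEquiv, ?_⟩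
  rintro (p | p) <;> revert p <;> refine forall_fin_add (fun s => ?_) (fun s => ?_) (fun s => ?_)
  · rw [widen_bd_inl_left]; rfl
  · rw [widen_bd_inl_mid]; rfl
  · rw [widen_bd_inl_right]; rfl
  · rw [widen_bd_inr_left]; rfl
  · rw [widen_bd_inr_mid]; rfl
  · rw [widen_bd_inr_right]; rfl

end widen

/-- The cap `i` strands from the left. -/
abbrev capAt (i j : ℕ) (h : i + 2 + j = n) : Curve (i + 0 + j) n := (cap.widen i j).cast rfl h

/-- The cup `i` strands from the left. -/
abbrev cupAt (i j : ℕ) (h : i + 2 + j = n) : Curve n (i + 0 + j) := (cup.widen i j).cast h rfl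

/-- The reflection of a cup is a cap. -/
theorem exists_equiv_dual_cupAt (i j : ℕ) (h : i + 2 + j = n) :
    ∃ e : (cupAt i j h).dual.K ≃ (capAt i j h).K, ∀ p, e ((cupAt i j h).dual.bd p) =
      (capAt i j h).bd p := by
  subst h
  refine ⟨Equiv.refl _, ?_⟩
  rintro (p | p)
  · revert p
    change ∀ p, (cup.widen i j).bd (Sum.inr p) = (cap.widen i j).bd (Sum.inl p)
    refine forall_fin_add (fun s => ?_) (fun s => s.elim0) (fun s => ?_)
    · rw [widen_bd_inr_left, widen_bd_inl_left]
    · rw [widen_bd_inr_right, widen_bd_inl_right]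
  · revert p
    change ∀ p, (cup.widen i j).bd (Sum.inl p) = (cap.widen i j).bd (Sum.inr p)
    refine forall_fin_add (fun s => ?_) (fun s => ?_) (fun s => ?_)
    · rw [widen_bd_inr_left, widen_bd_inl_left]
    · rw [widen_bd_inr_mid, widen_bd_inl_mid]
    · rw [widen_bd_inr_right, widen_bd_inl_right]

open Classical in
/-- If two adjacent points on the bottom of `c` are joined by an arc, then stacking a cup and a cap
at these points below `c` adds a circle. -/
theorem exists_equiv_stack_cup_cap (c : Curve m n) (i j : ℕ) (h : i + 2 + j = n)
    (hc : c.bd (Sum.inr ⟨i, by omega⟩) = c.bd (Sum.inr ⟨i + 1, by omega⟩)) :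
    ∃ e : ((c.stack (cupAt i j h)).stack (capAt i j h)).K ≃ c.addCircle.K,
      ∀ p, e (((c.stack (cupAt i j h)).stack (capAt i j h)).bd p) = c.addCircle.bd p := by
  subst h
  let k₀ := c.bd (Sum.inr ⟨i, by omega⟩)
  have hmid : ∀ s : Fin 2, c.bd (Sum.inr (Fin.castAdd j (Fin.natAdd i s))) = k₀ := by
    intro s
    fin_cases s
    exacts [rfl, hc.symm]
  have hne : ∀ p, p ≠ Sum.inr ⟨i, by omega⟩ → p ≠ Sum.inr ⟨i + 1, by omega⟩ → c.bd p ≠ k₀ := by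
    intro p h1 h2 h3
    rcases c.eq_or_eq_or_eq h3 (h3.trans hc) with h | h | h
    · exact h1 h
    · exact h2 h
    · simp at h
  have hl : ∀ s : Fin i, c.bd (Sum.inr (Fin.castAdd j (Fin.castAdd 2 s))) ≠ k₀ := fun s =>
    hne _ (fun h => by simp [Fin.ext_iff] at h; omega) (fun h => by simp [Fin.ext_iff] at h; omega)
  have hr : ∀ s : Fin j, c.bd (Sum.inr (Fin.natAdd (i + 2) s)) ≠ k₀ := fun s =>
    hne _ (fun h => by simp [Fin.ext_iff] at h; omega) (fun h => by simp [Fin.ext_iff] at h; omega)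
  -- the images of the components of `c`, of the cup and of the cap in `c ⊔ circle`
  let θ : c.K → c.K ⊕ Unit := fun k => if k = k₀ then Sum.inr () else Sum.inl k
  have θ₀ : θ k₀ = Sum.inr () := if_pos rfl
  have θ₁ : ∀ {k}, k ≠ k₀ → θ k = Sum.inl k := fun h => if_neg h
  let φ : (Fin i ⊕ Unit) ⊕ Fin j → c.K ⊕ Unit := Sum.elim (Sum.elim
    (fun s => Sum.inl (c.bd (Sum.inr (Fin.castAdd j (Fin.castAdd 2 s))))) (fun _ => Sum.inr ()))
    (fun s => Sum.inl (c.bd (Sum.inr (Fin.natAdd (i + 2) s))))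
  let ψ : (Fin i ⊕ Unit) ⊕ Fin j → c.K ⊕ Unit := Sum.elim (Sum.elim
    (fun s => Sum.inl (c.bd (Sum.inr (Fin.castAdd j (Fin.castAdd 2 s))))) (fun _ => Sum.inl k₀))
    (fun s => Sum.inl (c.bd (Sum.inr (Fin.natAdd (i + 2) s))))
  have h1 : ∀ t : Fin (i + 2 + j), θ (c.bd (Sum.inr t)) = φ ((cup.widen i j).bd (Sum.inl t)) := by
    refine forall_fin_add (fun s => ?_) (fun s => ?_) (fun s => ?_)
    · rw [widen_bd_inl_left]; exact θ₁ (hl s)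
    · rw [widen_bd_inl_mid, hmid]; exact θ₀
    · rw [widen_bd_inl_right]; exact θ₁ (hr s)
  have h2 : ∀ t : Fin (i + 0 + j), φ ((cup.widen i j).bd (Sum.inr t)) =
      ψ ((cap.widen i j).bd (Sum.inl t)) := by
    refine forall_fin_add (fun s => ?_) (fun s => s.elim0) (fun s => ?_)
    · rw [widen_bd_inl_left, widen_bd_inr_left]; rfl
    · rw [widen_bd_inl_right, widen_bd_inr_right]; rfl
  have h3 : ∀ t : Fin (i + 2 + j), ψ ((cap.widen i j).bd (Sum.inr t)) =
      Sum.inl (c.bd (Sum.inr t)) := by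
    refine forall_fin_add (fun s => ?_) (fun s => ?_) (fun s => ?_)
    · rw [widen_bd_inr_left]; rfl
    · rw [widen_bd_inr_mid, hmid]; rfl
    · rw [widen_bd_inr_right]; rfl
  let D := ((c.stack (cupAt i j rfl)).stack (capAt i j rfl)).K
  let α : c.K → D := fun k => Glue.inl (Glue.inl k)
  let β : (Fin i ⊕ Unit) ⊕ Fin j → D := fun k => Glue.inl (Glue.inr k)
  let γ : (Fin i ⊕ Unit) ⊕ Fin j → D := fun k => Glue.inr k
  have g1 : ∀ t : Fin (i + 2 + j), α (c.bd (Sum.inr t)) = β ((cup.widen i j).bd (Sum.inl t)) :=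
    fun t => congrArg Glue.inl (Glue.cond t)
  have g2 : ∀ t : Fin (i + 0 + j), β ((cup.widen i j).bd (Sum.inr t)) =
      γ ((cap.widen i j).bd (Sum.inl t)) := fun t => Glue.cond t
  let u : D → c.K ⊕ Unit := Glue.lift (Glue.lift θ φ h1) ψ h2
  let v : c.K ⊕ Unit → D := Sum.elim
    (fun k => if k = k₀ then γ (Sum.inl (Sum.inr ())) else α k) (fun _ => α k₀)
  have v₀ : v (Sum.inl k₀) = γ (Sum.inl (Sum.inr ())) := if_pos rfl
  have v₁ : ∀ {k}, k ≠ k₀ → v (Sum.inl k) = α k := fun h => if_neg h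
  have e1 : ∀ k, v (θ k) = α k := by
    intro k
    by_cases hk : k = k₀
    · subst hk; rw [θ₀]; rfl
    · rw [θ₁ hk, v₁ hk]
  have e2 : ∀ k, v (φ k) = β k := by
    rintro ((s | s) | s)
    · refine (v₁ (hl s)).trans ((g1 _).trans ?_)
      rw [widen_bd_inl_left]
    · refine (congrArg α (hmid 0).symm).trans ((g1 _).trans ?_)
      rw [widen_bd_inl_mid]
    · refine (v₁ (hr s)).trans ((g1 _).trans ?_)
      rw [widen_bd_inl_right]
  have e3 : ∀ k, v (ψ k) = γ k := by
    rintro ((s | s) | s)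
    · have := g2 (Fin.castAdd j (Fin.castAdd 0 s))
      rw [widen_bd_inl_left, widen_bd_inr_left, ← e2] at this
      exact this
    · exact v₀
    · have := g2 (Fin.natAdd (i + 0) s)
      rw [widen_bd_inl_right, widen_bd_inr_right, ← e2] at this
      exact this
  refine ⟨⟨u, v, Glue.ind (Glue.ind e1 e2) e3, ?_⟩, ?_⟩
  · rintro (k | k)
    · by_cases hk : k = k₀
      · subst hk; rw [v₀]; rfl
      · rw [v₁ hk]; exact θ₁ hk
    · exact θ₀
  · intro p
    rw [addCircle_bd]
    rcases p with p | p
    · exact θ₁ (hne _ (by simp) (by simp))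
    · exact h3 p

end Curve

namespace GCob

variable {m n : ℕ}

/-- A diagram with two adjacent points on the bottom joined by an arc is a shifted direct summand of
a diagram that ends with a cap. -/
theorem exists_retract_stack_capAt {c : Curve m n} (h : c.JoinsBelow) (s : ℤ) :
    ∃ (i j : ℕ) (h : i + 2 + j = n) (b : Curve m (i + 0 + j)) (d : ℤ),
      Nonempty (Retract (⟨c, s⟩ : GCob m n) ⟨b.stack (Curve.capAt i j h), d + 0⟩) := by
  obtain ⟨i, hi, hc⟩ := h
  have hj : i + 2 + (n - i - 2) = n := by omega
  obtain ⟨e, he⟩ := c.exists_equiv_stack_cup_cap i (n - i - 2) hj hc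
  exact ⟨i, _, hj, _, s + 1, ⟨(retractAddCircle c s).trans
    (Retract.ofIso (isoOfEquiv e he (add_zero _)).symm)⟩⟩

theorem exists_equiv_stack {k : ℕ} {a a' : Curve m k} {b b' : Curve k n} (e : a.K ≃ a'.K)
    (he : ∀ p, e (a.bd p) = a'.bd p) (f : b.K ≃ b'.K) (hf : ∀ p, f (b.bd p) = b'.bd p) :
    ∃ g : (a.stack b).K ≃ (a'.stack b').K, ∀ p, g ((a.stack b).bd p) = (a'.stack b').bd p := by
  have he' : ∀ p, e.symm (a'.bd p) = a.bd p := fun p => by rw [← he, e.symm_apply_apply]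
  have hf' : ∀ p, f.symm (b'.bd p) = b.bd p := fun p => by rw [← hf, f.symm_apply_apply]
  refine ⟨⟨Glue.lift (fun x => Glue.inl (e x)) (fun x => Glue.inr (f x)) (fun t => ?_),
    Glue.lift (fun x => Glue.inl (e.symm x)) (fun x => Glue.inr (f.symm x)) (fun t => ?_),
    Glue.ind (fun x => congrArg Glue.inl (e.symm_apply_apply x))
      (fun x => congrArg Glue.inr (f.symm_apply_apply x)),
    Glue.ind (fun x => congrArg Glue.inl (e.apply_symm_apply x))
      (fun x => congrArg Glue.inr (f.apply_symm_apply x))⟩, ?_⟩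
  · rw [he, hf]; exact Glue.cond t
  · rw [he', hf']; exact Glue.cond t
  · rintro (p | p)
    · exact congrArg Glue.inl (he _)
    · exact congrArg Glue.inr (hf _)

/-- A diagram with two adjacent points on the top joined by an arc is a shifted direct summand of
a diagram that starts with a cup. -/
theorem exists_retract_stack_cupAt {c : Curve m n} (h : c.JoinsAbove) (s : ℤ) :
    ∃ (i j : ℕ) (h : i + 2 + j = m) (b : Curve (i + 0 + j) n) (d : ℤ),
      Nonempty (Retract (⟨c, s⟩ : GCob m n) ⟨(Curve.cupAt i j h).stack b, 0 + d⟩) := by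
  obtain ⟨i, j, h, b, d, ⟨r⟩⟩ := exists_retract_stack_capAt (c := c.dual) h (-s)
  -- reflect the retract; the reflection is contravariant, so the two maps change places
  let r' : Retract (⟨c, s⟩ : GCob m n) ⟨(b.stack (Curve.capAt i j h)).dual, -(d + 0)⟩ :=
    (Retract.ofIso (isoOfEquiv (X := ⟨c, s⟩) (Y := ⟨c.dual.dual, - -s⟩) (Equiv.refl _)
      (by rintro (p | p) <;> rfl) (neg_neg s).symm)).trans (r.op.map (dual n m))
  obtain ⟨e, he⟩ := Curve.exists_equiv_dual_cupAt i j h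
  have he' : ∀ p, e.symm ((Curve.capAt i j h).dual.bd p) = (Curve.cupAt i j h).bd p := by
    intro p
    rw [Equiv.symm_apply_eq]
    have := (he p.swap).symm
    rcases p with p | p <;> exact this
  obtain ⟨g, hg⟩ := exists_equiv_stack (a := (Curve.capAt i j h).dual) (a' := Curve.cupAt i j h)
    (b := b.dual) e.symm he' (Equiv.refl _) (fun _ => rfl)
  refine ⟨i, j, h, b.dual, -d, ⟨r'.trans (Retract.ofIso ?_)⟩⟩
  refine isoOfEquiv (X := ⟨(b.stack (Curve.capAt i j h)).dual, -(d + 0)⟩)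
    (Y := ⟨(Curve.cupAt i j h).stack b.dual, 0 + -d⟩)
    ((Curve.dualStackK b (Curve.capAt i j h)).trans g) (fun p => ?_) (by simp)
  exact (congrArg g (Curve.dualStackK_bd _ _ p)).trans (hg p)

end GCob

/-! ### Matrix categories and contractible complexes -/

section MatIso

variable {A B E : Type 1} [Category.{1} A] [Category.{1} B] [Category.{1} E] [Preadditive A]
  [Preadditive B] [Preadditive E]

open Classical in
/-- The matrix with entries `f i` at the positions `(i, e i)` and zeros elsewhere. -/
noncomputable def matHom {M N : Mat_ A} (e : M.ι → N.ι) (f : ∀ i, M.X i ⟶ N.X (e i)) : M ⟶ N :=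
  fun i j => if h : e i = j then f i ≫ eqToHom (congrArg N.X h) else 0

theorem matHom_apply {M N : Mat_ A} (e : M.ι → N.ι) (f : ∀ i, M.X i ⟶ N.X (e i)) (i) :
    matHom e f i (e i) = f i := (dif_pos rfl).trans (by simp)

theorem matHom_apply_ne {M N : Mat_ A} (e : M.ι → N.ι) (f : ∀ i, M.X i ⟶ N.X (e i)) {i j}
    (h : e i ≠ j) : matHom e f i j = 0 := dif_neg h

theorem matHom_comp {M N P : Mat_ A} (e : M.ι → N.ι) (f : ∀ i, M.X i ⟶ N.X (e i))
    (g : N ⟶ P) (i k) : (matHom e f ≫ g) i k = f i ≫ g (e i) k := by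
  rw [Mat_.comp_apply, Finset.sum_eq_single (e i), matHom_apply]
  · intro j _ hj
    rw [matHom_apply_ne _ _ hj.symm, Limits.zero_comp]
  · simp

theorem comp_matHom {M N P : Mat_ A} {e : M.ι → N.ι} (he : e.Injective)
    (f : ∀ i, M.X i ⟶ N.X (e i)) (g : P ⟶ M) (k i) :
    (g ≫ matHom e f) k (e i) = g k i ≫ f i := by
  rw [Mat_.comp_apply, Finset.sum_eq_single i, matHom_apply]
  · intro j _ hj
    rw [matHom_apply_ne _ _ (fun h => hj (he h)), Limits.comp_zero]
  · simp

theorem isIso_matHom {M N : Mat_ A} (e : M.ι ≃ N.ι) (f : ∀ i, M.X i ≅ N.X (e i)) :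
    IsIso (matHom e (fun i => (f i).hom)) := by
  classical
  let g : N ⟶ M := fun j i =>
    if h : j = e i then eqToHom (congrArg N.X h) ≫ (f i).inv else 0
  have hg : ∀ i, g (e i) i = (f i).inv := fun i => (dif_pos rfl).trans (by simp)
  have hg' : ∀ {i j}, j ≠ e i → g j i = 0 := fun h => dif_neg h
  refine ⟨g, ?_, ?_⟩
  · ext i k
    rw [matHom_comp]
    by_cases h : i = k
    · subst h
      rw [hg, Iso.hom_inv_id, Mat_.id_apply_self]
    · rw [hg' (fun h' => h (e.injective h')), Limits.comp_zero, Mat_.id_apply_of_ne _ _ _ h]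
  · ext j k
    obtain ⟨i, rfl⟩ := e.surjective k
    rw [comp_matHom e.injective]
    by_cases h : j = e i
    · subst h
      rw [hg, Iso.inv_hom_id, Mat_.id_apply_self]
    · rw [hg' h, Limits.zero_comp, Mat_.id_apply_of_ne _ _ _ h]

/-- An isomorphism of formal direct sums that is given by a bijection of the summands and
isomorphisms of corresponding summands. -/
noncomputable def matIsoOfEquiv {M N : Mat_ A} (e : M.ι ≃ N.ι) (f : ∀ i, M.X i ≅ N.X (e i)) :
    M ≅ N :=
  have := isIso_matHom e f
  asIso (matHom e (fun i => (f i).hom))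

/-- Naturality of `matIsoOfEquiv` can be checked on matrix entries. -/
theorem matIsoOfEquiv_naturality {M N M' N' : Mat_ A} (e : M.ι ≃ N.ι)
    (f : ∀ i, M.X i ≅ N.X (e i)) (e' : M'.ι ≃ N'.ι) (f' : ∀ i, M'.X i ≅ N'.X (e' i)) (g : M ⟶ M')
    (h : N ⟶ N') (H : ∀ i j, g i j ≫ (f' j).hom = (f i).hom ≫ h (e i) (e' j)) :
    g ≫ (matIsoOfEquiv e' f').hom = (matIsoOfEquiv e f).hom ≫ h := by
  ext i k
  obtain ⟨j, rfl⟩ := e'.surjective k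
  exact (comp_matHom e'.injective _ g i j).trans ((H i j).trans
    (matHom_comp e (fun i => (f i).hom) h i (e' j)).symm)

/-- A natural isomorphism extends to formal direct sums. -/
noncomputable def mapMatIso {G H : A ⥤ B} [G.Additive] [H.Additive] (α : G ≅ H) :
    G.mapMat_ ≅ H.mapMat_ :=
  NatIso.ofComponents
    (fun M => matIsoOfEquiv (M := G.mapMat_.obj M) (N := H.mapMat_.obj M) (Equiv.refl _)
      (fun i => α.app (M.X i)))
    (fun f => matIsoOfEquiv_naturality _ _ _ _ _ _ fun i j => α.hom.naturality (f i j))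

variable (F : A ⥤ B ⥤ E) [F.Additive] [∀ X, (F.obj X).Additive]

instance flip_additive (F : A ⥤ B ⥤ E) [∀ X, (F.obj X).Additive] : F.flip.Additive where
  map_add {X Y f g} := by
    ext Z
    exact (F.obj Z).map_add

instance flip_obj_additive (Y : B) : (F.flip.obj Y).Additive where
  map_add {X X'} f g := by
    change (F.map (f + g)).app Y = _
    rw [Functor.map_add]
    rfl

/-- The extension of a bilinear functor to formal direct sums, with a single object as the first
argument. -/
noncomputable def matBiEmbedding (X : A) :
    (matBi F).obj ((Mat_.embedding A).obj X) ≅ (F.obj X).mapMat_ :=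
  NatIso.ofComponents
    (fun M => matIsoOfEquiv (M := ((matBi F).obj ((Mat_.embedding A).obj X)).obj M)
      (N := (F.obj X).mapMat_.obj M) (Equiv.punitProd M.ι) (fun _ => Iso.refl _))
    (fun f => matIsoOfEquiv_naturality _ _ _ _ _ _ fun ⟨u, i⟩ ⟨_, j⟩ => by
      refine (Category.comp_id _).trans (Eq.trans ?_ (Category.id_comp _).symm)
      change biMap F ((𝟙 ((Mat_.embedding A).obj X) :) u u) (f i j) = (F.obj X).map (f i j)
      rw [Mat_.id_apply_self, biMap]
      change (F.map (𝟙 X)).app _ ≫ _ = _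
      rw [F.map_id, NatTrans.id_app]
      exact Category.id_comp _)

/-- The extension of a bilinear functor to formal direct sums, with a single object as the second
argument. -/
noncomputable def matBiFlipEmbedding (Y : B) :
    (matBi F).flip.obj ((Mat_.embedding B).obj Y) ≅ (F.flip.obj Y).mapMat_ :=
  NatIso.ofComponents
    (fun M => matIsoOfEquiv (M := ((matBi F).flip.obj ((Mat_.embedding B).obj Y)).obj M)
      (N := (F.flip.obj Y).mapMat_.obj M) (Equiv.prodPUnit M.ι) (fun _ => Iso.refl _))
    (fun f => matIsoOfEquiv_naturality _ _ _ _ _ _ fun ⟨i, u⟩ ⟨j, _⟩ => by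
      refine (Category.comp_id _).trans (Eq.trans ?_ (Category.id_comp _).symm)
      change biMap F (f i j) ((𝟙 ((Mat_.embedding B).obj Y) :) u u) = (F.map (f i j)).app Y
      rw [Mat_.id_apply_self, biMap]
      change _ ≫ (F.obj _).map (𝟙 Y) = _
      rw [CategoryTheory.Functor.map_id]
      exact Category.comp_id _)

end MatIso

section Contractible

variable {A B E : Type 1} [Category.{1} A] [Category.{1} B] [Category.{1} E] [Preadditive A]
  [Preadditive B] [Preadditive E]

theorem Contractible.map {K : CochainComplex A ℤ} (h : Contractible K) (G : A ⥤ B) [G.Additive] :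
    Contractible ((G.mapHomologicalComplex _).obj K) := by
  obtain ⟨h⟩ := h
  exact ⟨(Homotopy.ofEq (CategoryTheory.Functor.map_id _ _).symm).trans ((G.mapHomotopy h).trans
    (Homotopy.ofEq (Functor.map_zero _ _ _)))⟩

/-- If the identity of `K` is a sum of maps that factor through contractible complexes, then `K` is
contractible. -/
theorem Contractible.of_sum {I : Type} [Fintype I] {K : CochainComplex A ℤ}
    {L : I → CochainComplex A ℤ} (hL : ∀ i, Contractible (L i)) (f : ∀ i, K ⟶ L i)
    (g : ∀ i, L i ⟶ K) (h : ∑ i, f i ≫ g i = 𝟙 K) : Contractible K := by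
  classical
  have key : ∀ s : Finset I, Nonempty (Homotopy (∑ i ∈ s, f i ≫ g i) 0) := by
    intro s
    induction s using Finset.induction_on with
    | empty => exact ⟨Homotopy.ofEq Finset.sum_empty⟩
    | insert i s hi ih =>
      obtain ⟨ih⟩ := ih
      obtain ⟨hi'⟩ := hL i
      have h1 : Homotopy (f i ≫ g i) 0 :=
        (Homotopy.ofEq (by rw [Category.id_comp])).trans
          (((hi'.compRight (g i)).compLeft (f i)).trans (Homotopy.ofEq (by simp)))
      exact ⟨(Homotopy.ofEq (Finset.sum_insert hi)).trans
        ((h1.add ih).trans (Homotopy.ofEq (add_zero _)))⟩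
  obtain ⟨k⟩ := key Finset.univ
  exact ⟨(Homotopy.ofEq h.symm).trans k⟩

theorem Contractible.of_retract {K L : CochainComplex A ℤ} (hL : Contractible L)
    (r : Retract K L) : Contractible K :=
  Contractible.of_sum (I := Unit) (L := fun _ => L) (fun _ => hL) (fun _ => r.i) (fun _ => r.r)
    (by simp)

theorem Contractible.of_iso {K L : CochainComplex A ℤ} (hL : Contractible L) (e : K ≅ L) :
    Contractible K := hL.of_retract (Retract.ofIso e)

variable (F : A ⥤ B ⥤ E) [F.Additive] [∀ X, (F.obj X).Additive]

/-- If the identity of `M` factors through the objects `N i`, then `F(M, L)` is contractible when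
all the complexes `F(N i, L)` are. -/
theorem contractible_of_sum {I : Type} [Fintype I] {M : A} {N : I → A} (f : ∀ i, M ⟶ N i)
    (g : ∀ i, N i ⟶ M) (h : ∑ i, f i ≫ g i = 𝟙 M) (L : CochainComplex B ℤ)
    (hL : ∀ i, Contractible (((F.obj (N i)).mapHomologicalComplex _).obj L)) :
    Contractible (((F.obj M).mapHomologicalComplex _).obj L) := by
  refine Contractible.of_sum hL
    (fun i => (NatTrans.mapHomologicalComplex (F.map (f i)) _).app L)
    (fun i => (NatTrans.mapHomologicalComplex (F.map (g i)) _).app L) ?_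
  ext p
  refine Eq.trans (map_sum (HomologicalComplex.Hom.fAddMonoidHom p) _ _) ?_
  change ∑ i, (F.map (f i)).app (L.X p) ≫ (F.map (g i)).app (L.X p) = 𝟙 ((F.obj M).obj (L.X p))
  have h1 : ((F.flip.obj (L.X p)).map (∑ i, f i ≫ g i)) = 𝟙 _ := by
    rw [h, CategoryTheory.Functor.map_id]
  rw [Functor.map_sum] at h1
  refine Eq.trans (Finset.sum_congr rfl fun i _ => ?_) h1
  exact ((F.flip.obj (L.X p)).map_comp _ _).symm

theorem contractible_of_retract {M N : A} (r : Retract M N) (L : CochainComplex B ℤ)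
    (hL : Contractible (((F.obj N).mapHomologicalComplex _).obj L)) :
    Contractible (((F.obj M).mapHomologicalComplex _).obj L) :=
  contractible_of_sum F (I := Unit) (N := fun _ => N) (fun _ => r.i) (fun _ => r.r) (by simp) L
    (fun _ => hL)

/-- If `F(X, L)` is contractible for all summands `X` of `M`, then so is `F(M, L)`. -/
theorem contractible_of_embedding (F : Mat_ A ⥤ B ⥤ E) [F.Additive] [∀ X, (F.obj X).Additive]
    (M : Mat_ A) (L : CochainComplex B ℤ)
    (hL : ∀ i, Contractible
      (((F.obj ((Mat_.embedding A).obj (M.X i))).mapHomologicalComplex _).obj L)) :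
    Contractible (((F.obj M).mapHomologicalComplex _).obj L) := by
  refine contractible_of_sum F (I := M.ι) (N := fun i => (Mat_.embedding A).obj (M.X i))
    (fun i => M.isoBiproductEmbedding.hom ≫
      Limits.biproduct.π (fun i => (Mat_.embedding A).obj (M.X i)) i)
    (fun i => Limits.biproduct.ι (fun i => (Mat_.embedding A).obj (M.X i)) i ≫
      M.isoBiproductEmbedding.inv) ?_ L hL
  have := Limits.biproduct.total (f := fun i => (Mat_.embedding A).obj (M.X i))
  rw [← M.isoBiproductEmbedding.hom_inv_id]
  conv_rhs => rw [← Category.id_comp M.isoBiproductEmbedding.inv, ← this]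
  simp only [Preadditive.sum_comp, Preadditive.comp_sum, Category.assoc]

theorem Contractible.of_natIso {G H : A ⥤ B} [G.Additive] [H.Additive] (α : G ≅ H)
    {K : CochainComplex A ℤ} (h : Contractible ((H.mapHomologicalComplex _).obj K)) :
    Contractible ((G.mapHomologicalComplex _).obj K) :=
  h.of_iso ((NatIso.mapHomologicalComplex α _).app K)

end Contractible

namespace BN

variable {m n k l : ℕ}

/-- Associativity of stacking, natural in the sum of diagrams on the bottom. -/
noncomputable def stackAssocBelow (X : GCob m k) (Y : GCob k l) :
    (stack m l n).obj (of (X.curve.stack Y.curve) (X.shift + Y.shift)) ≅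
      (stack k l n).obj (of Y.curve Y.shift) ⋙ (stack m k n).obj (of X.curve X.shift) :=
  matBiEmbedding _ _ ≪≫ mapMatIso (GCob.stackAssocBelow X Y) ≪≫ Functor.mapMatComp _ _ ≪≫
    Functor.isoWhiskerRight (matBiEmbedding (GCob.stack k l n) Y).symm _ ≪≫
    Functor.isoWhiskerLeft _ (matBiEmbedding (GCob.stack m k n) X).symm

/-- Associativity of stacking, natural in the sum of diagrams on the top. -/
noncomputable def stackAssocAbove (Y : GCob k l) (Z : GCob l n) :
    (stack m k n).flip.obj (of (Y.curve.stack Z.curve) (Y.shift + Z.shift)) ≅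
      (stack m k l).flip.obj (of Y.curve Y.shift) ⋙ (stack m l n).flip.obj (of Z.curve Z.shift) :=
  matBiFlipEmbedding _ _ ≪≫ mapMatIso (GCob.stackAssocAbove Y Z) ≪≫ Functor.mapMatComp _ _ ≪≫
    Functor.isoWhiskerRight (matBiFlipEmbedding (GCob.stack m k l) Y).symm _ ≪≫
    Functor.isoWhiskerLeft _ (matBiFlipEmbedding (GCob.stack m l n) Z).symm

/-- Stacking the identity diagram on top does nothing. -/
noncomputable def oneStack : (stack m m n).obj (of (Curve.one m) 0) ≅ 𝟭 (BN m n) :=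
  matBiEmbedding _ _ ≪≫ mapMatIso GCob.oneStack ≪≫ Functor.mapMatId

/-- Stacking the identity diagram on the bottom does nothing. -/
noncomputable def stackOne : (stack m n n).flip.obj (of (Curve.one n) 0) ≅ 𝟭 (BN m n) :=
  matBiFlipEmbedding _ _ ≪≫ mapMatIso GCob.stackOne ≪≫ Functor.mapMatId

/-- A complex that is killed by turnbacks on top is killed by all diagrams with an arc that joins
adjacent points on the bottom. -/
theorem contractible_stack {M : BN m n} (hM : ∀ i, (M.X i).curve.JoinsBelow)
    {L : CochainComplex (BN n l) ℤ} (hL : KillsAbove L) :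
    Contractible ((((stack m n l).obj M).mapHomologicalComplex _).obj L) := by
  refine contractible_of_embedding _ M L fun i => ?_
  obtain ⟨p, q, h, b, d, ⟨r⟩⟩ := GCob.exists_retract_stack_capAt (hM i) (M.X i).shift
  refine contractible_of_retract (stack m n l) (r.map (Mat_.embedding _)) L ?_
  refine Contractible.of_natIso
    (stackAssocBelow ⟨b, d⟩ ⟨Curve.capAt p q h, 0⟩) ?_
  exact (hL p q h).map ((stack _ _ _).obj (of b d))

/-- A complex that is killed by turnbacks on the bottom is killed by all diagrams with an arc that
joins adjacent points on the top. -/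
theorem contractible_stack_flip {M : BN n l} (hM : ∀ i, (M.X i).curve.JoinsAbove)
    {L : CochainComplex (BN m n) ℤ} (hL : KillsBelow L) :
    Contractible ((((stack m n l).flip.obj M).mapHomologicalComplex _).obj L) := by
  refine contractible_of_embedding (stack m n l).flip M L fun i => ?_
  obtain ⟨p, q, h, b, d, ⟨r⟩⟩ := GCob.exists_retract_stack_cupAt (hM i) (M.X i).shift
  refine contractible_of_retract (stack m n l).flip (r.map (Mat_.embedding _)) L ?_
  refine Contractible.of_natIso
    (stackAssocAbove ⟨Curve.cupAt p q h, 0⟩ ⟨b, d⟩) ?_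
  exact (hL p q h).map ((stack _ _ _).flip.obj (of b d))

end BN

/-! ### Duals -/

variable {m n k l : ℕ}

namespace BN



/-- The dual of a sum of diagrams. -/
noncomputable abbrev dualObj (X : BN m n) : BN n m :=
  ⟨X.ι, fun i => (GCob.dual m n).obj (.op (X.X i))⟩

theorem dualMap_id (X : BN m n) : dualMap (𝟙 X) = 𝟙 (dualObj X) := by
  ext i j
  by_cases h : i = j
  · subst h
    rw [Mat_.id_apply_self]
    refine Eq.trans ?_ ((GCob.dual m n).map_id (.op (X.X i)))
    exact congrArg (fun f => (GCob.dual m n).map f.op) (Mat_.id_apply_self X i)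
  · rw [Mat_.id_apply_of_ne _ _ _ h]
    refine (congrArg (fun f => (GCob.dual m n).map f.op)
      (Mat_.id_apply_of_ne X j i (Ne.symm h))).trans ?_
    exact Subtype.ext (map_zero CHom.dual)

theorem dualMap_add {X Y : BN m n} (f g : X ⟶ Y) : dualMap (f + g) = dualMap f + dualMap g := by
  ext i j
  exact Subtype.ext (map_add CHom.dual (f j i).1 (g j i).1)

theorem contractible_dual {K : CochainComplex (BN m n) ℤ} (h : Contractible K) :
    Contractible (dual K) := by
  obtain ⟨h⟩ := h
  refine ⟨⟨fun i j => -dualMap (h.hom (-j) (-i)), fun i j hij => ?_, fun i => ?_⟩⟩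
  · refine (congrArg (fun u => -dualMap u) (h.zero (-j) (-i) fun h' => ?_)).trans ?_
    · have h1 : j + 1 ≠ i := hij
      have h2 : -i + 1 = -j := h'
      omega
    · exact (congrArg Neg.neg dualMap_zero).trans neg_zero
  · have hc := h.comm (-i)
    have r1 : (ComplexShape.up ℤ).Rel (-i) (-(i - 1)) := by
      change -i + 1 = -(i - 1); omega
    have r2 : (ComplexShape.up ℤ).Rel (-(i + 1)) (-i) := by
      change -(i + 1) + 1 = -i; omega
    have r3 : (ComplexShape.up ℤ).Rel i (i + 1) := rfl
    have r4 : (ComplexShape.up ℤ).Rel (i - 1) i := by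
      change i - 1 + 1 = i; omega
    rw [dNext_eq _ r1, prevD_eq _ r2] at hc
    have hc' := congrArg dualMap hc
    change dualMap (𝟙 _) = dualMap (_ + _ + 0) at hc'
    rw [add_zero, dualMap_id, dualMap_add, dualMap_comp, dualMap_comp] at hc'
    refine Eq.trans ?_ (congrArg₂ (fun u v => u + v + 0) (dNext_eq _ r3).symm
      (prevD_eq _ r4).symm)
    refine hc'.trans ?_
    rw [add_zero, add_comm]
    exact congrArg₂ (· + ·) (Preadditive.neg_comp_neg _ _).symm
      (Preadditive.neg_comp_neg _ _).symm

theorem stack_map_of_apply (c : Curve k l) (s : ℤ) {X Y : BN m k} (f : X ⟶ Y) (i : X.ι) (j : Y.ι) :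
    (((stack m k l).flip.obj (of c s)).map f (i, PUnit.unit) (j, PUnit.unit)).1 =
      CHom.stack (f i j).1 (CHom.id c) := by
  change (biMap (GCob.stack m k l) (f i j) ((𝟙 (of c s) : of c s ⟶ of c s) PUnit.unit
    PUnit.unit)).1 = _
  have h1 : (𝟙 (of c s) : of c s ⟶ of c s) PUnit.unit PUnit.unit = 𝟙 _ := Mat_.id_apply_self _ _
  rw [h1]
  change CHom.comp (CHom.stack (f i j).1 (CHom.id c)) (CHom.stack (CHom.id _) (CHom.id c)) = _
  rw [CHom.stack_id, CHom.comp_id]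

theorem stack_of_map_apply (c : Curve m k) (s : ℤ) {X Y : BN k l} (f : X ⟶ Y) (i : X.ι) (j : Y.ι) :
    (((stack m k l).obj (of c s)).map f (PUnit.unit, i) (PUnit.unit, j)).1 =
      CHom.stack (CHom.id c) (f i j).1 := by
  change (biMap (GCob.stack m k l) ((𝟙 (of c s) : of c s ⟶ of c s) PUnit.unit
    PUnit.unit) (f i j)).1 = _
  have h1 : (𝟙 (of c s) : of c s ⟶ of c s) PUnit.unit PUnit.unit = 𝟙 _ := Mat_.id_apply_self _ _
  rw [h1]
  change CHom.comp (CHom.stack (CHom.id c) (CHom.id _)) (CHom.stack (CHom.id c) (f i j).1) = _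
  rw [CHom.stack_id, CHom.id_comp]

/-- Reflection reverses the order of stacking: a diagram on the bottom of a sum of diagrams. -/
noncomputable def dualStackBelow (c : Curve k l) (X : BN m k) :
    dualObj (((stack m k l).flip.obj (of c 0)).obj X) ≅
      ((stack l k m).obj (of c.dual 0)).obj (dualObj X) :=
  matIsoOfEquiv (M := dualObj (((stack m k l).flip.obj (of c 0)).obj X))
    (N := ((stack l k m).obj (of c.dual 0)).obj (dualObj X)) (Equiv.prodComm _ _)
    (fun i => GCob.isoOfEquiv
      (X := ⟨((X.X i.1).curve.stack c).dual, -((X.X i.1).shift + 0)⟩)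
      (Y := ⟨c.dual.stack (X.X i.1).curve.dual, 0 + -(X.X i.1).shift⟩) _
      (Curve.dualStackK_bd (X.X i.1).curve c) (by simp))

theorem dualStackBelow_naturality (c : Curve k l) {X Y : BN m k} (f : X ⟶ Y) :
    dualMap (((stack m k l).flip.obj (of c 0)).map f) ≫ (dualStackBelow c X).hom =
      (dualStackBelow c Y).hom ≫ ((stack l k m).obj (of c.dual 0)).map (dualMap f) := by
  refine matIsoOfEquiv_naturality _ _ _ _ _ _ ?_
  rintro ⟨i, ⟨⟩⟩ ⟨j, ⟨⟩⟩
  refine Subtype.ext ?_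
  change CHom.comp (CHom.dual (((stack m k l).flip.obj (of c 0)).map f (j, PUnit.unit)
    (i, PUnit.unit)).1) _ = CHom.comp _ (((stack l k m).obj (of c.dual 0)).map (dualMap f)
    (PUnit.unit, i) (PUnit.unit, j)).1
  rw [stack_map_of_apply, stack_of_map_apply, ← CHom.dual_id]
  exact CHom.comp_dualStackK (f j i).1 (CHom.id c)

/-- Reflection reverses the order of stacking: a diagram on the top of a sum of diagrams. -/
noncomputable def dualStackAbove (c : Curve m k) (X : BN k l) :
    dualObj (((stack m k l).obj (of c 0)).obj X) ≅
      ((stack l k m).flip.obj (of c.dual 0)).obj (dualObj X) :=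
  matIsoOfEquiv (M := dualObj (((stack m k l).obj (of c 0)).obj X))
    (N := ((stack l k m).flip.obj (of c.dual 0)).obj (dualObj X)) (Equiv.prodComm _ _)
    (fun i => GCob.isoOfEquiv
      (X := ⟨(c.stack (X.X i.2).curve).dual, -(0 + (X.X i.2).shift)⟩)
      (Y := ⟨(X.X i.2).curve.dual.stack c.dual, -(X.X i.2).shift + 0⟩) _
      (Curve.dualStackK_bd c (X.X i.2).curve) (by simp))

theorem dualStackAbove_naturality (c : Curve m k) {X Y : BN k l} (f : X ⟶ Y) :
    dualMap (((stack m k l).obj (of c 0)).map f) ≫ (dualStackAbove c X).hom =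
      (dualStackAbove c Y).hom ≫ ((stack l k m).flip.obj (of c.dual 0)).map (dualMap f) := by
  refine matIsoOfEquiv_naturality _ _ _ _ _ _ ?_
  rintro ⟨⟨⟩, i⟩ ⟨⟨⟩, j⟩
  refine Subtype.ext ?_
  change CHom.comp (CHom.dual (((stack m k l).obj (of c 0)).map f (PUnit.unit, j)
    (PUnit.unit, i)).1) _ = CHom.comp _ (((stack l k m).flip.obj (of c.dual 0)).map (dualMap f)
    (i, PUnit.unit) (j, PUnit.unit)).1
  rw [stack_map_of_apply, stack_of_map_apply, ← CHom.dual_id]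
  exact CHom.comp_dualStackK (CHom.id c) (f j i).1

/-- A diagram that kills `K` from below has a reflection that kills the dual of `K` from above. -/
theorem contractible_stack_dual {K : CochainComplex (BN m k) ℤ} {c : Curve k l}
    (h : Contractible ((((stack m k l).flip.obj (of c 0)).mapHomologicalComplex _).obj K))
    {c' : Curve l k}
    (e : c.dual.K ≃ c'.K) (he : ∀ p, e (c.dual.bd p) = c'.bd p) :
    Contractible ((((stack l k m).obj (of c' 0)).mapHomologicalComplex _).obj (dual K)) := by
  refine Contractible.of_natIso ((stack l k m).mapIso
    ((Mat_.embedding _).mapIso (GCob.isoOfEquiv (X := ⟨_, 0⟩) (Y := ⟨_, 0⟩) e he rfl).symm)) ?_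
  refine (contractible_dual h).of_iso
    (HomologicalComplex.Hom.isoOfComponents (fun p => dualStackBelow c (K.X (-p))) ?_).symm
  intro p q _
  refine Eq.trans ?_ (Preadditive.neg_comp _ _).symm
  refine Eq.trans ?_ (congrArg Neg.neg (dualStackBelow_naturality c (K.d (-q) (-p))).symm)
  refine Eq.trans (congrArg ((dualStackBelow c (K.X (-p))).hom ≫ ·) ?_)
    (Preadditive.comp_neg _ _)
  exact Functor.map_neg ((stack l k m).obj (of c.dual 0))

/-- A diagram that kills `K` from above has a reflection that kills the dual of `K` from below. -/
theorem contractible_stack_flip_dual {K : CochainComplex (BN k l) ℤ} {c : Curve m k}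
    (h : Contractible ((((stack m k l).obj (of c 0)).mapHomologicalComplex _).obj K))
    {c' : Curve k m}
    (e : c.dual.K ≃ c'.K) (he : ∀ p, e (c.dual.bd p) = c'.bd p) :
    Contractible ((((stack l k m).flip.obj (of c' 0)).mapHomologicalComplex _).obj (dual K)) := by
  refine Contractible.of_natIso ((stack l k m).flip.mapIso
    ((Mat_.embedding _).mapIso (GCob.isoOfEquiv (X := ⟨_, 0⟩) (Y := ⟨_, 0⟩) e he rfl).symm)) ?_
  refine (contractible_dual h).of_iso
    (HomologicalComplex.Hom.isoOfComponents (fun p => dualStackAbove c (K.X (-p))) ?_).symm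
  intro p q _
  refine Eq.trans ?_ (Preadditive.neg_comp _ _).symm
  refine Eq.trans ?_ (congrArg Neg.neg (dualStackAbove_naturality c (K.d (-q) (-p))).symm)
  refine Eq.trans (congrArg ((dualStackAbove c (K.X (-p))).hom ≫ ·) ?_)
    (Preadditive.comp_neg _ _)
  exact Functor.map_neg ((stack l k m).flip.obj (of c.dual 0))

end BN

theorem KillsBelow.dual {K : CochainComplex (BN n m) ℤ} (hK : KillsBelow K) :
    KillsAbove (BN.dual K) := by
  intro i j h
  obtain ⟨e, he⟩ := Curve.exists_equiv_dual_cupAt i j h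
  exact BN.contractible_stack_dual (hK i j h) e he

theorem KillsAbove.dual {K : CochainComplex (BN n m) ℤ} (hK : KillsAbove K) :
    KillsBelow (BN.dual K) := by
  intro i j h
  obtain ⟨e, he⟩ := Curve.exists_equiv_dual_cupAt i j h
  refine BN.contractible_stack_flip_dual (hK i j h) e.symm fun p => ?_
  rw [Equiv.symm_apply_eq]
  cases p with
  | inl t => exact (he (.inr t)).symm
  | inr t => exact (he (.inl t)).symm

/-! ### Perturbed contractions -/

section Perturbation

variable {V : Type 1} [Category.{1} V] [Preadditive V] {T C : CochainComplex V ℤ}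

/-- A perturbed contraction onto a subcomplex: if `ι` is a split inclusion of a subcomplex, `h`
vanishes on it, and `d h + h d + ρ ι` is invertible, then the inclusion is a homotopy equivalence.
With `N` the inverse, the homotopy inverse is `N ρ` and the homotopy is `N h`. -/
theorem nonempty_homotopyEquiv_of_inclusion (ι : C ⟶ T) (ρ : ∀ p, T.X p ⟶ C.X p)
    (h : ∀ p q, T.X p ⟶ T.X q) (h0 : ∀ p q, q + 1 ≠ p → h p q = 0)
    (hι : ∀ p, ι.f p ≫ ρ p = 𝟙 _) (hh : ∀ p q, ι.f p ≫ h p q = 0)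
    (hM : ∀ p, IsIso (T.d p (p + 1) ≫ h (p + 1) p + h p (p - 1) ≫ T.d (p - 1) p + ρ p ≫ ι.f p)) :
    Nonempty (HomotopyEquiv T C) := by
  obtain ⟨M, hMd⟩ : ∃ M : ∀ p, T.X p ⟶ T.X p, ∀ p, M p =
    T.d p (p + 1) ≫ h (p + 1) p + h p (p - 1) ≫ T.d (p - 1) p + ρ p ≫ ι.f p := ⟨_, fun _ => rfl⟩
  have hM' : ∀ p, ∃ N, M p ≫ N = 𝟙 _ ∧ N ≫ M p = 𝟙 _ := fun p => hMd p ▸ (hM p).out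
  choose N hMN hNM using hM'
  have hιM : ∀ p, ι.f p ≫ M p = ι.f p := by
    intro p
    rw [hMd, Preadditive.comp_add, Preadditive.comp_add, ← Category.assoc, ← Category.assoc,
      ← Category.assoc, hh, hι, ι.comm, Category.assoc, hh]
    simp
  have hιN : ∀ p, ι.f p ≫ N p = ι.f p := by
    intro p
    rw [← hιM p, Category.assoc, hMN, Category.comp_id, hιM]
  have hι' : ∀ p {Z : V} (f : C.X p ⟶ Z), ι.f p ≫ ρ p ≫ f = f := by
    intro p Z f
    rw [← Category.assoc, hι, Category.id_comp]
  have hιd : ∀ p q {Z : V} (f : T.X q ⟶ Z), ι.f p ≫ T.d p q ≫ f = C.d p q ≫ ι.f q ≫ f := by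
    intro p q Z f
    rw [← Category.assoc, ι.comm, Category.assoc]
  -- the failure of `M` to commute with `d`, conjugated by `N`
  have key : ∀ p q, p + 1 = q → T.d p q ≫ N q + N p ≫ T.d p q ≫ ρ q ≫ ι.f q =
      N p ≫ T.d p q + N p ≫ ρ p ≫ C.d p q ≫ ι.f q := by
    rintro p q rfl
    have h1 : M p ≫ T.d p (p + 1) + T.d p (p + 1) ≫ ρ (p + 1) ≫ ι.f (p + 1) =
        T.d p (p + 1) ≫ M (p + 1) + ρ p ≫ C.d p (p + 1) ≫ ι.f (p + 1) := by
      have e : p + 1 - 1 = p := by omega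
      rw [hMd, hMd, e]
      simp only [Preadditive.add_comp, Preadditive.comp_add, Category.assoc, T.d_comp_d,
        T.d_comp_d_assoc, Limits.comp_zero, Limits.zero_comp, ι.comm]
      abel
    have h2 := congrArg (fun u => N p ≫ u ≫ N (p + 1)) h1
    simp only [Preadditive.add_comp, Preadditive.comp_add, Category.assoc, hMN, hιN,
      Category.comp_id] at h2
    rwa [← Category.assoc (N p) (M p), hNM, Category.id_comp] at h2
  have hchain : ∀ p q, p + 1 = q → (N p ≫ ρ p) ≫ C.d p q = T.d p q ≫ N q ≫ ρ q := by
    intro p q hpq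
    have h1 := congrArg (· ≫ ρ q) (key p q hpq)
    simp only [Preadditive.add_comp, Category.assoc, hι, Category.comp_id] at h1
    rw [add_comm, add_left_cancel_iff] at h1
    rw [Category.assoc, h1]
  let r : T ⟶ C := { f := fun p => N p ≫ ρ p, comm' := fun p q hpq => hchain p q hpq }
  refine ⟨{ hom := r, inv := ι, homotopyHomInvId := ?_, homotopyInvHomId := Homotopy.ofEq ?_ }⟩
  · refine Homotopy.symm ⟨fun p q => N p ≫ h p q, fun p q hpq => ?_, fun p => ?_⟩
    · exact (congrArg (N p ≫ ·) (h0 p q hpq)).trans Limits.comp_zero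
    · have r1 : (ComplexShape.up ℤ).Rel p (p + 1) := rfl
      have r2 : (ComplexShape.up ℤ).Rel (p - 1) p := by
        change p - 1 + 1 = p; omega
      refine Eq.trans ?_ (congrArg₂ (fun u v => u + v + (r ≫ ι).f p) (dNext_eq _ r1).symm
        (prevD_eq _ r2).symm)
      change 𝟙 (T.X p) = T.d p (p + 1) ≫ N (p + 1) ≫ h (p + 1) p +
        (N p ≫ h p (p - 1)) ≫ T.d (p - 1) p + (N p ≫ ρ p) ≫ ι.f p
      have h1 := congrArg (· ≫ h (p + 1) p) (key p (p + 1) rfl)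
      simp only [Preadditive.add_comp, Category.assoc, hh, Limits.comp_zero, add_zero] at h1
      rw [h1, ← hNM p, hMd]
      simp only [Preadditive.comp_add, Category.assoc]
  · ext p
    change ι.f p ≫ N p ≫ ρ p = 𝟙 _
    rw [← Category.assoc, hιN, hι]

/-- A perturbed contraction onto a quotient complex: if `ρ` is a split projection to a quotient
complex, the image of `h` projects to zero, and `d h + h d + ρ ι` is invertible, then the projection
is a homotopy equivalence. -/
theorem nonempty_homotopyEquiv_of_projection (ι : ∀ p, C.X p ⟶ T.X p) (ρ : T ⟶ C)
    (h : ∀ p q, T.X p ⟶ T.X q) (h0 : ∀ p q, q + 1 ≠ p → h p q = 0)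
    (hι : ∀ p, ι p ≫ ρ.f p = 𝟙 _) (hh : ∀ p q, h p q ≫ ρ.f q = 0)
    (hM : ∀ p, IsIso (T.d p (p + 1) ≫ h (p + 1) p + h p (p - 1) ≫ T.d (p - 1) p + ρ.f p ≫ ι p)) :
    Nonempty (HomotopyEquiv T C) := by
  obtain ⟨M, hMd⟩ : ∃ M : ∀ p, T.X p ⟶ T.X p, ∀ p, M p =
    T.d p (p + 1) ≫ h (p + 1) p + h p (p - 1) ≫ T.d (p - 1) p + ρ.f p ≫ ι p := ⟨_, fun _ => rfl⟩
  have hM' : ∀ p, ∃ N, M p ≫ N = 𝟙 _ ∧ N ≫ M p = 𝟙 _ := fun p => hMd p ▸ (hM p).out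
  choose N hMN hNM using hM'
  have hMρ : ∀ p, M p ≫ ρ.f p = ρ.f p := by
    intro p
    rw [hMd]
    simp only [Preadditive.add_comp, Category.assoc, hh, hι, ← ρ.comm, Limits.comp_zero,
      Category.comp_id, zero_add]
    rw [← Category.assoc (h p (p - 1)), hh, Limits.zero_comp, zero_add]
  have hNρ : ∀ p, N p ≫ ρ.f p = ρ.f p := by
    intro p
    rw [← hMρ p, ← Category.assoc, hNM, Category.id_comp, hMρ]
  -- the failure of `M` to commute with `d`, conjugated by `N`
  have key : ∀ p q, p + 1 = q → T.d p q ≫ N q + ρ.f p ≫ C.d p q ≫ ι q ≫ N q =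
      N p ≫ T.d p q + ρ.f p ≫ ι p ≫ T.d p q ≫ N q := by
    rintro p q rfl
    have h1 : M p ≫ T.d p (p + 1) + ρ.f p ≫ C.d p (p + 1) ≫ ι (p + 1) =
        T.d p (p + 1) ≫ M (p + 1) + ρ.f p ≫ ι p ≫ T.d p (p + 1) := by
      have e : p + 1 - 1 = p := by omega
      rw [hMd, hMd, e, ρ.comm_assoc]
      simp only [Preadditive.add_comp, Preadditive.comp_add, Category.assoc, T.d_comp_d,
        T.d_comp_d_assoc, Limits.comp_zero, Limits.zero_comp]
      abel
    have h2 := congrArg (fun u => N p ≫ u ≫ N (p + 1)) h1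
    simp only [Preadditive.add_comp, Preadditive.comp_add, Category.assoc, hMN,
      Category.comp_id] at h2
    rwa [← Category.assoc (N p) (M p), hNM, Category.id_comp, ← Category.assoc (N p) (ρ.f p), hNρ,
      ← Category.assoc (N p) (ρ.f p), hNρ] at h2
  have hchain : ∀ p q, p + 1 = q → (ι p ≫ N p) ≫ T.d p q = C.d p q ≫ ι q ≫ N q := by
    intro p q hpq
    have h1 := congrArg (ι p ≫ ·) (key p q hpq)
    simp only [Preadditive.comp_add] at h1
    rw [← Category.assoc (ι p) (ρ.f p), hι, Category.id_comp, ← Category.assoc (ι p) (ρ.f p), hι,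
      Category.id_comp, add_comm, add_right_cancel_iff] at h1
    rw [Category.assoc, h1]
  let i : C ⟶ T := { f := fun p => ι p ≫ N p, comm' := fun p q hpq => hchain p q hpq }
  refine ⟨{ hom := ρ, inv := i, homotopyHomInvId := ?_, homotopyInvHomId := Homotopy.ofEq ?_ }⟩
  · refine Homotopy.symm ⟨fun p q => h p q ≫ N q, fun p q hpq => ?_, fun p => ?_⟩
    · exact (congrArg (· ≫ N q) (h0 p q hpq)).trans Limits.zero_comp
    · have r1 : (ComplexShape.up ℤ).Rel p (p + 1) := rfl
      have r2 : (ComplexShape.up ℤ).Rel (p - 1) p := by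
        change p - 1 + 1 = p; omega
      refine Eq.trans ?_ (congrArg₂ (fun u v => u + v + (ρ ≫ i).f p) (dNext_eq _ r1).symm
        (prevD_eq _ r2).symm)
      change 𝟙 (T.X p) = T.d p (p + 1) ≫ h (p + 1) p ≫ N p +
        (h p (p - 1) ≫ N (p - 1)) ≫ T.d (p - 1) p + ρ.f p ≫ ι p ≫ N p
      have h1 := congrArg (h p (p - 1) ≫ ·) (key (p - 1) p (by omega))
      simp only [Preadditive.comp_add] at h1
      rw [← Category.assoc (h _ _) (ρ.f _), hh, Limits.zero_comp, add_zero,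
        ← Category.assoc (h _ _) (ρ.f _), hh, Limits.zero_comp, add_zero] at h1
      rw [Category.assoc, ← h1, ← hMN p, hMd]
      simp only [Preadditive.add_comp, Category.assoc]
  · ext p
    change (ι p ≫ N p) ≫ ρ.f p = 𝟙 _
    rw [Category.assoc, hNρ, hι]

end Perturbation

namespace Completion

variable {t : Mode} {C : Type 1} [Category.{1} C] [Preadditive C]

/-- The powers of an endomorphism. -/
noncomputable def power {X : Completion t C} (u : X ⟶ X) : ℕ → (X ⟶ X)
  | 0 => 𝟙 X
  | k + 1 => power u k ≫ u

theorem comp_power {X : Completion t C} (u : X ⟶ X) (k : ℕ) :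
    u ≫ power u k = power u (k + 1) := by
  induction k with
  | zero => exact (Category.comp_id u).trans (Category.id_comp u).symm
  | succ k ih => exact (Category.assoc _ _ _).symm.trans (congrArg (· ≫ u) ih)

theorem id_val_ne (X : Completion t C) {i j : X.ι} (h : i ≠ j) : (𝟙 X : X ⟶ X).1 i j = 0 :=
  dif_neg h

open Classical in
/-- An endomorphism that is unitriangular with respect to a grading of the summands by integers, and
has its off-diagonal entries in degree one, is invertible if only finitely many nonzero summands lie
above (in the case of sums), respectively below (in the case of products), any given one: then the
geometric series is a matrix with finite columns, respectively rows. -/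
theorem isIso_of_unitriangular {X : Completion t C} (f : X ⟶ X) (g : X.ι → ℤ)
    (h1 : ∀ x, f.1 x x = 𝟙 _) (h2 : ∀ x y, x ≠ y → g y ≠ g x + 1 → f.1 x y = 0)
    (hsum : t = .sum → ∀ x, {y | g x ≤ g y ∧ ¬ Limits.IsZero (X.X y)}.Finite)
    (hprod : t = .prod → ∀ y, {x | g x ≤ g y ∧ ¬ Limits.IsZero (X.X x)}.Finite) : IsIso f := by
  obtain ⟨u, hu⟩ : ∃ u : X ⟶ X, u = 𝟙 X - f := ⟨_, rfl⟩
  have hu0 : ∀ x y, g y ≠ g x + 1 → u.1 x y = 0 := by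
    intro x y h
    rw [hu]
    change (𝟙 X : X ⟶ X).1 x y - f.1 x y = 0
    by_cases hxy : x = y
    · subst hxy
      rw [id_val, h1, sub_self]
    · rw [id_val_ne X hxy, h2 x y hxy h, sub_self]
  -- the geometric series: only one power of `u` contributes to a given entry
  let v : X ⟶ X := ⟨fun x y => if g x ≤ g y then (power u (g y - g x).toNat).1 x y else 0, by
    have hv : ∀ x y, (if g x ≤ g y then (power u (g y - g x).toNat).1 x y else 0) ≠ 0 →
        g x ≤ g y ∧ ¬ Limits.IsZero (X.X x) ∧ ¬ Limits.IsZero (X.X y) := by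
      intro x y h
      have hle : g x ≤ g y := by
        by_contra h'
        exact h (if_neg h')
      exact ⟨hle, fun hz => h (hz.eq_of_src _ _), fun hz => h (hz.eq_of_tgt _ _)⟩
    cases t
    · exact fun x => (hsum rfl x).subset fun y hy => ⟨(hv x y hy).1, (hv x y hy).2.2⟩
    · exact fun y => (hprod rfl y).subset fun x hx => ⟨(hv x y hx).1, (hv x y hx).2.1⟩⟩
  have hv : ∀ x y (k : ℕ), g y = g x + k → v.1 x y = (power u k).1 x y := by
    intro x y k hk
    refine (if_pos (by omega)).trans ?_
    rw [show (g y - g x).toNat = k by omega]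
  have hv0 : ∀ x y, g y < g x → v.1 x y = 0 := fun x y h => if_neg (by omega)
  have hvid : ∀ x y, ¬ g x < g y → v.1 x y = (𝟙 X : X ⟶ X).1 x y := by
    intro x y h
    rcases eq_or_lt_of_le (not_lt.mp h) with h | h
    · exact hv x y 0 (by simpa using h)
    · rw [hv0 x y h, id_val_ne X]
      rintro rfl
      exact lt_irrefl _ h
  have hvu : v ≫ u = v - 𝟙 X := by
    refine Subtype.ext ?_
    funext x z
    change ∑ᶠ y, v.1 x y ≫ u.1 y z = v.1 x z - (𝟙 X : X ⟶ X).1 x z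
    by_cases hxz : g x < g z
    · obtain ⟨k, hk⟩ : ∃ k : ℕ, g z = g x + (k + 1 : ℕ) :=
        ⟨(g z - g x - 1).toNat, by push_cast; omega⟩
      rw [hv x z _ hk, id_val_ne X (by rintro rfl; exact lt_irrefl _ hxz), sub_zero]
      refine finsum_congr fun y => ?_
      by_cases hy : g z = g y + 1
      · rw [hv x y k (by push_cast at hk; omega)]
      · rw [hu0 y z hy, Limits.comp_zero, Limits.comp_zero]
    · rw [hvid x z hxz, sub_self]
      refine finsum_eq_zero_of_forall_eq_zero fun y => ?_
      by_cases hy : g z = g y + 1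
      · rw [hv0 x y (by omega), Limits.zero_comp]
      · rw [hu0 y z hy, Limits.comp_zero]
  have huv : u ≫ v = v - 𝟙 X := by
    refine Subtype.ext ?_
    funext x z
    change ∑ᶠ y, u.1 x y ≫ v.1 y z = v.1 x z - (𝟙 X : X ⟶ X).1 x z
    by_cases hxz : g x < g z
    · obtain ⟨k, hk⟩ : ∃ k : ℕ, g z = g x + (k + 1 : ℕ) :=
        ⟨(g z - g x - 1).toNat, by push_cast; omega⟩
      rw [hv x z _ hk, id_val_ne X (by rintro rfl; exact lt_irrefl _ hxz), sub_zero, ← comp_power]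
      refine finsum_congr fun y => ?_
      by_cases hy : g y = g x + 1
      · rw [hv y z k (by push_cast at hk; omega)]
      · rw [hu0 x y hy, Limits.zero_comp, Limits.zero_comp]
    · rw [hvid x z hxz, sub_self]
      refine finsum_eq_zero_of_forall_eq_zero fun y => ?_
      by_cases hy : g y = g x + 1
      · rw [hv0 y z (by omega), Limits.comp_zero]
      · rw [hu0 x y hy, Limits.zero_comp]
  have hf : f = 𝟙 X - u := by rw [hu]; abel
  refine ⟨v, ?_, ?_⟩
  · rw [hf, Preadditive.sub_comp, huv, Category.id_comp, sub_sub_cancel]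
  · rw [hf, Preadditive.comp_sub, hvu, Category.comp_id, sub_sub_cancel]

end Completion

/-! ### Contracting the rows of a bicomplex -/

section TotContraction

variable {A B E : Type 1} [Category.{1} A] [Category.{1} B] [Category.{1} E] [Preadditive A]
  [Preadditive B] [Preadditive E]

theorem negOnePow_mul_self (i : ℤ) : (i.negOnePow : ℤ) * i.negOnePow = 1 := by
  rw [← Units.val_mul, ← Int.negOnePow_add, Int.negOnePow_even _ ⟨i, rfl⟩, Units.val_one]

theorem biMap_id_left (F : A ⥤ B ⥤ E) (X : A) {Y Y' : B} (g : Y ⟶ Y') :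
    biMap F (𝟙 X) g = (F.obj X).map g := by
  simp [biMap]

theorem biMap_id_id (F : A ⥤ B ⥤ E) (X : A) (Y : B) : biMap F (𝟙 X) (𝟙 Y) = 𝟙 _ := by
  simp [biMap]

theorem idOr_d (K : CochainComplex A ℤ) {i j k : ℤ} (h : j + 1 = k) :
    idOr K i j ≫ K.d j k = K.d i k := by
  by_cases hij : i = j
  · subst hij
    rw [idOr_self, Category.id_comp]
  · rw [idOr_ne K hij, Limits.zero_comp, K.shape]
    intro h'
    have h1 : i + 1 = k := h'
    omega

variable (F : A ⥤ B ⥤ E) [F.Additive] [∀ X, (F.obj X).Additive]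
variable (K : CochainComplex A ℤ) (L : CochainComplex B ℤ) (t : Mode)

/-- The row `F(K ^ i, L)` of the bicomplex. -/
noncomputable abbrev row (i : ℤ) : CochainComplex E ℤ :=
  ((F.obj (K.X i)).mapHomologicalComplex _).obj L

/-- The row of index zero, as a complex over the completion. -/
noncomputable abbrev inclRow : CochainComplex (Completion t E) ℤ :=
  ((Completion.incl t E).mapHomologicalComplex _).obj (row F K L 0)

/-- The inclusion of the row of index zero in the total complex. -/
noncomputable def totIncl (p : ℤ) : (inclRow F K L t).X p ⟶ totX F K L t p :=
  ⟨fun _ y => biMap F (idOr K 0 y.1.1) (idOr L p y.1.2), by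
    have h : ∀ (y : {x : ℤ × ℤ // x.1 + x.2 = p}),
        biMap F (idOr K 0 y.1.1) (idOr L p y.1.2) ≠ 0 → y.1 = (0, p) := by
      intro y h
      refine Prod.ext ?_ ?_
      · by_contra h'
        exact h (by rw [idOr_ne K (Ne.symm h'), biMap_zero_left])
      · by_contra h'
        exact h (by rw [idOr_ne L (Ne.symm h'), biMap_zero_right])
    cases t
    · exact fun x => finite_of_near (0, p) (0, p) fun y hy => Or.inl (h y hy)
    · exact fun y => Set.toFinite (α := Unit) _⟩

/-- The projection of the total complex to the row of index zero. -/
noncomputable def totProj (p : ℤ) : totX F K L t p ⟶ (inclRow F K L t).X p :=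
  ⟨fun x _ => biMap F (idOr K x.1.1 0) (idOr L x.1.2 p), by
    have h : ∀ (x : {x : ℤ × ℤ // x.1 + x.2 = p}),
        biMap F (idOr K x.1.1 0) (idOr L x.1.2 p) ≠ 0 → x.1 = (0, p) := by
      intro y h
      refine Prod.ext ?_ ?_
      · by_contra h'
        exact h (by rw [idOr_ne K h', biMap_zero_left])
      · by_contra h'
        exact h (by rw [idOr_ne L h', biMap_zero_right])
    cases t
    · exact fun x => Set.toFinite (α := Unit) _
    · exact fun x => finite_of_near (0, p) (0, p) fun y hy => Or.inl (h y hy)⟩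

variable {F K L}

open Classical in
/-- The contraction of the `i`-th row with the sign `(-1) ^ i` if `i = i'` is not zero, and zero
otherwise. -/
noncomputable def rowHtpy (H : ∀ i ≠ 0, Homotopy (𝟙 (row F K L i)) 0) (i j i' j' : ℤ) :
    (F.obj (K.X i)).obj (L.X j) ⟶ (F.obj (K.X i')).obj (L.X j') :=
  if h : i ≠ 0 ∧ i = i' then
    (i.negOnePow : ℤ) • ((H i h.1).hom j j' ≫ eqToHom (by rw [h.2]; rfl)) else 0

theorem rowHtpy_eq_zero (H : ∀ i ≠ 0, Homotopy (𝟙 (row F K L i)) 0) {i j i' j' : ℤ}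
    (h : i = 0 ∨ i' = 0 ∨ i ≠ i' ∨ j' + 1 ≠ j) : rowHtpy H i j i' j' = 0 := by
  by_cases h0 : i ≠ 0 ∧ i = i'
  · obtain ⟨h1, rfl⟩ := h0
    have h2 : j' + 1 ≠ j := by tauto
    refine (dif_pos ⟨h1, rfl⟩).trans ?_
    refine (congrArg (fun u => (i.negOnePow : ℤ) • (u ≫ eqToHom rfl)) ((H i h1).zero j j' h2)).trans
      ?_
    exact (congrArg (fun u => (i.negOnePow : ℤ) • u) Limits.zero_comp).trans (smul_zero _)
  · exact dif_neg h0

theorem rowHtpy_apply (H : ∀ i ≠ 0, Homotopy (𝟙 (row F K L i)) 0) {i : ℤ} (hi : i ≠ 0)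
    (j j' : ℤ) : rowHtpy H i j i j' = (i.negOnePow : ℤ) • (H i hi).hom j j' :=
  (dif_pos ⟨hi, rfl⟩).trans (congrArg (fun u => (i.negOnePow : ℤ) • u) (Category.comp_id _))

/-- The vertical differential of the bicomplex carries the sign `(-1) ^ i` as well, so that the
signs cancel. -/
theorem rowHtpy_comm (H : ∀ i ≠ 0, Homotopy (𝟙 (row F K L i)) 0) {i : ℤ} (hi : i ≠ 0)
    (j : ℤ) : ((i.negOnePow : ℤ) • (F.obj (K.X i)).map (L.d j (j + 1))) ≫ rowHtpy H i (j + 1) i j +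
      rowHtpy H i j i (j - 1) ≫ ((i.negOnePow : ℤ) • (F.obj (K.X i)).map (L.d (j - 1) j)) =
        𝟙 _ := by
  have r1 : (ComplexShape.up ℤ).Rel j (j + 1) := rfl
  have r2 : (ComplexShape.up ℤ).Rel (j - 1) j := by
    change j - 1 + 1 = j; omega
  have hc := (H i hi).comm j
  rw [dNext_eq _ r1, prevD_eq _ r2] at hc
  rw [rowHtpy_apply H hi, rowHtpy_apply H hi]
  refine Eq.trans (congrArg₂ (· + ·)
    ((Preadditive.zsmul_comp ..).trans (congrArg _ (Preadditive.comp_zsmul ..)))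
    ((Preadditive.zsmul_comp ..).trans (congrArg _ (Preadditive.comp_zsmul ..)))) ?_
  rw [smul_smul, smul_smul, negOnePow_mul_self, one_smul, one_smul]
  exact ((add_zero _).symm.trans hc.symm)

/-- The contractions of the rows of nonzero index, as a map between terms of the total complex. -/
noncomputable def totHtpy (H : ∀ i ≠ 0, Homotopy (𝟙 (row F K L i)) 0) (p q : ℤ) :
    totX F K L t p ⟶ totX F K L t q :=
  ⟨fun x y => rowHtpy H x.1.1 x.1.2 y.1.1 y.1.2, by
    have h : ∀ (x : {x : ℤ × ℤ // x.1 + x.2 = p}) (y : {x : ℤ × ℤ // x.1 + x.2 = q}),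
        rowHtpy H x.1.1 x.1.2 y.1.1 y.1.2 ≠ 0 → x.1.1 = y.1.1 := by
      intro x y h
      by_contra h'
      exact h (rowHtpy_eq_zero H (by tauto))
    cases t
    · refine fun x => finite_of_near (x.1.1, q - x.1.1) (x.1.1, q - x.1.1) fun y hy => ?_
      have h1 := h x y hy
      have h2 := y.2
      exact Or.inl (Prod.ext h1.symm (by simp only; omega))
    · refine fun y => finite_of_near (y.1.1, p - y.1.1) (y.1.1, p - y.1.1) fun x hx => ?_
      have h1 := h x y hx
      have h2 := x.2
      exact Or.inl (Prod.ext h1 (by simp only; omega))⟩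

variable {t}

theorem totHtpy_zero (H : ∀ i ≠ 0, Homotopy (𝟙 (row F K L i)) 0) (p q : ℤ) (h : q + 1 ≠ p) :
    totHtpy t H p q = 0 := by
  refine Subtype.ext ?_
  funext x y
  have hx := x.2
  have hy := y.2
  refine rowHtpy_eq_zero H ?_
  by_contra h'
  push Not at h'
  omega

theorem totIncl_comp {p : ℤ} {Z : Completion t E} (f : totX F K L t p ⟶ Z) (x : Unit) (z : Z.ι) :
    (totIncl F K L t p ≫ f).1 x z = f.1 ⟨(0, p), zero_add p⟩ z := by
  refine (finsum_eq_single _ (⟨(0, p), zero_add p⟩ : {x : ℤ × ℤ // x.1 + x.2 = p})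
    fun y hy => ?_).trans ?_
  · have h0 : y.1.1 ≠ 0 := fun h => hy (Subtype.ext (Prod.ext h (by have := y.2; simp only; omega)))
    refine (congrArg (fun u => biMap F u (idOr L p y.1.2) ≫ f.1 y z) (idOr_ne K h0.symm)).trans ?_
    exact (congrArg (· ≫ f.1 y z) (biMap_zero_left F _)).trans Limits.zero_comp
  · refine (congrArg₂ (fun u v => biMap F u v ≫ f.1 ⟨(0, p), zero_add p⟩ z) (idOr_self K 0)
      (idOr_self L p)).trans ?_
    rw [biMap_id_left, CategoryTheory.Functor.map_id]
    exact Category.id_comp _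

theorem comp_totProj {p : ℤ} {Z : Completion t E} (f : Z ⟶ totX F K L t p) (z : Z.ι) (y : Unit) :
    (f ≫ totProj F K L t p).1 z y = f.1 z ⟨(0, p), zero_add p⟩ := by
  refine (finsum_eq_single _ (⟨(0, p), zero_add p⟩ : {x : ℤ × ℤ // x.1 + x.2 = p})
    fun y hy => ?_).trans ?_
  · have h0 : y.1.1 ≠ 0 := fun h => hy (Subtype.ext (Prod.ext h (by have := y.2; simp only; omega)))
    refine (congrArg (fun u => f.1 z y ≫ biMap F u (idOr L y.1.2 p)) (idOr_ne K h0)).trans ?_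
    exact (congrArg (f.1 z y ≫ ·) (biMap_zero_left F _)).trans Limits.comp_zero
  · refine (congrArg₂ (fun u v => f.1 z ⟨(0, p), zero_add p⟩ ≫ biMap F u v) (idOr_self K 0)
      (idOr_self L p)).trans ?_
    rw [biMap_id_left, CategoryTheory.Functor.map_id]
    exact Category.comp_id _

theorem totIncl_totProj (p : ℤ) : totIncl F K L t p ≫ totProj F K L t p = 𝟙 _ := by
  refine Subtype.ext ?_
  funext x y
  refine (totIncl_comp _ _ _).trans ?_
  refine (congrArg₂ (biMap F) (idOr_self K 0) (idOr_self L p)).trans ?_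
  rw [biMap_id_left, CategoryTheory.Functor.map_id]
  exact (Completion.id_val ((inclRow F K L t).X p) x).symm

theorem totIncl_totHtpy (H : ∀ i ≠ 0, Homotopy (𝟙 (row F K L i)) 0) (p q : ℤ) :
    totIncl F K L t p ≫ totHtpy t H p q = 0 := by
  refine Subtype.ext ?_
  funext x y
  exact (totIncl_comp _ _ _).trans (rowHtpy_eq_zero H (.inl rfl))

theorem totHtpy_totProj (H : ∀ i ≠ 0, Homotopy (𝟙 (row F K L i)) 0) (p q : ℤ) :
    totHtpy t H p q ≫ totProj F K L t q = 0 := by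
  refine Subtype.ext ?_
  funext x y
  exact (comp_totProj _ _ _).trans (rowHtpy_eq_zero H (.inr (.inl rfl)))

/-- If no differential starts in `K ^ 0`, then the row of index zero is a subcomplex. -/
theorem totIncl_d (h0 : K.d 0 1 = 0) (p q : ℤ) (hpq : p + 1 = q) :
    totIncl F K L t p ≫ (tot F K L t).d p q = (inclRow F K L t).d p q ≫ totIncl F K L t q := by
  refine Subtype.ext ?_
  funext x z
  refine (totIncl_comp ((tot F K L t).d p q) x z).trans ?_
  change biMap F (K.d 0 z.1.1) (idOr L p z.1.2) +
    ((0 : ℤ).negOnePow : ℤ) • biMap F (idOr K 0 z.1.1) (L.d p z.1.2) = _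
  have h1 : K.d 0 z.1.1 = 0 := by
    by_cases h : z.1.1 = 1
    · rw [h, h0]
    · exact K.shape _ _ fun h' => h (by have h2 : (0 : ℤ) + 1 = z.1.1 := h'; omega)
  rw [h1, biMap_zero_left, zero_add, Int.negOnePow_zero, Units.val_one, one_smul]
  refine Eq.trans ?_ (finsum_eq_single _ () fun k hk => (hk rfl).elim).symm
  change _ = (F.obj (K.X 0)).map (L.d p q) ≫ biMap F (idOr K 0 z.1.1) (idOr L q z.1.2)
  subst hpq
  rw [← biMap_id_left, biMap_comp, Category.id_comp, d_idOr]

/-- If no differential ends in `K ^ 0`, then the row of index zero is a quotient complex. -/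
theorem d_totProj (h0 : K.d (-1) 0 = 0) (p q : ℤ) (hpq : p + 1 = q) :
    (tot F K L t).d p q ≫ totProj F K L t q = totProj F K L t p ≫ (inclRow F K L t).d p q := by
  refine Subtype.ext ?_
  funext x z
  refine (comp_totProj _ _ _).trans ?_
  change biMap F (K.d x.1.1 0) (idOr L x.1.2 q) +
    (x.1.1.negOnePow : ℤ) • biMap F (idOr K x.1.1 0) (L.d x.1.2 q) = _
  have h1 : K.d x.1.1 0 = 0 := by
    by_cases h : x.1.1 = -1
    · rw [h, h0]
    · exact K.shape _ _ fun h' => h (by have h2 : x.1.1 + 1 = 0 := h'; omega)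
  have h2 : (x.1.1.negOnePow : ℤ) • biMap F (idOr K x.1.1 0) (L.d x.1.2 q) =
      biMap F (idOr K x.1.1 0) (L.d x.1.2 q) := by
    by_cases h : x.1.1 = 0
    · rw [h, Int.negOnePow_zero, Units.val_one, one_smul]
    · rw [idOr_ne K h, biMap_zero_left, smul_zero]
  rw [h1, biMap_zero_left, zero_add, h2]
  refine Eq.trans ?_ (finsum_eq_single _ () fun k hk => (hk rfl).elim).symm
  change _ = biMap F (idOr K x.1.1 0) (idOr L x.1.2 p) ≫ (F.obj (K.X 0)).map (L.d p q)
  rw [← biMap_id_left, biMap_comp, Category.comp_id, idOr_d L hpq]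

variable (F K L) in
/-- The entries of the differential of the total complex. -/
noncomputable def totEntry (i j i' j' : ℤ) :
    (F.obj (K.X i)).obj (L.X j) ⟶ (F.obj (K.X i')).obj (L.X j') :=
  biMap F (K.d i i') (idOr L j j') + (i.negOnePow : ℤ) • biMap F (idOr K i i') (L.d j j')

theorem totEntry_eq_zero {i j i' j' : ℤ} (h : i + 1 ≠ i') (h' : i ≠ i') :
    totEntry F K L i j i' j' = 0 := by
  rw [totEntry, K.shape _ _ h, idOr_ne K h', biMap_zero_left, biMap_zero_left, smul_zero, add_zero]

theorem totEntry_self (i j j' : ℤ) :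
    totEntry F K L i j i j' = (i.negOnePow : ℤ) • (F.obj (K.X i)).map (L.d j j') := by
  have h : ¬ (ComplexShape.up ℤ).Rel i i := fun h => by
    have h1 : i + 1 = i := h
    omega
  rw [totEntry, K.shape _ _ h, idOr_self, biMap_zero_left, zero_add, biMap_id_left]

/-- The perturbation of the contractions of the rows: the part of degree zero in the row index of
`d h + h d + ρ ι` is the identity, and the rest, coming from the horizontal differential, has degree
one. -/
theorem isIso_totHtpy (H : ∀ i ≠ 0, Homotopy (𝟙 (row F K L i)) 0)
    (hsum : t = .sum → (∀ i > 0, Limits.IsZero (K.X i)) ∨ ∀ j < 0, Limits.IsZero (L.X j))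
    (hprod : t = .prod → (∀ i < 0, Limits.IsZero (K.X i)) ∨ ∀ j > 0, Limits.IsZero (L.X j))
    (p : ℤ) : IsIso ((totH F K L t p (p + 1) + totV F K L t p (p + 1)) ≫ totHtpy t H (p + 1) p +
      totHtpy t H p (p - 1) ≫ (totH F K L t (p - 1) p + totV F K L t (p - 1) p) +
      totProj F K L t p ≫ totIncl F K L t p) := by
  have hfin : ∀ (a b : ℤ) (s : Set {x : ℤ × ℤ // x.1 + x.2 = p}),
      (∀ x ∈ s, a ≤ x.1.1 ∧ x.1.1 ≤ b) → s.Finite := by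
    intro a b s hs
    refine Set.Finite.of_finite_image (f := fun x => x.1.1)
      ((Set.finite_Icc a b).subset ?_) ?_
    · rintro _ ⟨x, hx, rfl⟩
      exact hs x hx
    · intro x _ y _ hxy
      have h1 := x.2
      have h2 := y.2
      have h3 : x.1.1 = y.1.1 := hxy
      exact Subtype.ext (Prod.ext h3 (by omega))
  have hzl : ∀ x : {x : ℤ × ℤ // x.1 + x.2 = p}, Limits.IsZero (K.X x.1.1) →
      Limits.IsZero ((totX F K L t p).X x) := by
    intro x hx
    refine (Limits.IsZero.iff_id_eq_zero _).mpr ?_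
    refine (biMap_id_id F _ _).symm.trans ?_
    rw [hx.eq_of_src (𝟙 _) 0, biMap_zero_left]
    rfl
  have hzr : ∀ x : {x : ℤ × ℤ // x.1 + x.2 = p}, Limits.IsZero (L.X x.1.2) →
      Limits.IsZero ((totX F K L t p).X x) := by
    intro x hx
    refine (Limits.IsZero.iff_id_eq_zero _).mpr ?_
    refine (biMap_id_id F _ _).symm.trans ?_
    rw [hx.eq_of_src (𝟙 (L.X x.1.2)) 0, biMap_zero_right]
    rfl
  refine Completion.isIso_of_unitriangular (X := totX F K L t p) _ (fun x => x.1.1) ?_ ?_ ?_ ?_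
  · intro ⟨⟨i, j⟩, hx⟩
    simp only at hx
    subst hx
    change (∑ᶠ y : {x : ℤ × ℤ // x.1 + x.2 = i + j + 1}, totEntry F K L i j y.1.1 y.1.2 ≫
      rowHtpy H y.1.1 y.1.2 i j) +
      (∑ᶠ y : {x : ℤ × ℤ // x.1 + x.2 = i + j - 1}, rowHtpy H i j y.1.1 y.1.2 ≫
      totEntry F K L y.1.1 y.1.2 i j) +
      (∑ᶠ _ : Unit, biMap F (idOr K i 0) (idOr L j (i + j)) ≫
        biMap F (idOr K 0 i) (idOr L (i + j) j)) = _
    by_cases hi : i = 0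
    · subst hi
      rw [finsum_eq_zero_of_forall_eq_zero, finsum_eq_zero_of_forall_eq_zero, zero_add, zero_add]
      · refine (finsum_eq_single _ () fun k hk => (hk rfl).elim).trans ?_
        have hj : ∀ k, j = k → idOr L j k ≫ idOr L k j = 𝟙 _ := by
          rintro k rfl
          rw [idOr_self, Category.comp_id]
        rw [biMap_comp, idOr_self, Category.comp_id, hj _ (zero_add j).symm, biMap_id_id]
        rfl
      · intro y
        rw [rowHtpy_eq_zero H (.inl rfl), Limits.zero_comp]
      · intro y
        rw [rowHtpy_eq_zero H (.inr (.inl rfl)), Limits.comp_zero]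
    · have h3 : (∑ᶠ _ : Unit, biMap F (idOr K i 0) (idOr L j (i + j)) ≫
          biMap F (idOr K 0 i) (idOr L (i + j) j)) = 0 :=
        finsum_eq_zero_of_forall_eq_zero fun _ => by
          rw [idOr_ne K hi, biMap_zero_left, Limits.zero_comp]
      refine (congrArg (fun u => _ + _ + u) h3).trans ((add_zero _).trans ?_)
      refine Eq.trans (congrArg₂ (· + ·) ?_ ?_) (rowHtpy_comm H hi j)
      · refine (finsum_eq_single _ (⟨(i, j + 1), by simp only; omega⟩ :
          {x : ℤ × ℤ // x.1 + x.2 = i + j + 1}) fun y hy => ?_).trans ?_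
        · rw [rowHtpy_eq_zero H, Limits.comp_zero]
          refine .inr (.inr (.inl fun h => hy (Subtype.ext (Prod.ext h ?_))))
          have h2 := y.2
          simp only
          omega
        · refine congrArg (· ≫ rowHtpy H i (j + 1) i j) ?_
          exact totEntry_self i j (j + 1)
      · refine (finsum_eq_single _ (⟨(i, j - 1), by simp only; omega⟩ :
          {x : ℤ × ℤ // x.1 + x.2 = i + j - 1}) fun y hy => ?_).trans ?_
        · rw [rowHtpy_eq_zero H, Limits.zero_comp]
          refine .inr (.inr (.inl fun h => hy (Subtype.ext (Prod.ext h.symm ?_))))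
          have h2 := y.2
          simp only
          omega
        · refine congrArg (rowHtpy H i j i (j - 1) ≫ ·) ?_
          exact totEntry_self i (j - 1) j
  · intro x z hxz hg
    have hne : x.1.1 ≠ z.1.1 := by
      intro h
      have h1 := x.2
      have h2 := z.2
      exact hxz (Subtype.ext (Prod.ext h (by omega)))
    change (∑ᶠ y : {x : ℤ × ℤ // x.1 + x.2 = p + 1}, totEntry F K L x.1.1 x.1.2 y.1.1 y.1.2 ≫
      rowHtpy H y.1.1 y.1.2 z.1.1 z.1.2) +
      (∑ᶠ y : {x : ℤ × ℤ // x.1 + x.2 = p - 1}, rowHtpy H x.1.1 x.1.2 y.1.1 y.1.2 ≫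
      totEntry F K L y.1.1 y.1.2 z.1.1 z.1.2) +
      (∑ᶠ _ : Unit, biMap F (idOr K x.1.1 0) (idOr L x.1.2 p) ≫
        biMap F (idOr K 0 z.1.1) (idOr L p z.1.2)) = 0
    rw [finsum_eq_zero_of_forall_eq_zero, finsum_eq_zero_of_forall_eq_zero,
      finsum_eq_zero_of_forall_eq_zero, zero_add, zero_add]
    · intro _
      by_cases h : x.1.1 = 0
      · rw [idOr_ne K (show 0 ≠ z.1.1 by omega), biMap_zero_left, Limits.comp_zero]
      · rw [idOr_ne K h, biMap_zero_left, Limits.zero_comp]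
    · intro y
      by_cases h : x.1.1 = y.1.1
      · rw [totEntry_eq_zero (by omega) (by omega), Limits.comp_zero]
      · rw [rowHtpy_eq_zero H (.inr (.inr (.inl h))), Limits.zero_comp]
    · intro y
      by_cases h : y.1.1 = z.1.1
      · rw [totEntry_eq_zero (by omega) (by omega), Limits.zero_comp]
      · rw [rowHtpy_eq_zero H (.inr (.inr (.inl h))), Limits.comp_zero]
  · intro ht x
    rcases hsum ht with h | h
    · refine hfin x.1.1 0 _ fun y hy => ⟨hy.1, ?_⟩
      by_contra h'
      exact hy.2 (hzl y (h _ (not_le.mp h')))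
    · refine hfin x.1.1 p _ fun y hy => ⟨hy.1, ?_⟩
      by_contra h'
      have h2 := y.2
      exact hy.2 (hzr y (h _ (by omega)))
  · intro ht y
    rcases hprod ht with h | h
    · refine hfin 0 y.1.1 _ fun x hx => ⟨?_, hx.1⟩
      by_contra h'
      exact hx.2 (hzl x (h _ (not_le.mp h')))
    · refine hfin p y.1.1 _ fun x hx => ⟨?_, hx.1⟩
      by_contra h'
      have h2 := x.2
      exact hx.2 (hzr x (h _ (by omega)))

/-- If the rows of nonzero index are contractible and the row of index zero is a subcomplex or a
quotient complex, then the total complex is homotopy equivalent to this row, provided that the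
geometric series of the perturbation is a matrix with finite columns, respectively rows. -/
theorem nonempty_homotopyEquiv_tot (hc : ∀ i ≠ 0, Contractible (row F K L i))
    (h0 : K.d 0 1 = 0 ∨ K.d (-1) 0 = 0)
    (hsum : t = .sum → (∀ i > 0, Limits.IsZero (K.X i)) ∨ ∀ j < 0, Limits.IsZero (L.X j))
    (hprod : t = .prod → (∀ i < 0, Limits.IsZero (K.X i)) ∨ ∀ j > 0, Limits.IsZero (L.X j)) :
    Nonempty (HomotopyEquiv (tot F K L t) (inclRow F K L t)) := by
  have H : ∀ i ≠ 0, Homotopy (𝟙 (row F K L i)) 0 := fun i hi => (hc i hi).some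
  rcases h0 with h0 | h0
  · exact nonempty_homotopyEquiv_of_inclusion (T := tot F K L t)
      { f := totIncl F K L t, comm' := fun p q hpq => totIncl_d h0 p q hpq } (totProj F K L t)
      (totHtpy t H) (totHtpy_zero H) totIncl_totProj (totIncl_totHtpy H)
      (isIso_totHtpy H hsum hprod)
  · exact nonempty_homotopyEquiv_of_projection (T := tot F K L t) (totIncl F K L t)
      { f := totProj F K L t, comm' := fun p q hpq => (d_totProj h0 p q hpq).symm }
      (totHtpy t H) (totHtpy_zero H) totIncl_totProj (totHtpy_totProj H)
      (isIso_totHtpy H hsum hprod)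

end TotContraction

/-! ### Interchanging the two factors -/

section TotSwap

variable {A B E : Type 1} [Category.{1} A] [Category.{1} B] [Category.{1} E] [Preadditive A]
  [Preadditive B] [Preadditive E]

theorem biMap_flip (F : A ⥤ B ⥤ E) {X X' : A} {Y Y' : B} (f : X ⟶ X') (g : Y ⟶ Y') :
    biMap F.flip g f = biMap F f g := by
  simp [biMap]

variable (F : A ⥤ B ⥤ E) [F.Additive] [∀ X, (F.obj X).Additive]
variable (K : CochainComplex A ℤ) (L : CochainComplex B ℤ) (t : Mode)

/-- The entries of the interchange of the two factors: the sign `(-1) ^ (i * j)` on `(i, j)`. -/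
noncomputable def swapEntry (i j i' j' : ℤ) :
    (F.obj (K.X i)).obj (L.X j) ⟶ (F.obj (K.X i')).obj (L.X j') :=
  ((i * j).negOnePow : ℤ) • biMap F (idOr K i i') (idOr L j j')

theorem swapEntry_eq_zero {i j i' j' : ℤ} (h : ¬ (i = i' ∧ j = j')) :
    swapEntry F K L i j i' j' = 0 := by
  rw [swapEntry]
  by_cases hi : i = i'
  · rw [idOr_ne L (fun hj => h ⟨hi, hj⟩), biMap_zero_right, smul_zero]
  · rw [idOr_ne K hi, biMap_zero_left, smul_zero]

theorem swapEntry_self (i j : ℤ) :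
    swapEntry F K L i j i j = ((i * j).negOnePow : ℤ) • 𝟙 _ := by
  rw [swapEntry, idOr_self, idOr_self, biMap_id_id]

theorem isFinite_swapEntry (p : ℤ) : Completion.IsFinite t
    (fun (x : (totX F K L t p).ι) (y : (totX F.flip L K t p).ι) =>
      swapEntry F K L x.1.1 x.1.2 y.1.2 y.1.1) := by
  have h : ∀ (x : {x : ℤ × ℤ // x.1 + x.2 = p}) (y : {x : ℤ × ℤ // x.1 + x.2 = p}),
      swapEntry F K L x.1.1 x.1.2 y.1.2 y.1.1 ≠ 0 → x.1.1 = y.1.2 ∧ x.1.2 = y.1.1 := by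
    intro x y h
    by_contra h'
    exact h (swapEntry_eq_zero F K L h')
  cases t
  · refine fun x => finite_of_near (x.1.2, x.1.1) (x.1.2, x.1.1) fun y hy => ?_
    exact Or.inl (Prod.ext (h x y hy).2.symm (h x y hy).1.symm)
  · refine fun y => finite_of_near (y.1.2, y.1.1) (y.1.2, y.1.1) fun x hx => ?_
    exact Or.inl (Prod.ext (h x y hx).1 (h x y hx).2)

/-- The interchange of the two factors of the total complex. -/
noncomputable def totSwap (p : ℤ) : totX F K L t p ⟶ totX F.flip L K t p :=
  ⟨fun x y => swapEntry F K L x.1.1 x.1.2 y.1.2 y.1.1, isFinite_swapEntry F K L t p⟩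

/-- The inverse of the interchange of the two factors of the total complex. -/
noncomputable def totSwapInv (p : ℤ) : totX F.flip L K t p ⟶ totX F K L t p :=
  ⟨fun x y => swapEntry F K L x.1.2 x.1.1 y.1.1 y.1.2, by
    have h : ∀ (x : {x : ℤ × ℤ // x.1 + x.2 = p}) (y : {x : ℤ × ℤ // x.1 + x.2 = p}),
        swapEntry F K L x.1.2 x.1.1 y.1.1 y.1.2 ≠ 0 → x.1.2 = y.1.1 ∧ x.1.1 = y.1.2 := by
      intro x y h
      by_contra h'
      exact h (swapEntry_eq_zero F K L h')
    cases t
    · refine fun x => finite_of_near (x.1.2, x.1.1) (x.1.2, x.1.1) fun y hy => ?_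
      exact Or.inl (Prod.ext (h x y hy).1.symm (h x y hy).2.symm)
    · refine fun y => finite_of_near (y.1.2, y.1.1) (y.1.2, y.1.1) fun x hx => ?_
      exact Or.inl (Prod.ext (h x y hx).2 (h x y hx).1)⟩

theorem swapEntry_swapEntry (i j i' j' : ℤ) :
    swapEntry F K L i j i j ≫ swapEntry F K L i j i' j' =
      biMap F (idOr K i i') (idOr L j j') := by
  rw [swapEntry_self, swapEntry, Preadditive.zsmul_comp, Preadditive.comp_zsmul, smul_smul,
    negOnePow_mul_self, one_smul, Category.id_comp]

theorem totX_id_apply (p : ℤ) (x y : {x : ℤ × ℤ // x.1 + x.2 = p}) :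
    biMap F (idOr K x.1.1 y.1.1) (idOr L x.1.2 y.1.2) =
      (𝟙 (totX F K L t p) : totX F K L t p ⟶ totX F K L t p).1 x y := by
  by_cases h : x = y
  · subst h
    refine Eq.trans ?_ (Completion.id_val (totX F K L t p) x).symm
    rw [idOr_self, idOr_self, biMap_id_id]
    rfl
  · refine Eq.trans ?_ (Completion.id_val_ne (totX F K L t p) h).symm
    by_cases h1 : x.1.1 = y.1.1
    · rw [idOr_ne L, biMap_zero_right]
      · rfl
      · exact fun h2 => h (Subtype.ext (Prod.ext h1 h2))
    · rw [idOr_ne K h1, biMap_zero_left]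
      rfl

theorem totSwap_totSwapInv (p : ℤ) : totSwap F K L t p ≫ totSwapInv F K L t p = 𝟙 _ := by
  refine Subtype.ext ?_
  funext x z
  change (∑ᶠ y : {x : ℤ × ℤ // x.1 + x.2 = p}, swapEntry F K L x.1.1 x.1.2 y.1.2 y.1.1 ≫
    swapEntry F K L y.1.2 y.1.1 z.1.1 z.1.2) = _
  rw [finsum_eq_single _ (⟨(x.1.2, x.1.1), (add_comm _ _).trans x.2⟩ :
    {x : ℤ × ℤ // x.1 + x.2 = p})]
  · exact (swapEntry_swapEntry F K L _ _ _ _).trans (totX_id_apply F K L t p x z)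
  · intro y hy
    rw [swapEntry_eq_zero, Limits.zero_comp]
    exact fun h => hy (Subtype.ext (Prod.ext h.2.symm h.1.symm))

theorem totSwapInv_totSwap (p : ℤ) : totSwapInv F K L t p ≫ totSwap F K L t p = 𝟙 _ := by
  refine Subtype.ext ?_
  funext x z
  change (∑ᶠ y : {x : ℤ × ℤ // x.1 + x.2 = p}, swapEntry F K L x.1.2 x.1.1 y.1.1 y.1.2 ≫
    swapEntry F K L y.1.1 y.1.2 z.1.2 z.1.1) = _
  rw [finsum_eq_single _ (⟨(x.1.2, x.1.1), (add_comm _ _).trans x.2⟩ :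
    {x : ℤ × ℤ // x.1 + x.2 = p})]
  · refine (swapEntry_swapEntry F K L _ _ _ _).trans ?_
    exact (biMap_flip F _ _).symm.trans (totX_id_apply F.flip L K t p x z)
  · intro y hy
    rw [swapEntry_eq_zero, Limits.zero_comp]
    exact fun h => hy (Subtype.ext (Prod.ext h.1.symm h.2.symm))

/-- The interchange of the factors is a chain map: the sign `(-1) ^ (i * j)` turns the sign rule for
`F(K, L)` into the one with the factors interchanged. -/
theorem totEntry_swapEntry (i j i' j' : ℤ) :
    swapEntry F K L i j i j ≫ totEntry F.flip L K j i j' i' =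
      totEntry F K L i j i' j' ≫ swapEntry F K L i' j' i' j' := by
  rw [swapEntry_self, swapEntry_self, Preadditive.zsmul_comp, Preadditive.comp_zsmul]
  refine (congrArg (fun u => ((i * j).negOnePow : ℤ) • u) (Category.id_comp _)).trans
    (Eq.trans ?_ (congrArg (fun u => ((i' * j').negOnePow : ℤ) • u) (Category.comp_id _)).symm)
  have h1 : totEntry F.flip L K j i j' i' = biMap F (idOr K i i') (L.d j j') +
      (j.negOnePow : ℤ) • biMap F (K.d i i') (idOr L j j') := by
    rw [totEntry, biMap_flip, biMap_flip]
  refine (congrArg (fun u => ((i * j).negOnePow : ℤ) • u) h1).trans ?_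
  rw [totEntry, smul_add, smul_add, smul_smul, smul_smul, add_comm]
  congr 1
  · by_cases h : i + 1 = i' ∧ j = j'
    · obtain ⟨rfl, rfl⟩ := h
      rw [add_mul, one_mul, Int.negOnePow_add, Units.val_mul]
    · have h0 : biMap F (K.d i i') (idOr L j j') = 0 := by
        by_cases hi : i + 1 = i'
        · rw [idOr_ne L (fun hj => h ⟨hi, hj⟩), biMap_zero_right]
        · rw [K.shape _ _ hi, biMap_zero_left]
      rw [h0, smul_zero, smul_zero]
  · by_cases h : i = i' ∧ j + 1 = j'
    · obtain ⟨rfl, rfl⟩ := h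
      rw [mul_add, mul_one, Int.negOnePow_add, Units.val_mul, mul_assoc, negOnePow_mul_self,
        mul_one]
    · have h0 : biMap F (idOr K i i') (L.d j j') = 0 := by
        by_cases hi : i = i'
        · rw [L.shape _ _ (fun hj => h ⟨hi, hj⟩), biMap_zero_right]
        · rw [idOr_ne K hi, biMap_zero_left]
      rw [h0, smul_zero, smul_zero]

theorem totSwap_d (p q : ℤ) : totSwap F K L t p ≫ (tot F.flip L K t).d p q =
    (tot F K L t).d p q ≫ totSwap F K L t q := by
  refine Subtype.ext ?_
  funext x z
  change (∑ᶠ y : {x : ℤ × ℤ // x.1 + x.2 = p}, swapEntry F K L x.1.1 x.1.2 y.1.2 y.1.1 ≫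
    totEntry F.flip L K y.1.1 y.1.2 z.1.1 z.1.2) =
    (∑ᶠ y : {x : ℤ × ℤ // x.1 + x.2 = q}, totEntry F K L x.1.1 x.1.2 y.1.1 y.1.2 ≫
      swapEntry F K L y.1.1 y.1.2 z.1.2 z.1.1)
  rw [finsum_eq_single _ (⟨(x.1.2, x.1.1), (add_comm _ _).trans x.2⟩ :
    {x : ℤ × ℤ // x.1 + x.2 = p}), finsum_eq_single _ (⟨(z.1.2, z.1.1), (add_comm _ _).trans z.2⟩ :
    {x : ℤ × ℤ // x.1 + x.2 = q})]
  · exact totEntry_swapEntry F K L _ _ _ _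
  · intro y hy
    rw [swapEntry_eq_zero, Limits.comp_zero]
    exact fun h => hy (Subtype.ext (Prod.ext h.1 h.2))
  · intro y hy
    rw [swapEntry_eq_zero, Limits.zero_comp]
    exact fun h => hy (Subtype.ext (Prod.ext h.2.symm h.1.symm))

/-- The total complex does not depend on the order of the two factors. -/
noncomputable def totSwapIso : tot F K L t ≅ tot F.flip L K t :=
  HomologicalComplex.Hom.isoOfComponents
    (fun p => ⟨totSwap F K L t p, totSwapInv F K L t p, totSwap_totSwapInv F K L t p,
      totSwapInv_totSwap F K L t p⟩)
    (fun p q _ => totSwap_d F K L t p q)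

end TotSwap

/-! ### Absorption -/

namespace BN

/-- Stacking on top a complex whose terms in nonzero degrees contain turnbacks and whose term in
degree zero is the identity diagram. -/
theorem equivTo_stackTot {t : Mode} {K : CochainComplex (BN n n) ℤ} {L : CochainComplex (BN n m) ℤ}
    (hK : ∀ i ≠ 0, ∀ x, ((K.X i).X x).curve.JoinsBelow) (e : K.X 0 ≅ of (Curve.one n) 0)
    (h0 : K.d 0 1 = 0 ∨ K.d (-1) 0 = 0) (hL : KillsAbove L)
    (hsum : t = .sum → (∀ i > 0, Limits.IsZero (K.X i)) ∨ ∀ j < 0, Limits.IsZero (L.X j))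
    (hprod : t = .prod → (∀ i < 0, Limits.IsZero (K.X i)) ∨ ∀ j > 0, Limits.IsZero (L.X j)) :
    EquivTo (stackTot t K L) L := by
  obtain ⟨h⟩ := nonempty_homotopyEquiv_tot (F := stack n n m)
    (fun i hi => contractible_stack (hK i hi) hL) h0 hsum hprod
  have α : (stack n n m).obj (K.X 0) ≅ 𝟭 (BN n m) := (stack n n m).mapIso e ≪≫ oneStack
  have e' : row (stack n n m) K L 0 ≅ L :=
    (NatIso.mapHomologicalComplex α _).app L ≪≫ (Functor.mapHomologicalComplexIdIso _ _).app L
  exact ⟨h.trans (HomotopyEquiv.ofIso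
    (((Completion.incl t _).mapHomologicalComplex _).mapIso e'))⟩

/-- Stacking on the bottom a complex whose terms in nonzero degrees contain turnbacks and whose term
in degree zero is the identity diagram. -/
theorem equivTo_stackTot_flip {t : Mode} {K : CochainComplex (BN n n) ℤ}
    {L : CochainComplex (BN m n) ℤ}
    (hK : ∀ i ≠ 0, ∀ x, ((K.X i).X x).curve.JoinsAbove) (e : K.X 0 ≅ of (Curve.one n) 0)
    (h0 : K.d 0 1 = 0 ∨ K.d (-1) 0 = 0) (hL : KillsBelow L)
    (hsum : t = .sum → (∀ i > 0, Limits.IsZero (K.X i)) ∨ ∀ j < 0, Limits.IsZero (L.X j))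
    (hprod : t = .prod → (∀ i < 0, Limits.IsZero (K.X i)) ∨ ∀ j > 0, Limits.IsZero (L.X j)) :
    EquivTo (stackTot t L K) L := by
  obtain ⟨h⟩ := nonempty_homotopyEquiv_tot (F := (stack m n n).flip)
    (fun i hi => contractible_stack_flip (hK i hi) hL) h0 hsum hprod
  have α : (stack m n n).flip.obj (K.X 0) ≅ 𝟭 (BN m n) := (stack m n n).flip.mapIso e ≪≫ stackOne
  have e' : row (stack m n n).flip K L 0 ≅ L :=
    (NatIso.mapHomologicalComplex α _).app L ≪≫ (Functor.mapHomologicalComplexIdIso _ _).app L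
  exact ⟨((HomotopyEquiv.ofIso (totSwapIso (stack m n n) L K t)).trans h).trans
    (HomotopyEquiv.ofIso (((Completion.incl t _).mapHomologicalComplex _).mapIso e'))⟩

/-- Each diagram of a sum of diagrams is a retract of the sum. -/
noncomputable def retractSummand (M : BN m n) (x : M.ι) :
    Retract ((Mat_.embedding _).obj (M.X x)) M where
  i := matHom (M := (Mat_.embedding _).obj (M.X x)) (fun _ => x) (fun _ => 𝟙 _)
  r := fun j _ => (𝟙 M : M ⟶ M) j x
  retract := by
    funext i j
    refine (matHom_comp _ _ _ i j).trans ?_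
    refine (Category.id_comp _).trans ?_
    refine (Mat_.id_apply_self M x).trans ?_
    exact (Mat_.id_apply_self ((Mat_.embedding _).obj (M.X x)) i).symm

/-- If no shift of the identity diagram is a summand, then no diagram of the sum consists of
vertical strands and circles. -/
theorem ne_of_isEmpty_retract {M : BN n n}
    (h : ∀ d, IsEmpty (Retract (of (Curve.one n) d) M)) (x : M.ι) :
    ¬ ∀ t, (M.X x).curve.bd (.inl t) = (M.X x).curve.bd (.inr t) := by
  intro hx
  obtain ⟨d, ⟨r⟩⟩ := GCob.exists_retract_one _ (M.X x).curve rfl (M.X x).shift hx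
  exact (h d).false ((r.map (Mat_.embedding _)).trans (retractSummand M x))

/-- The dual of an isomorphism. -/
noncomputable def dualIso {X Y : BN m n} (e : X ≅ Y) : dualObj X ≅ dualObj Y where
  hom := dualMap e.inv
  inv := dualMap e.hom
  hom_inv_id := by rw [← dualMap_comp, e.hom_inv_id, dualMap_id]
  inv_hom_id := by rw [← dualMap_comp, e.inv_hom_id, dualMap_id]

theorem isZero_dualObj {X : BN m n} (h : Limits.IsZero X) : Limits.IsZero (dualObj X) := by
  refine (Limits.IsZero.iff_id_eq_zero _).mpr ?_
  rw [← dualMap_id, h.eq_of_src (𝟙 X) 0, dualMap_zero]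

theorem isZero_widen {x z : ℕ} {K : CochainComplex (BN m n) ℤ} {i : ℤ}
    (h : Limits.IsZero (K.X i)) : Limits.IsZero ((widen x z K).X i) :=
  (GCob.widen x z m n).mapMat_.map_isZero h

theorem nonempty_dual_one : Nonempty (dualObj (of (Curve.one n) 0) ≅ of (Curve.one n) 0) :=
  ⟨(Mat_.embedding _).mapIso (GCob.isoOfEquiv
    (X := ⟨(Curve.one n).dual, -0⟩) (Y := ⟨Curve.one n, 0⟩) (Equiv.refl _)
    (fun p => by cases p <;> rfl) (by simp))⟩

theorem nonempty_widen_one (x z y : ℕ) {K : CochainComplex (BN y y) ℤ}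
    (e : K.X 0 ≅ of (Curve.one y) 0) :
    Nonempty ((widen x z K).X 0 ≅ of (Curve.one (x + y + z)) 0) := by
  obtain ⟨e', he'⟩ := Curve.exists_equiv_widen_one x z y
  exact ⟨(GCob.widen x z y y).mapMat_.mapIso e ≪≫ (Mat_.embedding _).mapIso (GCob.isoOfEquiv
    (X := ⟨(Curve.one y).widen x z, 0⟩) (Y := ⟨Curve.one (x + y + z), 0⟩) e' he' rfl)⟩

end BN

theorem mainTheorem2 (x y z : ℕ) (P : CochainComplex (BN y y) ℤ)
    (Q : CochainComplex (BN (x + y + z) (x + y + z)) ℤ) (hP : IsUniversalProjector y P)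
    (hQ : IsUniversalProjector (x + y + z) Q) :
    ((∀ t, EquivTo (stackTot t (BN.widen x z P) Q) Q) ∧
      EquivTo (stackTot .prod (BN.widen x z (BN.dual P)) Q) Q) ∧
    ((∀ t, EquivTo (stackTot t (BN.widen x z (BN.dual P)) (BN.dual Q)) (BN.dual Q)) ∧
      EquivTo (stackTot .sum (BN.widen x z P) (BN.dual Q)) (BN.dual Q)) ∧
    ((∀ t, EquivTo (stackTot t Q (BN.widen x z P)) Q) ∧
      EquivTo (stackTot .prod Q (BN.widen x z (BN.dual P))) Q) ∧
    ((∀ t, EquivTo (stackTot t (BN.dual Q) (BN.widen x z (BN.dual P))) (BN.dual Q)) ∧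
      EquivTo (stackTot .sum (BN.dual Q) (BN.widen x z P)) (BN.dual Q)) := by
  obtain ⟨e⟩ := hP.zero
  obtain ⟨e1⟩ := BN.nonempty_widen_one x z y e
  obtain ⟨e2⟩ := BN.nonempty_widen_one x z y (K := BN.dual P)
    (BN.dualIso e ≪≫ BN.nonempty_dual_one.some)
  have hne : ∀ i ≠ 0, ∀ s, ¬ ∀ t, ((P.X i).X s).curve.bd (.inl t) =
      ((P.X i).X s).curve.bd (.inr t) :=
    fun i hi => BN.ne_of_isEmpty_retract (hP.ne_zero i hi)
  have hned : ∀ i ≠ 0, ∀ s, ¬ ∀ t, (((BN.dual P).X i).X s).curve.bd (.inl t) =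
      (((BN.dual P).X i).X s).curve.bd (.inr t) :=
    fun i hi s h => hne (-i) (neg_ne_zero.mpr hi) s fun t => (h t).symm
  have b1 : ∀ i ≠ 0, ∀ s, (((BN.widen x z P).X i).X s).curve.JoinsBelow :=
    fun i hi s => (Curve.joinsBelow_of_ne _ (hne i hi s)).widen x z
  have a1 : ∀ i ≠ 0, ∀ s, (((BN.widen x z P).X i).X s).curve.JoinsAbove :=
    fun i hi s => (Curve.joinsAbove_of_ne _ (hne i hi s)).widen x z
  have b2 : ∀ i ≠ 0, ∀ s, (((BN.widen x z (BN.dual P)).X i).X s).curve.JoinsBelow :=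
    fun i hi s => (Curve.joinsBelow_of_ne _ (hned i hi s)).widen x z
  have a2 : ∀ i ≠ 0, ∀ s, (((BN.widen x z (BN.dual P)).X i).X s).curve.JoinsAbove :=
    fun i hi s => (Curve.joinsAbove_of_ne _ (hned i hi s)).widen x z
  have z1 : ∀ i > 0, Limits.IsZero ((BN.widen x z P).X i) :=
    fun i hi => BN.isZero_widen (hP.nonpos i hi)
  have z2 : ∀ i < 0, Limits.IsZero ((BN.widen x z (BN.dual P)).X i) :=
    fun i hi => BN.isZero_widen (K := BN.dual P) (BN.isZero_dualObj (hP.nonpos (-i) (by omega)))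
  have z4 : ∀ i < 0, Limits.IsZero ((BN.dual Q).X i) :=
    fun i hi => BN.isZero_dualObj (hQ.nonpos (-i) (by omega))
  have d1 : (BN.widen x z P).d 0 1 = 0 ∨ (BN.widen x z P).d (-1) 0 = 0 :=
    .inl ((z1 1 (by omega)).eq_of_tgt _ _)
  have d2 : (BN.widen x z (BN.dual P)).d 0 1 = 0 ∨ (BN.widen x z (BN.dual P)).d (-1) 0 = 0 :=
    .inr ((z2 (-1) (by omega)).eq_of_src _ _)
  -- in each case, which complex is bounded on which side decides whether the series converges
  refine ⟨⟨fun t => ?_, ?_⟩, ⟨fun t => ?_, ?_⟩, ⟨fun t => ?_, ?_⟩, ⟨fun t => ?_, ?_⟩⟩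
  · exact BN.equivTo_stackTot b1 e1 d1 hQ.above (fun _ => .inl z1) (fun _ => .inr hQ.nonpos)
  · exact BN.equivTo_stackTot b2 e2 d2 hQ.above nofun (fun _ => .inl z2)
  · exact BN.equivTo_stackTot b2 e2 d2 hQ.below.dual (fun _ => .inr z4) (fun _ => .inl z2)
  · exact BN.equivTo_stackTot b1 e1 d1 hQ.below.dual (fun _ => .inl z1) nofun
  · exact BN.equivTo_stackTot_flip a1 e1 d1 hQ.below (fun _ => .inl z1) (fun _ => .inr hQ.nonpos)
  · exact BN.equivTo_stackTot_flip a2 e2 d2 hQ.below nofun (fun _ => .inl z2)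
  · exact BN.equivTo_stackTot_flip a2 e2 d2 hQ.above.dual (fun _ => .inr z4) (fun _ => .inl z2)
  · exact BN.equivTo_stackTot_flip a1 e1 d1 hQ.above.dual (fun _ => .inl z1) nofun
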